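/- Let $\emptyset\neq\Gamma\subseteq\mathbb R^d$ be open and convex, and let $\psi\in\mathcal D(\mathbb R^d)$. **Notation.** Let $\mathcal S'(\Gamma)$ be the space of all $f\in\mathcal D'(\mathbb R^d)$ such that $e^{-\eta\cdot x}f(x)\in\mathcal S'(\mathbb R^d)$ for all $\eta\in\Gamma$, with the projective limit topology with respect to the maps $\mathcal S'(\Gamma)\to\mathcal S'(\mathbb R^d)$, $f\mapsto e^{-\eta\cdot x}f(x)$, $\eta\in\Gamma$ (where $\mathcal S'(\mathbb R^d)$ has the strong dual topology). For a non-empty compact convex set $K$ put $h_{K}(x)=\max_{\eta\in K}x\cdot\eta$. For a positive continuous function $v$ on $\mathbb R^d$ let $Cv(\mathbb R^d)$ be the space of all $f\in C(\mathbb R^d)$ with $\|f\|_v=\sup_x|f(x)|v(x)<\infty$, normed by $\|\cdot\|_v$. Let $(K_N)_{N\in\mathbb N}$ be any increasing sequence of non-empty compact convex subsets of $\Gamma$ with $\bigcup_NK_N=\Gamma$. Let $C_\Gamma(\mathbb R^d)=\varprojlim_N C e^{h_{-K_N}}(\mathbb R^d)$, and let $\mathcal V_{\mathrm{pol}}C(\mathbb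 R^d)=\varinjlim_n C(1+|\cdot|)^{-n}(\mathbb R^d)$ (locally convex inductive limit). Let $\widehat\otimes_\varepsilon$ denote the completed $\varepsilon$-tensor product; an element $u$ of $C_\Gamma(\mathbb R^d_x)\widehat\otimes_\varepsilon\mathcal V_{\mathrm{pol}}C(\mathbb R^d_\xi)$ is identified with the function $(x,\xi)\mapsto(\delta_x\otimes\delta_\xi)(u)$ on $\mathbb R^{2d}$. For $f\in\mathcal D'(\mathbb R^d)$ put $V_\psi f(x,\xi)=\langle f,\overline{M_\xi T_x\psi}\rangle$, where $M_\xi T_x\psi(t)=e^{2\pi i\xi\cdot t}\psi(t-x)$; for $\varphi\in\mathcal D(\mathbb R^d)$ this gives $V_{\overline\psi}\varphi(x,\xi)=\int\varphi(t)\psi(t-x)e^{-2\pi i\xi\cdot t}\,dt$. The adjoint is defined by $$\langle V_\psi^*F,\varphi\rangle=\iint_{\mathbb R^{2d}}F(x,\xi)\,V_{\overline\psi}\varphi(x,-\xi)\,dx\,d\xi,\qquad\varphi\in\mathcal D(\mathbb R^d).$$ **Proposition.** (0) The identification above is injective, and it identifies $C_\Gamma(\mathbb R^d_x)\widehat\otimes_\varepsilon\mathcal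 V_{\mathrm{pol}}C(\mathbb R^d_\xi)$, as a set, with the space of all $F\in C(\mathbb R^{2d})$ such that for every $N\in\mathbb N$ there is $n\in\mathbb N$ with $$\sup_{(x,\xi)\in\mathbb R^{2d}}|F(x,\xi)|\,e^{h_{-K_N}(x)}(1+|\xi|)^{-n}<\infty .$$ (i) The map $V_\psi\colon\mathcal S'(\Gamma)\to C_\Gamma(\mathbb R^d_x)\widehat\otimes_\varepsilon\mathcal V_{\mathrm{pol}}C(\mathbb R^d_\xi)$ is well defined, linear and continuous. (ii) The map $V_\psi^*\colon C_\Gamma(\mathbb R^d_x)\widehat\otimes_\varepsilon\mathcal V_{\mathrm{pol}}C(\mathbb R^d_\xi)\to\mathcal S'(\Gamma)$ is well defined (the integrals defining $V_\psi^*F$ converge absolutely), linear and continuous. -/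

import Mathlib

open Set Filter Topology MeasureTheory
open scoped NNReal ContDiff Distributions SchwartzMap Pointwise TensorProduct ComplexConjugate

noncomputable section

/-! ### Weighted spaces of continuous functions -/

section Weighted

variable {X : Type} [TopologicalSpace X]

/-- The continuous functions `f` on `X` with `sup_x |f(x)| v(x) < ∞`, as a subspace of `C(X)`. -/
def weightedSubmodule (v : X → ℝ≥0) : Submodule ℂ C(X, ℂ) where
  carrier := {f | BddAbove (range fun x => ‖f x‖ * (v x : ℝ))}
  zero_mem' := ⟨0, by rintro _ ⟨x, rfl⟩; simp⟩
  add_mem' := by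
    rintro f g ⟨A, hA⟩ ⟨B, hB⟩
    refine ⟨A + B, ?_⟩
    rintro _ ⟨x, rfl⟩
    have h1 : ‖f x‖ * (v x : ℝ) ≤ A := hA ⟨x, rfl⟩
    have h2 : ‖g x‖ * (v x : ℝ) ≤ B := hB ⟨x, rfl⟩
    have h3 : ‖f x + g x‖ * (v x : ℝ) ≤ (‖f x‖ + ‖g x‖) * (v x : ℝ) :=
      mul_le_mul_of_nonneg_right (norm_add_le _ _) (v x).2
    show ‖(f + g) x‖ * (v x : ℝ) ≤ A + B
    rw [ContinuousMap.add_apply]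
    linarith
  smul_mem' := by
    rintro c f ⟨A, hA⟩
    refine ⟨‖c‖ * A, ?_⟩
    rintro _ ⟨x, rfl⟩
    have h1 : ‖f x‖ * (v x : ℝ) ≤ A := hA ⟨x, rfl⟩
    show ‖(c • f) x‖ * (v x : ℝ) ≤ ‖c‖ * A
    rw [ContinuousMap.smul_apply, norm_smul, mul_assoc]
    exact mul_le_mul_of_nonneg_left h1 (norm_nonneg c)

/-- The space `Cv(X)`. -/
def WeightedC (v : X → ℝ≥0) : Type := ↥(weightedSubmodule v)

namespace WeightedC

variable {v : X → ℝ≥0}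

instance : AddCommGroup (WeightedC v) := inferInstanceAs (AddCommGroup ↥(weightedSubmodule v))

instance : Module ℂ (WeightedC v) := inferInstanceAs (Module ℂ ↥(weightedSubmodule v))

/-- The underlying continuous function. -/
def toCont : WeightedC v →ₗ[ℂ] C(X, ℂ) := (weightedSubmodule v).subtype

theorem bddAbove (f : WeightedC v) : BddAbove (range fun x => ‖toCont f x‖ * (v x : ℝ)) := f.2

/-- The weighted seminorm `‖f‖_v = sup_x |f(x)| v(x)`. -/
def weightedSeminorm (v : X → ℝ≥0) : Seminorm ℂ (WeightedC v) :=
  Seminorm.ofSMulLE (fun f => ⨆ x, ‖toCont f x‖ * (v x : ℝ))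
    (by simp)
    (by
      intro f g
      have hnn : ∀ h : WeightedC v, 0 ≤ ⨆ x, ‖toCont h x‖ * (v x : ℝ) := fun h =>
        Real.iSup_nonneg fun x => mul_nonneg (norm_nonneg _) (v x).2
      refine Real.iSup_le (fun x => ?_) (add_nonneg (hnn f) (hnn g))
      have h1 := le_ciSup f.bddAbove x
      have h2 := le_ciSup g.bddAbove x
      have h3 : ‖toCont f x + toCont g x‖ * (v x : ℝ)
          ≤ (‖toCont f x‖ + ‖toCont g x‖) * (v x : ℝ) :=
        mul_le_mul_of_nonneg_right (norm_add_le _ _) (v x).2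
      rw [map_add, ContinuousMap.add_apply]
      linarith)
    (by
      intro c f
      have hnn : 0 ≤ ⨆ x, ‖toCont f x‖ * (v x : ℝ) :=
        Real.iSup_nonneg fun x => mul_nonneg (norm_nonneg _) (v x).2
      refine Real.iSup_le (fun x => ?_) (mul_nonneg (norm_nonneg c) hnn)
      rw [map_smul, ContinuousMap.smul_apply, norm_smul, mul_assoc]
      exact mul_le_mul_of_nonneg_left (le_ciSup f.bddAbove x) (norm_nonneg c))

theorem norm_apply_mul_le (f : WeightedC v) (x : X) :
    ‖toCont f x‖ * (v x : ℝ) ≤ weightedSeminorm v f :=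
  le_ciSup f.bddAbove x

instance : SeminormedAddCommGroup (WeightedC v) :=
  (weightedSeminorm v).toAddGroupSeminorm.toSeminormedAddCommGroup

/-- Evaluation at a point where the weight is positive is continuous. -/
theorem continuous_eval {x : X} (hx : 0 < v x) :
    Continuous fun f : WeightedC v => toCont f x := by
  have hx' : (0 : ℝ) < v x := hx
  refine AddMonoidHomClass.continuous_of_bound
    (((ContinuousMap.evalCLM ℂ x : C(X, ℂ) →L[ℂ] ℂ) : C(X, ℂ) →ₗ[ℂ] ℂ).comp toCont :
      WeightedC v →ₗ[ℂ] ℂ) ((v x : ℝ)⁻¹) (fun f => ?_)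
  have h := norm_apply_mul_le f x
  rw [inv_mul_eq_div, le_div_iff₀ hx']
  exact h

end WeightedC

/-- Pointwise increasing sequences of positive continuous functions. -/
structure IncreasingWeightSystem (X : Type) [TopologicalSpace X] where
  weight : ℕ → X → ℝ≥0
  pos : ∀ N x, 0 < weight N x
  cont : ∀ N, Continuous (weight N)
  mono : Monotone weight

/-- Pointwise decreasing sequences of positive continuous functions. -/
structure DecreasingWeightSystem (X : Type) [TopologicalSpace X] where
  weight : ℕ → X → ℝ≥0
  pos : ∀ N x, 0 < weight N x
  cont : ∀ N, Continuous (weight N)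
  anti : Antitone weight

/-- The space `𝒲C(X)`: the projective limit of the spaces `Cw_N(X)`. -/
def ProjC (W : IncreasingWeightSystem X) : Type :=
  ↥(⨅ N, weightedSubmodule (W.weight N) : Submodule ℂ C(X, ℂ))

namespace ProjC

variable {W : IncreasingWeightSystem X}

instance : AddCommGroup (ProjC W) :=
  inferInstanceAs (AddCommGroup ↥(⨅ N, weightedSubmodule (W.weight N) : Submodule ℂ C(X, ℂ)))

instance : Module ℂ (ProjC W) :=
  inferInstanceAs (Module ℂ ↥(⨅ N, weightedSubmodule (W.weight N) : Submodule ℂ C(X, ℂ)))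

/-- The underlying continuous function. -/
def toCont : ProjC W →ₗ[ℂ] C(X, ℂ) :=
  (⨅ N, weightedSubmodule (W.weight N) : Submodule ℂ C(X, ℂ)).subtype

/-- The canonical map `𝒲C(X) → Cw_N(X)`. -/
def proj (N : ℕ) : ProjC W →ₗ[ℂ] WeightedC (W.weight N) :=
  Submodule.inclusion (iInf_le _ N)

/-- The projective limit topology. -/
instance : TopologicalSpace (ProjC W) :=
  ⨅ N, TopologicalSpace.induced (proj (W := W) N) inferInstance

/-- The point evaluation `δ_x` on `𝒲C(X)`. -/
def eval (x : X) : ProjC W →L[ℂ] ℂ where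
  toFun f := toCont f x
  map_add' f g := by rw [map_add, ContinuousMap.add_apply]
  map_smul' c f := by rw [map_smul, ContinuousMap.smul_apply, RingHom.id_apply]
  cont := by
    have h : Continuous (proj (W := W) 0) := continuous_iInf_dom continuous_induced_dom
    exact (WeightedC.continuous_eval (W.pos 0 x)).comp h

end ProjC

/-- The union of the spaces `Cv_N(X)`. -/
def indSubmodule (V : DecreasingWeightSystem X) : Submodule ℂ C(X, ℂ) where
  carrier := {f | ∃ N, f ∈ weightedSubmodule (V.weight N)}
  zero_mem' := ⟨0, Submodule.zero_mem _⟩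
  add_mem' := by
    have key : ∀ {N M : ℕ} (_ : N ≤ M) {f : C(X, ℂ)},
        f ∈ weightedSubmodule (V.weight N) → f ∈ weightedSubmodule (V.weight M) := by
      rintro N M hNM f ⟨A, hA⟩
      refine ⟨A, ?_⟩
      rintro _ ⟨x, rfl⟩
      have h1 : ‖f x‖ * (V.weight N x : ℝ) ≤ A := hA ⟨x, rfl⟩
      have h2 : (V.weight M x : ℝ) ≤ V.weight N x := V.anti hNM x
      exact (mul_le_mul_of_nonneg_left h2 (norm_nonneg _)).trans h1
    rintro f g ⟨N, hf⟩ ⟨M, hg⟩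
    exact ⟨max N M, Submodule.add_mem _ (key (le_max_left N M) hf) (key (le_max_right N M) hg)⟩
  smul_mem' := by
    rintro c f ⟨N, hf⟩
    exact ⟨N, Submodule.smul_mem _ c hf⟩

/-- The space `𝒱C(X)`: the locally convex inductive limit of the spaces `Cv_N(X)`. -/
def IndC (V : DecreasingWeightSystem X) : Type := ↥(indSubmodule V)

namespace IndC

variable {V : DecreasingWeightSystem X}

instance : AddCommGroup (IndC V) := inferInstanceAs (AddCommGroup ↥(indSubmodule V))

instance : Module ℂ (IndC V) := inferInstanceAs (Module ℂ ↥(indSubmodule V))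

/-- The underlying continuous function. -/
def toCont : IndC V →ₗ[ℂ] C(X, ℂ) := (indSubmodule V).subtype

/-- The canonical map `Cv_N(X) → 𝒱C(X)`. -/
def incl (N : ℕ) : WeightedC (V.weight N) →ₗ[ℂ] IndC V :=
  Submodule.inclusion (fun _ hf => ⟨N, hf⟩)

/-- The locally convex inductive limit topology: the finest locally convex vector space topology
for which all the maps `Cv_N(X) → 𝒱C(X)` are continuous. -/
instance : TopologicalSpace (IndC V) :=
  sInf {t : TopologicalSpace (IndC V) |
    (∀ N, @Continuous _ _ inferInstance t (incl (V := V) N)) ∧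
    @IsTopologicalAddGroup (IndC V) t _ ∧
    @ContinuousSMul ℂ (IndC V) _ _ t ∧
    @LocallyConvexSpace ℝ (IndC V) _ _ _ (Module.complexToReal (IndC V)) t}

/-- The point evaluation `δ_x` on `𝒱C(X)`. -/
def eval (x : X) : IndC V →L[ℂ] ℂ where
  toFun f := toCont f x
  map_add' f g := by rw [map_add, ContinuousMap.add_apply]
  map_smul' c f := by rw [map_smul, ContinuousMap.smul_apply, RingHom.id_apply]
  cont := by
    let L : IndC V →ₗ[ℂ] ℂ :=
      { toFun := fun f => toCont f x
        map_add' := fun f g => by rw [map_add, ContinuousMap.add_apply]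
        map_smul' := fun c f => by
          rw [map_smul, ContinuousMap.smul_apply, RingHom.id_apply] }
    refine continuous_sInf_dom (t := TopologicalSpace.induced L inferInstance)
      ⟨fun N => ?_, ?_, ?_, ?_⟩ (continuous_induced_dom (f := L))
    · rw [continuous_induced_rng]
      exact WeightedC.continuous_eval (V.pos N x)
    · exact topologicalAddGroup_induced L
    · exact continuousSMul_induced L
    · exact LocallyConvexSpace.induced (L.restrictScalars ℝ)

end IndC

end Weighted

/-! ### The completed `ε`-tensor product -/

section Eps

variable (E F : Type)
  [AddCommGroup E] [Module ℂ E] [TopologicalSpace E]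
  [AddCommGroup F] [Module ℂ F] [TopologicalSpace F]

/-- The algebraic tensor product `E ⊗ F`, to be endowed with the `ε`-topology. -/
def EpsTensor : Type := E ⊗[ℂ] F

instance : AddCommGroup (EpsTensor E F) := inferInstanceAs (AddCommGroup (E ⊗[ℂ] F))

instance : Module ℂ (EpsTensor E F) := inferInstanceAs (Module ℂ (E ⊗[ℂ] F))

/-- The products `A × B` of equicontinuous sets `A ⊆ E'` and `B ⊆ F'`. -/
def equicontinuousRectangles : Set (Set ((E →L[ℂ] ℂ) × (F →L[ℂ] ℂ))) :=
  {P | ∃ (A : Set (E →L[ℂ] ℂ)) (B : Set (F →L[ℂ] ℂ)),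
    Equicontinuous (fun (φ : A) (e : E) => (φ : E →L[ℂ] ℂ) e) ∧
    Equicontinuous (fun (χ : B) (f : F) => (χ : F →L[ℂ] ℂ) f) ∧ P = A ×ˢ B}

variable {E F}

/-- The linear form `φ ⊗ χ` on `E ⊗ F`. -/
def EpsTensor.pairing (φ : E →L[ℂ] ℂ) (χ : F →L[ℂ] ℂ) : EpsTensor E F →ₗ[ℂ] ℂ :=
  LinearMap.mul' ℂ ℂ ∘ₗ TensorProduct.map (φ : E →ₗ[ℂ] ℂ) (χ : F →ₗ[ℂ] ℂ)

variable (E F)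

/-- An element `t` of `E ⊗ F` as the function `(φ, χ) ↦ (φ ⊗ χ)(t)` on `E' × F'`. -/
def EpsTensor.toFun : EpsTensor E F →ₗ[ℂ]
    UniformOnFun ((E →L[ℂ] ℂ) × (F →L[ℂ] ℂ)) ℂ (equicontinuousRectangles E F) where
  toFun t := UniformOnFun.ofFun _ fun P => EpsTensor.pairing P.1 P.2 t
  map_add' s t := by
    refine congrArg (UniformOnFun.ofFun _) (funext fun P => ?_)
    exact map_add (EpsTensor.pairing P.1 P.2) s t
  map_smul' c t := by
    refine congrArg (UniformOnFun.ofFun _) (funext fun P => ?_)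
    exact map_smul (EpsTensor.pairing P.1 P.2) c t

/-- The `ε`-topology on `E ⊗ F` (with its uniformity): uniform convergence on the products of
equicontinuous subsets of `E'` and `F'`. -/
instance : UniformSpace (EpsTensor E F) :=
  UniformSpace.comap (EpsTensor.toFun E F) inferInstance

instance : IsUniformAddGroup (EpsTensor E F) :=
  IsUniformAddGroup.comap (EpsTensor.toFun E F)

instance : UniformContinuousConstSMul ℂ (EpsTensor E F) where
  uniformContinuous_const_smul c := by
    have hi : IsUniformInducing (EpsTensor.toFun E F) := ⟨rfl⟩
    rw [hi.uniformContinuous_iff]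
    have h := UniformOnFun.postcomp_uniformContinuous
      (α := (E →L[ℂ] ℂ) × (F →L[ℂ] ℂ)) (𝔖 := equicontinuousRectangles E F)
      (uniformContinuous_const_smul (M := ℂ) (X := ℂ) c)
    convert h.comp hi.uniformContinuous using 1
    exact funext fun t => map_smul (EpsTensor.toFun E F) c t

/-- The completed `ε`-tensor product `E ⊗̂_ε F`. -/
abbrev CompletedEpsTensor : Type := UniformSpace.Completion (EpsTensor E F)

variable {E F}

theorem EpsTensor.uniformContinuous_pairing (φ : E →L[ℂ] ℂ) (χ : F →L[ℂ] ℂ) :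
    UniformContinuous (EpsTensor.pairing φ χ) := by
  have hi : IsUniformInducing (EpsTensor.toFun E F) := ⟨rfl⟩
  have hmem : ({φ} ×ˢ {χ} : Set ((E →L[ℂ] ℂ) × (F →L[ℂ] ℂ))) ∈ equicontinuousRectangles E F :=
    ⟨{φ}, {χ}, equicontinuous_finite.2 fun a => a.1.continuous,
      equicontinuous_finite.2 fun b => b.1.continuous, rfl⟩
  have h := UniformOnFun.uniformContinuous_eval_of_mem (β := ℂ)
    (𝔖 := equicontinuousRectangles E F) (x := (φ, χ)) (by simp) hmem
  exact h.comp hi.uniformContinuous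

/-- The continuous extension of `φ ⊗ χ` to `E ⊗̂_ε F`. -/
def CompletedEpsTensor.pairing (φ : E →L[ℂ] ℂ) (χ : F →L[ℂ] ℂ) :
    CompletedEpsTensor E F → ℂ :=
  UniformSpace.Completion.extension (EpsTensor.pairing φ χ)

theorem CompletedEpsTensor.pairing_coe (φ : E →L[ℂ] ℂ) (χ : F →L[ℂ] ℂ) (t : EpsTensor E F) :
    CompletedEpsTensor.pairing φ χ (t : CompletedEpsTensor E F) = EpsTensor.pairing φ χ t :=
  UniformSpace.Completion.extension_coe (EpsTensor.uniformContinuous_pairing φ χ) t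

end Eps

/-- The function on `X × Y` that an element of `𝒲C(X) ⊗̂_ε 𝒱C(Y)` represents: its value at
`(x, y)` is `(δ_x ⊗ δ_y)(u)`; in particular `f ⊗ g` represents `(x, y) ↦ f(x) g(y)`. -/
def toFunction {X Y : Type} [TopologicalSpace X] [TopologicalSpace Y]
    {W : IncreasingWeightSystem X} {V : DecreasingWeightSystem Y}
    (u : CompletedEpsTensor (ProjC W) (IndC V)) (p : X × Y) : ℂ :=
  CompletedEpsTensor.pairing (ProjC.eval p.1) (IndC.eval p.2) u

/-! ### The weights -/

/-- The space `ℝ^d` with the Euclidean norm and inner product. -/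
abbrev Rd (d : ℕ) : Type := EuclideanSpace ℝ (Fin d)

section Weights

variable {d : ℕ}

/-- The supporting function `h_K(x) = max_{η ∈ K} x · η` of a set `K`. -/
def supportingFunction (K : Set (Rd d)) (x : Rd d) : ℝ :=
  sSup ((fun η => inner ℝ x η) '' K)

/-- A sequence of non-empty compact convex subsets `K_N` of `Γ`, increasing with union `Γ`. -/
structure CCSExhaustion (Γ : Set (Rd d)) where
  set : ℕ → Set (Rd d)
  nonempty : ∀ N, (set N).Nonempty
  isCompact : ∀ N, IsCompact (set N)
  convex : ∀ N, Convex ℝ (set N)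
  mono : Monotone set
  iUnion_eq : ⋃ N, set N = Γ

theorem continuous_supportingFunction {K : Set (Rd d)} (hK : IsCompact K) :
    Continuous (supportingFunction K) :=
  hK.continuous_sSup (f := fun x η : Rd d => inner ℝ x η) (by fun_prop)

theorem supportingFunction_mono {K L : Set (Rd d)} (hK : K.Nonempty) (hL : IsCompact L)
    (h : K ⊆ L) (x : Rd d) : supportingFunction K x ≤ supportingFunction L x :=
  csSup_le_csSup (hL.image (by fun_prop)).bddAbove (hK.image _) (image_mono h)

/-- The increasing weight system `(e^{h_{-K_N}})_N`. -/
def CCSExhaustion.weights {Γ : Set (Rd d)} (K : CCSExhaustion Γ) :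
    IncreasingWeightSystem (Rd d) where
  weight N x := ⟨Real.exp (supportingFunction (-K.set N) x), (Real.exp_pos _).le⟩
  pos _ _ := Real.exp_pos _
  cont N := (Real.continuous_exp.comp
    (continuous_supportingFunction (K.isCompact N).neg)).subtype_mk _
  mono N M hNM x := Real.exp_le_exp.2 <|
    supportingFunction_mono (K.nonempty N).neg (K.isCompact M).neg
      (Set.neg_subset_neg.2 (K.mono hNM)) x

variable (d)

/-- The decreasing weight system `((1 + |·|)^{-n})_n`. -/
def polWeights : DecreasingWeightSystem (Rd d) where
  weight n ξ := ((1 + ‖ξ‖₊) ^ n)⁻¹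
  pos n ξ := by positivity
  cont n := by
    refine Continuous.inv₀ (by fun_prop) fun ξ => ?_
    positivity
  anti n m hnm ξ := by
    show ((1 + ‖ξ‖₊) ^ m)⁻¹ ≤ ((1 + ‖ξ‖₊) ^ n)⁻¹
    gcongr
    exact le_self_add

variable {d}

/-- The space `C_Γ(ℝ^d)`. -/
abbrev CGamma {Γ : Set (Rd d)} (K : CCSExhaustion Γ) : Type := ProjC K.weights

/-- The space `C_Γ(ℝ^d_x) ⊗̂_ε 𝒱_pol C(ℝ^d_ξ)`. -/
abbrev CGammaTensorPol {Γ : Set (Rd d)} (K : CCSExhaustion Γ) : Type :=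
  CompletedEpsTensor (CGamma K) (IndC (polWeights d))

end Weights

/-! ### Laplace transformable distributions -/

section Laplace

variable {d : ℕ}

/-- The test function space `𝒟(ℝ^d)`. -/
abbrev TestFn (d : ℕ) : Type := 𝓓((⊤ : TopologicalSpace.Opens (Rd d)), ℂ)

/-- The space of distributions `𝒟'(ℝ^d)`. -/
abbrev Distr (d : ℕ) : Type := TestFn d →L[ℂ] ℂ

/-- The space `𝒮'(ℝ^d)` with the strong dual topology. -/
abbrev Temp (d : ℕ) : Type := 𝓢(Rd d, ℂ) →L[ℂ] ℂ

/-- The product of a test function with a smooth function. -/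
def TestFn.mulSmooth (g : Rd d → ℂ) (hg : ContDiff ℝ ∞ g) (φ : TestFn d) : TestFn d where
  toFun x := g x * φ x
  contDiff' := hg.mul φ.contDiff
  hasCompactSupport' := φ.hasCompactSupport.mul_left
  tsupport_subset' _ _ := trivial

/-- The test function `x ↦ e^{-η · x} φ(x)`. -/
def expTwist (η : Rd d) (φ : TestFn d) : TestFn d :=
  TestFn.mulSmooth (fun x => Complex.exp (-((inner ℝ η x : ℝ) : ℂ)))
    (by
      refine ContDiff.cexp (ContDiff.neg ?_)
      exact Complex.ofRealCLM.contDiff.comp (contDiff_const.inner ℝ contDiff_id)) φ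

/-- A test function as a rapidly decreasing function. -/
def TestFn.toSchwartz (φ : TestFn d) : 𝓢(Rd d, ℂ) :=
  φ.hasCompactSupport.toSchwartzMap φ.contDiff

/-- The tempered distribution `u` is `e^{-η · x} f(x)`. -/
def IsExpTwist (f : Distr d) (η : Rd d) (u : Temp d) : Prop :=
  ∀ φ : TestFn d, u φ.toSchwartz = f (expTwist η φ)

theorem expTwist_add (η : Rd d) (φ χ : TestFn d) :
    expTwist η (φ + χ) = expTwist η φ + expTwist η χ := by
  ext x
  exact mul_add _ _ _

/-- The distributions `f` such that `e^{-η · x} f(x)` is tempered for all `η ∈ Γ`. -/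
def laplaceSubmodule (Γ : Set (Rd d)) : Submodule ℂ (Distr d) where
  carrier := {f | ∀ η ∈ Γ, ∃ u : Temp d, IsExpTwist f η u}
  zero_mem' η _ := ⟨0, fun _ => rfl⟩
  add_mem' := by
    intro f g hf hg η hη
    obtain ⟨u, hu⟩ := hf η hη
    obtain ⟨w, hw⟩ := hg η hη
    exact ⟨u + w, fun φ => congrArg₂ (· + ·) (hu φ) (hw φ)⟩
  smul_mem' := by
    intro c f hf η hη
    obtain ⟨u, hu⟩ := hf η hη
    exact ⟨c • u, fun φ => congrArg (c • ·) (hu φ)⟩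

/-- The space `𝒮'(Γ)` of Laplace transformable distributions. -/
def LaplaceDistr (Γ : Set (Rd d)) : Type := ↥(laplaceSubmodule Γ)

namespace LaplaceDistr

variable {Γ : Set (Rd d)}

instance : AddCommGroup (LaplaceDistr Γ) := inferInstanceAs (AddCommGroup ↥(laplaceSubmodule Γ))

instance : Module ℂ (LaplaceDistr Γ) := inferInstanceAs (Module ℂ ↥(laplaceSubmodule Γ))

/-- The inclusion `𝒮'(Γ) → 𝒟'(ℝ^d)`. -/
def toDistr : LaplaceDistr Γ →ₗ[ℂ] Distr d := (laplaceSubmodule Γ).subtype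

/-- The map `𝒮'(Γ) → 𝒮'(ℝ^d)`, `f ↦ e^{-η · x} f(x)`. (The tempered distribution is determined by
its values on the dense subspace of test functions.) -/
def twist (η : Γ) (f : LaplaceDistr Γ) : Temp d := (f.2 η η.2).choose

theorem twist_spec (η : Γ) (f : LaplaceDistr Γ) : IsExpTwist (toDistr f) η (twist η f) :=
  (f.2 η η.2).choose_spec

/-- The projective limit topology with respect to the maps `f ↦ e^{-η · x} f(x)`, `η ∈ Γ`. -/
instance : TopologicalSpace (LaplaceDistr Γ) :=
  ⨅ η : Γ, TopologicalSpace.induced (twist η) inferInstance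

end LaplaceDistr

/-! ### The short-time Fourier transform -/

/-- The test function `t ↦ conj (M_ξ T_x ψ (t)) = conj (e^{2πi ξ · t} ψ(t - x))`. -/
def conjTimeFreqShift (ψ : TestFn d) (x ξ : Rd d) : TestFn d where
  toFun t := conj (Complex.exp (2 * Real.pi * Complex.I * ((inner ℝ ξ t : ℝ) : ℂ)) * ψ (t - x))
  contDiff' := by
    refine Complex.conjCLE.contDiff.comp (ContDiff.mul ?_ ?_)
    · refine ContDiff.cexp (contDiff_const.mul ?_)
      exact Complex.ofRealCLM.contDiff.comp (contDiff_const.inner ℝ contDiff_id)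
    · exact ψ.contDiff.comp (contDiff_id.sub contDiff_const)
  hasCompactSupport' := by
    have h : HasCompactSupport fun t : Rd d => ψ (t - x) :=
      ψ.hasCompactSupport.comp_homeomorph (Homeomorph.subRight x)
    exact (h.mul_left (f := fun t =>
      Complex.exp (2 * Real.pi * Complex.I * ((inner ℝ ξ t : ℝ) : ℂ)))).comp_left (map_zero _)
  tsupport_subset' _ _ := trivial

/-- The STFT `V_ψ f(x, ξ) = ⟨f, conj (M_ξ T_x ψ)⟩` of a distribution `f`. -/
def stftDistr (ψ : TestFn d) (f : Distr d) (x ξ : Rd d) : ℂ := f (conjTimeFreqShift ψ x ξ)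

/-- The STFT `V_ψ f(x, ξ) = ∫ f(t) conj (ψ(t - x)) e^{-2πi ξ · t} dt` of a function `f`. -/
def stftFun (ψ f : Rd d → ℂ) (x ξ : Rd d) : ℂ :=
  ∫ t, f t * conj (ψ (t - x)) * Complex.exp (-(2 * Real.pi * Complex.I * ((inner ℝ ξ t : ℝ) : ℂ)))

/-- The integrand `F(x, ξ) V_{conj ψ} φ(x, -ξ)` in the definition of the adjoint STFT:
`⟨V_ψ^* F, φ⟩ = ∫∫ F(x, ξ) V_{conj ψ} φ(x, -ξ) dx dξ`. -/
def adjointIntegrand (ψ : TestFn d) (F : Rd d × Rd d → ℂ) (φ : TestFn d) (p : Rd d × Rd d) : ℂ :=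
  F p * stftFun (fun t => conj (ψ t)) φ p.1 (-p.2)

/-- The distribution `g` is the adjoint STFT `V_ψ^* F` (the defining integrals being absolutely
convergent). -/
def IsAdjointSTFT (ψ : TestFn d) (F : Rd d × Rd d → ℂ) (g : Distr d) : Prop :=
  ∀ φ : TestFn d, Integrable (adjointIntegrand ψ F φ) ∧ g φ = ∫ p, adjointIntegrand ψ F φ p

end Laplace

end

/-! The proof replaces the abstract completed tensor product by a concrete function space. `EpsModel
K` consists of the continuous `F` on ℝ^{2d} for which `|F(x,ξ)| e^{h_{-K_N}(x)} v(ξ)` is bounded for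
every `N` and every rapidly decreasing `v ≥ 0` (continuous or not), with the topology of these
seminorms. It is complete and Hausdorff. The algebraic tensor product maps into it by `f ⊗ g ↦ f(x)
g(ξ)`, and this map is uniformly inducing with dense range. Uniqueness of completions then
identifies the two spaces.

Inducing: the sets `{w_N(x) δ_x}` and `{v(ξ) δ_ξ}` are equicontinuous, so the seminorms of the model
are ε-continuous. Conversely, an equicontinuous set of forms on `C_Γ` is dominated by one norm. An
equicontinuous set on the inductive limit is dominated on each step by a multiple `C_n` of the norm;
`IndC.norm_apply_le_of_rapidMinorant` turns the sequence `C_n` into one rapidly decreasing weight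
`v` with `|χ(g)| ≤ sup v|g|`.

Density: truncations of `F` are approximated on compact sets by Stone–Weierstrass. They converge to
`F` because Γ is open, which lets `e^{h_{-K_N}(x)}` be multiplied by `e^{r|x|}` at the price of a
larger `N` (`exists_finset_dominating`). The growth description of the space follows since
boundedness against all rapidly decreasing `v` is polynomial growth in `ξ`.

For `V_ψ`, let `u = e^{-η·x} f`. Then `V_ψ f(x,ξ) = e^{η·x} u(M_{-ξ} T_x w_η)` with a Schwartz
window `w_η`. Choosing `η` from a finite set according to `x` makes `e^{η·x} e^{h_{-K_N}(x)} ≤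
e^{-r|x|}`. The functions `e^{-r|x|} v(ξ) M_{-ξ} T_x w_η` form a bounded set in the Schwartz space,
so the strong topology controls the weighted STFT.

For the adjoint, the STFT of `φ` decays rapidly in both variables, uniformly for `φ` in a bounded
set. Moving `e^{-η·t}` from `φ` onto the window leaves a factor `e^{-η·x}`, which is absorbed by
`e^{h_{-K_N}(x)}` as soon as `η ∈ K_N`. The integrals are thus dominated by a seminorm of the model
times a fixed integrable function. -/

noncomputable section

/-! ### Spaces of continuous functions with a family of weights -/

section MultiWeighted

variable {X ι : Type} [TopologicalSpace X]

/-- The continuous functions that are bounded with respect to each weight of a family. -/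
def MultiC (c : ι → X → ℝ≥0) : Type :=
  ↥(⨅ i, weightedSubmodule (c i) : Submodule ℂ C(X, ℂ))

namespace MultiC

variable {c : ι → X → ℝ≥0}

instance : AddCommGroup (MultiC c) :=
  inferInstanceAs (AddCommGroup ↥(⨅ i, weightedSubmodule (c i) : Submodule ℂ C(X, ℂ)))

instance : Module ℂ (MultiC c) :=
  inferInstanceAs (Module ℂ ↥(⨅ i, weightedSubmodule (c i) : Submodule ℂ C(X, ℂ)))

/-- The underlying continuous function. -/
def toCont : MultiC c →ₗ[ℂ] C(X, ℂ) :=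
  (⨅ i, weightedSubmodule (c i) : Submodule ℂ C(X, ℂ)).subtype

theorem toCont_injective : Function.Injective (toCont (c := c)) := Subtype.val_injective

theorem exists_bound (F : MultiC c) (i : ι) : ∃ C, ∀ p, ‖toCont F p‖ * (c i p : ℝ) ≤ C := by
  obtain ⟨C, hC⟩ := (Submodule.mem_iInf _).1 F.2 i
  exact ⟨C, fun p => hC ⟨p, rfl⟩⟩

/-- A continuous function bounded with respect to each weight. -/
def mk (F : C(X, ℂ)) (h : ∀ i, ∃ C, ∀ p, ‖F p‖ * (c i p : ℝ) ≤ C) : MultiC c :=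
  ⟨F, (Submodule.mem_iInf _).2 fun i =>
    ⟨(h i).choose, by rintro _ ⟨p, rfl⟩; exact (h i).choose_spec p⟩⟩

/-- The function `c_i F`. -/
def scaled (i : ι) : MultiC c →+ UniformFun X ℂ where
  toFun F := UniformFun.ofFun fun p => ((c i p : ℝ) : ℂ) * toCont F p
  map_zero' := by
    refine congrArg UniformFun.ofFun (funext fun p => ?_)
    simp
  map_add' F G := by
    refine congrArg UniformFun.ofFun (funext fun p => ?_)
    rw [map_add, ContinuousMap.add_apply]
    exact mul_add _ _ _

/-- The uniformity of weighted uniform convergence. -/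
instance : UniformSpace (MultiC c) := ⨅ i, UniformSpace.comap (scaled i) inferInstance

instance : IsUniformAddGroup (MultiC c) :=
  isUniformAddGroup_iInf fun i => IsUniformAddGroup.comap (scaled i)

theorem tendsto_iff {α : Type*} {l : Filter α} {G : α → MultiC c} {F : MultiC c} :
    Tendsto G l (𝓝 F) ↔ ∀ i, TendstoUniformly
      (fun a p => ((c i p : ℝ) : ℂ) * toCont (G a) p) (fun p => ((c i p : ℝ) : ℂ) * toCont F p) l := by
  have h : (UniformSpace.toTopologicalSpace : TopologicalSpace (MultiC c)) =
      ⨅ i, TopologicalSpace.induced (scaled i) inferInstance := UniformSpace.toTopologicalSpace_iInf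
  rw [h, nhds_iInf, tendsto_iInf]
  refine forall_congr' fun i => ?_
  rw [nhds_induced, tendsto_comap_iff, UniformFun.tendsto_iff_tendstoUniformly]
  rfl

theorem norm_scaled_sub (i : ι) (F G : MultiC c) (p : X) :
    dist (((c i p : ℝ) : ℂ) * toCont F p) (((c i p : ℝ) : ℂ) * toCont G p) =
      ‖toCont (F - G) p‖ * c i p := by
  rw [dist_eq_norm, ← mul_sub, map_sub, ContinuousMap.sub_apply, norm_mul, mul_comm]
  simp

theorem tendsto_iff_norm {α : Type*} {l : Filter α} {G : α → MultiC c} {F : MultiC c} :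
    Tendsto G l (𝓝 F) ↔ ∀ i, ∀ ε > 0, ∀ᶠ a in l, ∀ p, ‖toCont (F - G a) p‖ * c i p < ε := by
  rw [tendsto_iff]
  refine forall_congr' fun i => ?_
  rw [Metric.tendstoUniformly_iff]
  simp only [norm_scaled_sub]

theorem continuous_eval {i : ι} {p : X} (h : 0 < c i p) :
    Continuous fun F : MultiC c => toCont F p := by
  have h' : (0 : ℝ) < c i p := h
  refine continuous_iff_continuousAt.2 fun F => ?_
  refine Metric.tendsto_nhds.2 fun ε hε => ?_
  have h1 := tendsto_iff_norm.1 (tendsto_id (α := MultiC c) (x := 𝓝 F)) i (ε * c i p) (by positivity)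
  filter_upwards [h1] with G hG
  have h2 := hG p
  rw [id, map_sub, ContinuousMap.sub_apply, ← dist_eq_norm, dist_comm] at h2
  exact lt_of_mul_lt_mul_right h2 h'.le

theorem t0Space (h : ∀ p, ∃ i, 0 < c i p) : T0Space (MultiC c) := by
  have : T2Space (MultiC c) := by
    refine ⟨fun F G hFG => ?_⟩
    obtain ⟨p, hp⟩ : ∃ p, toCont F p ≠ toCont G p := by
      by_contra! hcon
      exact hFG (toCont_injective (ContinuousMap.ext hcon))
    obtain ⟨i, hi⟩ := h p
    exact separated_by_continuous (continuous_eval hi) hp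
  infer_instance

/-- The one positive continuous weight `c i₀` produces the pointwise limit and its continuity. The
other weights may vanish or jump: for them a uniform Cauchy condition and the known pointwise limit
suffice. -/
theorem completeSpace (i₀ : ι) (hpos : ∀ p, 0 < c i₀ p) (hcont : Continuous (c i₀)) :
    CompleteSpace (MultiC c) := by
  refine ⟨fun {l} hl => ?_⟩
  have hne : l.NeBot := hl.1
  have hcs : ∀ i, Cauchy (map (scaled (c := c) i) l) := fun i =>
    hl.map ((uniformContinuous_iInf_dom (i := i) uniformContinuous_comap))
  have hUC : ∀ i, UniformCauchySeqOn (fun (F : MultiC c) p => ((c i p : ℝ) : ℂ) * toCont F p)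
      l univ := by
    intro i u hu
    have h1 := (hcs i).2
    rw [prod_map_map_eq, UniformFun.hasBasis_uniformity X ℂ |>.ge_iff] at h1
    filter_upwards [h1 u hu] with G hG p _
    exact hG p
  have hpt : ∀ p, ∃ z, Tendsto (fun F : MultiC c => ((c i₀ p : ℝ) : ℂ) * toCont F p) l (𝓝 z) :=
    fun p => cauchy_map_iff_exists_tendsto.1 ((hUC i₀).cauchy_map (mem_univ p))
  choose z hz using hpt
  have hc : ∀ p, ((c i₀ p : ℝ) : ℂ) ≠ 0 := fun p => by
    have := hpos p
    exact_mod_cast this.ne'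
  have hlim : ∀ p, Tendsto (fun F : MultiC c => toCont F p) l (𝓝 (((c i₀ p : ℝ) : ℂ)⁻¹ * z p)) := by
    intro p
    refine ((hz p).const_mul (((c i₀ p : ℝ) : ℂ)⁻¹)).congr fun F => ?_
    rw [inv_mul_cancel_left₀ (hc p)]
  have hTU : ∀ i, TendstoUniformly (fun (F : MultiC c) p => ((c i p : ℝ) : ℂ) * toCont F p)
      (fun p => ((c i p : ℝ) : ℂ) * (((c i₀ p : ℝ) : ℂ)⁻¹ * z p)) l := by
    intro i
    rw [← tendstoUniformlyOn_univ]
    exact (hUC i).tendstoUniformlyOn_of_tendsto fun p _ => (hlim p).const_mul _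
  have hcc : Continuous fun p => ((c i₀ p : ℝ) : ℂ) := by fun_prop
  have hzc : Continuous fun p => ((c i₀ p : ℝ) : ℂ)⁻¹ * z p := by
    have h1 : Continuous fun p => ((c i₀ p : ℝ) : ℂ) * (((c i₀ p : ℝ) : ℂ)⁻¹ * z p) :=
      (hTU i₀).continuous (Eventually.of_forall fun F => hcc.mul (toCont F).continuous).frequently
    refine (hcc.inv₀ hc |>.mul h1).congr fun p => ?_
    exact inv_mul_cancel_left₀ (hc p) _
  have hb : ∀ i, ∃ C, ∀ p, ‖((c i₀ p : ℝ) : ℂ)⁻¹ * z p‖ * (c i p : ℝ) ≤ C := by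
    intro i
    obtain ⟨F, hF⟩ := (Metric.tendstoUniformly_iff.1 (hTU i) 1 one_pos).exists
    obtain ⟨C, hC⟩ := F.exists_bound i
    refine ⟨1 + C, fun p => ?_⟩
    have h1 := hF p
    rw [dist_eq_norm] at h1
    have h2 := norm_le_insert' (((c i p : ℝ) : ℂ) * (((c i₀ p : ℝ) : ℂ)⁻¹ * z p))
      (((c i p : ℝ) : ℂ) * toCont F p)
    have h3 := hC p
    have h4 : ∀ w : ℂ, ‖((c i p : ℝ) : ℂ) * w‖ = ‖w‖ * c i p := fun w => by
      rw [norm_mul, mul_comm]; simp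
    rw [h4, h4] at h2
    linarith
  refine ⟨mk ⟨_, hzc⟩ hb, ?_⟩
  exact tendsto_iff.2 hTU

end MultiC

end MultiWeighted

/-! ### Equicontinuous sets of linear forms and seminorm bounds -/

/-- A linear form bounded by `1` on the ball `{q < r}` of a seminorm is bounded by `r⁻¹ q`. -/
theorem LinearMap.norm_le_of_seminorm_ball {E : Type} [AddCommGroup E] [Module ℂ E]
    (L : E →ₗ[ℂ] ℂ) (q : Seminorm ℂ E) {r : ℝ} (hr : 0 < r) (h : ∀ f, q f < r → ‖L f‖ ≤ 1) (f : E) :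
    ‖L f‖ ≤ r⁻¹ * q f := by
  by_contra! hlt
  have h0 : 0 ≤ r⁻¹ * q f := mul_nonneg (by positivity) (apply_nonneg q f)
  -- Scaling by a number strictly between the two sides, rather than by `q f`, also covers `q f =
  -- 0`.
  obtain ⟨t, ht1, ht2⟩ := exists_between hlt
  have ht : 0 < t := h0.trans_lt ht1
  have hq : q ((t⁻¹ : ℂ) • f) < r := by
    rw [map_smul_eq_mul, norm_inv, Complex.norm_real, Real.norm_of_nonneg ht.le,
      inv_mul_lt_iff₀ ht]
    rw [inv_mul_lt_iff₀ hr] at ht1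
    linarith
  have h1 := h _ hq
  rw [map_smul, norm_smul, norm_inv, Complex.norm_real, Real.norm_of_nonneg ht.le,
    inv_mul_le_iff₀ ht] at h1
  linarith

namespace WeightedC

variable {X : Type} [TopologicalSpace X] {v : X → ℝ≥0}

theorem norm_eq (f : WeightedC v) : ‖f‖ = weightedSeminorm v f := rfl

instance : NormedSpace ℂ (WeightedC v) where
  norm_smul_le c f := (map_smul_eq_mul (weightedSeminorm v) c f).le

theorem norm_le {f : WeightedC v} {C : ℝ} (hC : 0 ≤ C)
    (h : ∀ x, ‖toCont f x‖ * (v x : ℝ) ≤ C) : ‖f‖ ≤ C :=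
  Real.iSup_le h hC

end WeightedC

namespace ProjC

variable {X : Type} [TopologicalSpace X] {W : IncreasingWeightSystem X}

theorem continuous_proj (N : ℕ) : Continuous (proj (W := W) N) :=
  continuous_iInf_dom continuous_induced_dom

theorem norm_proj_mono {N M : ℕ} (h : N ≤ M) (f : ProjC W) : ‖proj N f‖ ≤ ‖proj M f‖ := by
  refine WeightedC.norm_le (norm_nonneg _) fun x => ?_
  refine le_trans ?_ (WeightedC.norm_apply_mul_le (proj M f) x)
  exact mul_le_mul_of_nonneg_left (W.mono h x) (norm_nonneg _)

/-- The weights increase, so the defining norms are directed and a neighbourhood of `0` contains a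
ball of a single one. On that ball all forms of `A` are bounded by `1`. -/
theorem exists_norm_le_of_equicontinuous {A : Set (ProjC W →L[ℂ] ℂ)}
    (hA : Equicontinuous (fun (φ : A) (e : ProjC W) => (φ : ProjC W →L[ℂ] ℂ) e)) :
    ∃ (N : ℕ) (C : ℝ), 0 ≤ C ∧ ∀ φ ∈ A, ∀ f, ‖φ f‖ ≤ C * ‖proj N f‖ := by
  have h0 := Metric.equicontinuousAt_iff_right.1 (hA 0) 1 one_pos
  have hn : 𝓝 (0 : ProjC W) = ⨅ N, comap (proj (W := W) N) (𝓝 0) := by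
    rw [nhds_iInf]
    simp only [nhds_induced, map_zero]
  have hdir : Directed (· ≥ ·) fun N => comap (proj (W := W) N) (𝓝 0) := by
    refine directed_of_isDirected_le fun N M hNM => ?_
    rw [ge_iff_le, (Metric.nhds_basis_ball.comap _).ge_iff]
    intro r hr
    refine ⟨Metric.ball 0 r, Metric.ball_mem_nhds _ hr, fun f hf => ?_⟩
    simp only [mem_preimage, mem_ball_zero_iff] at hf ⊢
    exact (norm_proj_mono hNM f).trans_lt hf
  rw [hn, Filter.Eventually, mem_iInf_of_directed hdir] at h0
  obtain ⟨N, hN⟩ := h0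
  obtain ⟨r, hr, hsub⟩ := (Metric.nhds_basis_ball.comap (proj (W := W) N)).mem_iff.1 hN
  refine ⟨N, r⁻¹, by positivity, fun φ hφ f => ?_⟩
  refine (φ : ProjC W →ₗ[ℂ] ℂ).norm_le_of_seminorm_ball
    ((WeightedC.weightedSeminorm (W.weight N)).comp (proj N)) hr (fun g hg => ?_) f
  have h1 := hsub (show g ∈ _ by simpa [WeightedC.norm_eq] using hg) ⟨φ, hφ⟩
  simp only [map_zero, dist_zero_left] at h1
  exact h1.le

theorem equicontinuous_weighted_eval (N : ℕ) :
    Equicontinuous (fun (φ : range fun x => (((W.weight N x : ℝ) : ℂ) • eval (W := W) x))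
      (e : ProjC W) => (φ : ProjC W →L[ℂ] ℂ) e) := by
  intro f
  rw [Metric.equicontinuousAt_iff_right]
  intro ε hε
  filter_upwards [Metric.continuousAt_iff'.1 (continuous_proj (W := W) N).continuousAt ε hε]
    with g hg
  rintro ⟨_, x, rfl⟩
  refine lt_of_le_of_lt ?_ hg
  rw [dist_comm, dist_eq_norm, dist_eq_norm, ← map_sub, ← map_sub]
  refine le_trans (le_of_eq ?_) (WeightedC.norm_apply_mul_le (proj N (g - f)) x)
  change ‖((W.weight N x : ℝ) : ℂ) * toCont (g - f) x‖ = ‖toCont (g - f) x‖ * _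
  rw [norm_mul, mul_comm]
  simp

end ProjC

namespace IndC

variable {X : Type} [TopologicalSpace X] {V : DecreasingWeightSystem X}

theorem continuous_incl (N : ℕ) : Continuous (incl (V := V) N) :=
  continuous_sInf_rng.2 fun _ ht => ht.1 N

/-- Only the continuity of the step inclusions enters. The constants depend on `n` but not on the
form in `B`, and this sequence of constants is all that is needed later about neighbourhoods of `0`
in the inductive limit. -/
theorem exists_norm_incl_le_of_equicontinuous {B : Set (IndC V →L[ℂ] ℂ)}
    (hB : Equicontinuous (fun (χ : B) (f : IndC V) => (χ : IndC V →L[ℂ] ℂ) f)) (n : ℕ) :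
    ∃ C : ℝ, 0 ≤ C ∧ ∀ χ ∈ B, ∀ g, ‖χ (incl n g)‖ ≤ C * ‖g‖ := by
  have h0 := Metric.equicontinuousAt_iff_right.1 (hB 0) 1 one_pos
  have h1 : Tendsto (incl (V := V) n) (𝓝 0) (𝓝 0) := by
    have := (continuous_incl (V := V) n).tendsto 0
    rwa [map_zero] at this
  obtain ⟨r, hr, hsub⟩ := Metric.eventually_nhds_iff_ball.1 (h1.eventually h0)
  refine ⟨r⁻¹, by positivity, fun χ hχ g => ?_⟩
  refine ((χ : IndC V →ₗ[ℂ] ℂ) ∘ₗ incl n).norm_le_of_seminorm_ball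
    (WeightedC.weightedSeminorm (V.weight n)) hr (fun g hg => ?_) g
  have h2 := hsub g (by simpa [WeightedC.norm_eq] using hg) ⟨χ, hχ⟩
  simp only [map_zero, dist_zero_left] at h2
  exact h2.le

/-- The inclusion of `𝒱C(X)` in `Cv(X)` for a weight `v` dominated by each weight of the system. -/
def toWeighted (v : X → ℝ≥0) (hv : ∀ n, ∃ C : ℝ, ∀ x, (v x : ℝ) ≤ C * V.weight n x) :
    IndC V →ₗ[ℂ] WeightedC v :=
  Submodule.inclusion (by
    rintro f ⟨n, A, hA⟩
    obtain ⟨C, hC⟩ := hv n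
    refine ⟨|C| * A, ?_⟩
    rintro _ ⟨x, rfl⟩
    have h1 : ‖f x‖ * (V.weight n x : ℝ) ≤ A := hA ⟨x, rfl⟩
    have h2 : (v x : ℝ) ≤ |C| * V.weight n x :=
      (hC x).trans (mul_le_mul_of_nonneg_right (le_abs_self C) (V.weight n x).2)
    calc ‖f x‖ * (v x : ℝ) ≤ ‖f x‖ * (|C| * V.weight n x) :=
          mul_le_mul_of_nonneg_left h2 (norm_nonneg _)
      _ = |C| * (‖f x‖ * V.weight n x) := by ring
      _ ≤ |C| * A := mul_le_mul_of_nonneg_left h1 (abs_nonneg C))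

/-- The topology induced from `Cv(X)` is itself one of the locally convex topologies over which the
inductive limit topology is the infimum. -/
theorem continuous_toWeighted {v : X → ℝ≥0}
    (hv : ∀ n, ∃ C : ℝ, ∀ x, (v x : ℝ) ≤ C * V.weight n x) :
    Continuous (toWeighted (V := V) v hv) := by
  let _ : NormedSpace ℝ (WeightedC v) := NormedSpace.complexToReal
  refine continuous_sInf_dom (t := TopologicalSpace.induced (toWeighted v hv) inferInstance)
    ⟨fun N => ?_, ?_, ?_, ?_⟩ continuous_induced_dom
  · rw [continuous_induced_rng]
    obtain ⟨C, hC⟩ := hv N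
    refine AddMonoidHomClass.continuous_of_bound (toWeighted v hv ∘ₗ incl N) |C| fun f => ?_
    refine WeightedC.norm_le (by positivity) fun x => ?_
    have h1 := WeightedC.norm_apply_mul_le f x
    have h2 : (v x : ℝ) ≤ |C| * V.weight N x :=
      (hC x).trans (mul_le_mul_of_nonneg_right (le_abs_self C) (V.weight N x).2)
    calc ‖WeightedC.toCont f x‖ * (v x : ℝ) ≤ ‖WeightedC.toCont f x‖ * (|C| * V.weight N x) :=
          mul_le_mul_of_nonneg_left h2 (norm_nonneg _)
      _ = |C| * (‖WeightedC.toCont f x‖ * V.weight N x) := by ring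
      _ ≤ |C| * ‖f‖ := mul_le_mul_of_nonneg_left h1 (abs_nonneg C)
  · exact topologicalAddGroup_induced (toWeighted v hv)
  · exact continuousSMul_induced (toWeighted v hv)
  · exact LocallyConvexSpace.induced ((toWeighted v hv).restrictScalars ℝ)

theorem equicontinuous_weighted_eval {v : X → ℝ≥0}
    (hv : ∀ n, ∃ C : ℝ, ∀ x, (v x : ℝ) ≤ C * V.weight n x) :
    Equicontinuous (fun (χ : range fun x => (((v x : ℝ) : ℂ) • eval (V := V) x))
      (f : IndC V) => (χ : IndC V →L[ℂ] ℂ) f) := by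
  intro f
  rw [Metric.equicontinuousAt_iff_right]
  intro ε hε
  filter_upwards [Metric.continuousAt_iff'.1 (continuous_toWeighted hv).continuousAt ε hε]
    with g hg
  rintro ⟨_, x, rfl⟩
  refine lt_of_le_of_lt ?_ hg
  rw [dist_comm, dist_eq_norm, dist_eq_norm, ← map_sub, ← map_sub]
  refine le_trans (le_of_eq ?_) (WeightedC.norm_apply_mul_le (toWeighted v hv (g - f)) x)
  change ‖((v x : ℝ) : ℂ) * toCont (g - f) x‖ = ‖toCont (g - f) x‖ * _
  rw [norm_mul, mul_comm]
  simp

/-- The product of an element of `𝒱C(X)` with a continuous function bounded by `1`. -/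
def cutoff (θ : C(X, ℝ)) (hθ : ∀ x, |θ x| ≤ 1) (g : IndC V) : IndC V :=
  ⟨⟨fun x => (θ x : ℂ) * toCont g x, by fun_prop⟩, by
    obtain ⟨n, A, hA⟩ := g.2
    refine ⟨n, A, ?_⟩
    rintro _ ⟨x, rfl⟩
    refine le_trans (mul_le_mul_of_nonneg_right ?_ (V.weight n x).2) (hA ⟨x, rfl⟩)
    change ‖(θ x : ℂ) * toCont g x‖ ≤ ‖toCont g x‖
    rw [norm_mul, Complex.norm_real]
    exact mul_le_of_le_one_left (norm_nonneg _) (hθ x)⟩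

@[simp]
theorem toCont_cutoff (θ : C(X, ℝ)) (hθ : ∀ x, |θ x| ≤ 1) (g : IndC V) (x : X) :
    toCont (cutoff θ hθ g) x = (θ x : ℂ) * toCont g x := rfl

theorem toCont_injective : Function.Injective (toCont (V := V)) := Subtype.val_injective

end IndC

/-! ### Polynomial weights and rapidly decreasing weights -/

section Rapid

variable {d : ℕ}

/-- The functions on `ℝ^d` that decrease faster than any power of `1 + |ξ|`. -/
def RapidlyDecreasing (v : Rd d → ℝ≥0) : Prop :=
  ∀ n : ℕ, ∃ C : ℝ, ∀ ξ, (v ξ : ℝ) * (1 + ‖ξ‖) ^ n ≤ C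

theorem coe_polWeights (n : ℕ) (ξ : Rd d) :
    ((polWeights d).weight n ξ : ℝ) = ((1 + ‖ξ‖) ^ n)⁻¹ := by
  simp [polWeights]

theorem RapidlyDecreasing.le_polWeights {v : Rd d → ℝ≥0} (hv : RapidlyDecreasing v) (n : ℕ) :
    ∃ C : ℝ, ∀ ξ, (v ξ : ℝ) ≤ C * (polWeights d).weight n ξ := by
  obtain ⟨C, hC⟩ := hv n
  refine ⟨C, fun ξ => ?_⟩
  rw [coe_polWeights, ← div_eq_mul_inv, le_div_iff₀ (by positivity)]
  exact hC ξ

theorem rapidlyDecreasing_exp_neg {r : ℝ} (hr : 0 < r) : RapidlyDecreasing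
    fun ξ : Rd d => (⟨Real.exp (-(r * ‖ξ‖)), (Real.exp_pos _).le⟩ : ℝ≥0) := by
  intro n
  refine ⟨r⁻¹ ^ n * n.factorial * Real.exp r, fun ξ => ?_⟩
  have h := Real.pow_div_factorial_le_exp (r * (1 + ‖ξ‖)) (by positivity) n
  rw [div_le_iff₀ (by positivity)] at h
  change Real.exp (-(r * ‖ξ‖)) * (1 + ‖ξ‖) ^ n ≤ _
  calc Real.exp (-(r * ‖ξ‖)) * (1 + ‖ξ‖) ^ n
      = Real.exp (-(r * ‖ξ‖)) * (r⁻¹ ^ n * (r * (1 + ‖ξ‖)) ^ n) := by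
        rw [mul_pow, ← mul_assoc (r⁻¹ ^ n), ← mul_pow, inv_mul_cancel₀ hr.ne', one_pow, one_mul]
    _ ≤ Real.exp (-(r * ‖ξ‖)) * (r⁻¹ ^ n * (Real.exp (r * (1 + ‖ξ‖)) * n.factorial)) := by gcongr
    _ = r⁻¹ ^ n * n.factorial * (Real.exp (-(r * ‖ξ‖)) * Real.exp (r * (1 + ‖ξ‖))) := by ring
    _ = r⁻¹ ^ n * n.factorial * Real.exp r := by
        rw [← Real.exp_add]; congr 2; ring

/-- A linear form that is `C n`-bounded on each step is bounded by the growth of `h`. -/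
theorem IndC.norm_apply_le_of_growth {L : IndC (polWeights d) →ₗ[ℂ] ℂ} {n : ℕ} {C : ℝ}
    (hC : 0 ≤ C) (hL : ∀ g, ‖L (incl n g)‖ ≤ C * ‖g‖) {h : IndC (polWeights d)} {A : ℝ}
    (hA : 0 ≤ A) (hb : ∀ ξ, ‖toCont h ξ‖ ≤ A * (1 + ‖ξ‖) ^ n) : ‖L h‖ ≤ C * A := by
  have hb' : ∀ ξ, ‖toCont h ξ‖ * ((polWeights d).weight n ξ : ℝ) ≤ A := fun ξ => by
    rw [coe_polWeights, ← div_eq_mul_inv, div_le_iff₀ (by positivity)]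
    exact hb ξ
  let g : WeightedC ((polWeights d).weight n) := ⟨h.1, A, by rintro _ ⟨ξ, rfl⟩; exact hb' ξ⟩
  have hg : ‖g‖ ≤ A := WeightedC.norm_le hA hb'
  exact (hL g).trans (mul_le_mul_of_nonneg_left hg hC)

/-- The continuous function equal to `1` for `|ξ| ≤ j` and to `0` for `|ξ| ≥ j + 1`. -/
def radialCutoff (d : ℕ) (j : ℕ) : C(Rd d, ℝ) :=
  ⟨fun ξ => max 0 (min 1 (j + 1 - ‖ξ‖)), by fun_prop⟩

theorem radialCutoff_apply (j : ℕ) (ξ : Rd d) :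
    radialCutoff d j ξ = max 0 (min 1 (j + 1 - ‖ξ‖)) := rfl

theorem radialCutoff_nonneg (j : ℕ) (ξ : Rd d) : 0 ≤ radialCutoff d j ξ := le_max_left _ _

theorem radialCutoff_le_one (j : ℕ) (ξ : Rd d) : radialCutoff d j ξ ≤ 1 :=
  max_le zero_le_one (min_le_left _ _)

theorem radialCutoff_eq_one {j : ℕ} {ξ : Rd d} (h : ‖ξ‖ ≤ j) : radialCutoff d j ξ = 1 := by
  rw [radialCutoff_apply, min_eq_left (by linarith), max_eq_right zero_le_one]

theorem radialCutoff_eq_zero {j : ℕ} {ξ : Rd d} (h : j + 1 ≤ ‖ξ‖) : radialCutoff d j ξ = 0 := by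
  rw [radialCutoff_apply]
  exact max_eq_left ((min_le_right _ _).trans (by linarith))

theorem radialCutoff_mono {j k : ℕ} (h : j ≤ k) (ξ : Rd d) :
    radialCutoff d j ξ ≤ radialCutoff d k ξ := by
  have : (j : ℝ) ≤ k := by exact_mod_cast h
  rw [radialCutoff_apply, radialCutoff_apply]
  gcongr

theorem abs_radialCutoff_le (j : ℕ) (ξ : Rd d) : |radialCutoff d j ξ| ≤ 1 := by
  rw [abs_of_nonneg (radialCutoff_nonneg j ξ)]
  exact radialCutoff_le_one j ξ

theorem abs_radialCutoff_sub_le (j : ℕ) (ξ : Rd d) :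
    |(radialCutoff d (j + 1) - radialCutoff d j) ξ| ≤ 1 := by
  have h1 := radialCutoff_mono j.le_succ ξ
  have h2 := radialCutoff_nonneg j ξ
  have h3 := radialCutoff_le_one (j + 1) ξ
  rw [ContinuousMap.sub_apply, abs_of_nonneg (sub_nonneg.2 h1)]
  linarith

theorem abs_one_sub_radialCutoff_le (j : ℕ) (ξ : Rd d) :
    |((1 : C(Rd d, ℝ)) - radialCutoff d j) ξ| ≤ 1 := by
  have h2 := radialCutoff_nonneg j ξ
  have h3 := radialCutoff_le_one j ξ
  rw [ContinuousMap.sub_apply, ContinuousMap.one_apply, abs_of_nonneg (sub_nonneg.2 h3)]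
  linarith

/-- The rapidly decreasing weight `4 (1 + |ξ|)² inf_n C_n 3ⁿ (1 + |ξ|)^{-n}`. -/
def rapidMinorant (C : ℕ → ℝ≥0) (ξ : Rd d) : ℝ≥0 :=
  4 * (1 + ‖ξ‖₊) ^ 2 * ⨅ n : ℕ, C n * 3 ^ n * ((1 + ‖ξ‖₊) ^ n)⁻¹

/-- Bounding the infimum by its term of index `n + 2` pays for both the prefactor `(1 + |ξ|)²` and
the power `n`. -/
theorem rapidlyDecreasing_rapidMinorant (C : ℕ → ℝ≥0) :
    RapidlyDecreasing (rapidMinorant (d := d) C) := by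
  intro n
  refine ⟨4 * (C (n + 2) * 3 ^ (n + 2)), fun ξ => ?_⟩
  have h : (⨅ n : ℕ, C n * 3 ^ n * ((1 + ‖ξ‖₊) ^ n)⁻¹) ≤
      C (n + 2) * 3 ^ (n + 2) * ((1 + ‖ξ‖₊) ^ (n + 2))⁻¹ := ciInf_le' _ _
  have h2 : rapidMinorant C ξ * (1 + ‖ξ‖₊) ^ n ≤ 4 * (C (n + 2) * 3 ^ (n + 2)) := by
    calc rapidMinorant C ξ * (1 + ‖ξ‖₊) ^ n
        ≤ 4 * (1 + ‖ξ‖₊) ^ 2 * (C (n + 2) * 3 ^ (n + 2) * ((1 + ‖ξ‖₊) ^ (n + 2))⁻¹) *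
            (1 + ‖ξ‖₊) ^ n := by unfold rapidMinorant; gcongr
      _ = 4 * (C (n + 2) * 3 ^ (n + 2)) * ((1 + ‖ξ‖₊) ^ (n + 2) * ((1 + ‖ξ‖₊) ^ (n + 2))⁻¹) := by
          ring
      _ = 4 * (C (n + 2) * 3 ^ (n + 2)) := by rw [mul_inv_cancel₀ (by positivity), mul_one]
  exact_mod_cast h2

/-- The estimate for a piece of `g` supported in an annulus. -/
theorem IndC.norm_apply_cutoff_le {L : IndC (polWeights d) →ₗ[ℂ] ℂ} {C : ℕ → ℝ≥0}
    (hL : ∀ n g, ‖L (incl n g)‖ ≤ C n * ‖g‖) {g : IndC (polWeights d)} {M : ℝ}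
    (hM : ∀ ξ, (rapidMinorant C ξ : ℝ) * ‖toCont g ξ‖ ≤ M) (j : ℕ) (θ : C(Rd d, ℝ))
    (hθ : ∀ ξ, |θ ξ| ≤ 1) (hsupp : ∀ ξ, θ ξ ≠ 0 → (j : ℝ) ≤ ‖ξ‖ ∧ ‖ξ‖ ≤ j + 2) :
    ‖L (cutoff θ hθ g)‖ ≤ M / (4 * (1 + j) ^ 2) := by
  have hM0 : 0 ≤ M := (mul_nonneg (NNReal.coe_nonneg _) (norm_nonneg _)).trans (hM 0)
  -- Since `|ξ| ≥ j` on the support, the piece has norm at most `(1 + j)^{-n} S` in the step `n`;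
  -- every `n` is available.
  have key : ∀ S : ℝ, 0 ≤ S → (∀ ξ, θ ξ ≠ 0 → ‖toCont g ξ‖ ≤ S) → ∀ n : ℕ,
      ‖L (cutoff θ hθ g)‖ ≤ C n * ((1 + (j : ℝ)) ^ n)⁻¹ * S := by
    intro S hS hgS n
    rw [mul_assoc]
    refine norm_apply_le_of_growth (C n).2 (hL n) (by positivity) fun ξ => ?_
    rw [toCont_cutoff, norm_mul, Complex.norm_real, Real.norm_eq_abs]
    by_cases h0 : θ ξ = 0
    · rw [h0, abs_zero, zero_mul]; positivity
    · have h1 : (1 + (j : ℝ)) ^ n ≤ (1 + ‖ξ‖) ^ n := by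
        have := (hsupp ξ h0).1
        gcongr
      calc |θ ξ| * ‖toCont g ξ‖ ≤ 1 * S :=
            mul_le_mul (hθ ξ) (hgS ξ h0) (norm_nonneg _) zero_le_one
        _ = ((1 + (j : ℝ)) ^ n)⁻¹ * S * (1 + (j : ℝ)) ^ n := by field_simp
        _ ≤ ((1 + (j : ℝ)) ^ n)⁻¹ * S * (1 + ‖ξ‖) ^ n := by gcongr
  set a : ℝ≥0 := ⨅ n : ℕ, C n * ((1 + (j : ℝ≥0)) ^ n)⁻¹ with ha
  have ha_le : ∀ ξ, θ ξ ≠ 0 → 4 * (1 + (j : ℝ)) ^ 2 * a ≤ rapidMinorant C ξ := by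
    intro ξ h0
    obtain ⟨h1, h2⟩ := hsupp ξ h0
    have h1' : (j : ℝ≥0) ≤ ‖ξ‖₊ := by exact_mod_cast h1
    -- On the annulus `1 + |ξ| ≤ 3 + j`; this is the origin of the factor `3ⁿ` in `rapidMinorant`.
    have h2' : 1 + ‖ξ‖₊ ≤ 3 * (1 + (j : ℝ≥0)) := by
      have : 1 + ‖ξ‖ ≤ 3 * (1 + (j : ℝ)) := by
        have : (0 : ℝ) ≤ j := j.cast_nonneg
        linarith
      exact_mod_cast this
    have h3 : a ≤ ⨅ n : ℕ, C n * 3 ^ n * ((1 + ‖ξ‖₊) ^ n)⁻¹ := by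
      refine le_ciInf fun n => (ciInf_le' _ n).trans ?_
      rw [mul_assoc]
      refine mul_le_mul_right ?_ _
      rw [inv_le_iff_one_le_mul₀ (by positivity), mul_assoc, mul_comm, mul_assoc]
      rw [← div_eq_inv_mul, one_le_div (by positivity)]
      rw [mul_comm, ← mul_pow]
      gcongr
    have h4 : 4 * (1 + (j : ℝ≥0)) ^ 2 * a ≤ rapidMinorant C ξ := by
      unfold rapidMinorant
      gcongr
    exact_mod_cast h4
  have hinf : ∀ S : ℝ, 0 ≤ S → (∀ ξ, θ ξ ≠ 0 → ‖toCont g ξ‖ ≤ S) →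
      ‖L (cutoff θ hθ g)‖ ≤ a * S := by
    intro S hS hgS
    lift S to ℝ≥0 using hS
    have h1 : ‖L (cutoff θ hθ g)‖₊ ≤ ⨅ n : ℕ, C n * ((1 + (j : ℝ≥0)) ^ n)⁻¹ * S :=
      le_ciInf fun n => by exact_mod_cast key S S.2 hgS n
    rw [← NNReal.iInf_mul, ← ha] at h1
    exact_mod_cast h1
  -- If `a = 0`, the weight may give no control on `g`. Any finite bound for `g` on the annulus,
  -- here from its polynomial growth, then forces the value to be `0`.
  rcases eq_or_ne a 0 with h0 | h0
  · obtain ⟨n, A, hA⟩ := g.2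
    have h1 : ∀ ξ, θ ξ ≠ 0 → ‖toCont g ξ‖ ≤ |A| * (3 + j) ^ n := by
      intro ξ hξ
      have h2 : ‖toCont g ξ‖ * ((polWeights d).weight n ξ : ℝ) ≤ A := hA ⟨ξ, rfl⟩
      rw [coe_polWeights, ← div_eq_mul_inv, div_le_iff₀ (by positivity)] at h2
      have h3 := (hsupp ξ hξ).2
      refine h2.trans (mul_le_mul (le_abs_self A) ?_ (by positivity) (abs_nonneg A))
      gcongr ?_ ^ n
      linarith
    have h2 := hinf _ (by positivity) h1
    rw [h0, NNReal.coe_zero, zero_mul] at h2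
    exact h2.trans (by positivity)
  · have hapos : (0 : ℝ) < a := by exact_mod_cast pos_iff_ne_zero.2 h0
    have h1 := hinf (M / (4 * (1 + (j : ℝ)) ^ 2 * a)) (by positivity) (fun ξ hξ => by
      rw [le_div_iff₀ (by positivity), mul_comm]
      exact (mul_le_mul_of_nonneg_right (ha_le ξ hξ) (norm_nonneg _)).trans (hM ξ))
    refine h1.trans (le_of_eq ?_)
    field_simp

/-- Decompose `g` into pieces on the annuli `j ≤ |ξ| ≤ j + 2`. On each piece the best step `n` may
be used, which costs the infimum over `n`. The factor `4 (1 + |ξ|)²` in the weight makes the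
contributions summable with total at most `M`. -/
theorem IndC.norm_apply_le_of_rapidMinorant {L : IndC (polWeights d) →ₗ[ℂ] ℂ} {C : ℕ → ℝ≥0}
    (hL : ∀ n g, ‖L (incl n g)‖ ≤ C n * ‖g‖) {g : IndC (polWeights d)} {M : ℝ}
    (hM : ∀ ξ, (rapidMinorant C ξ : ℝ) * ‖toCont g ξ‖ ≤ M) : ‖L g‖ ≤ M := by
  have hM0 : 0 ≤ M := (mul_nonneg (NNReal.coe_nonneg _) (norm_nonneg _)).trans (hM 0)
  -- The bounds `M / (4 (1 + j)²)` are summed by comparison with the telescoping `(M/2)(1/(j+1) -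
  -- 1/(j+2))`; with the central piece the total stays below `3M/4`.
  have hmain : ∀ J : ℕ, ‖L (cutoff (radialCutoff d J) (abs_radialCutoff_le J) g)‖ ≤
      M / 4 + M / 2 * (1 - 1 / (J + 1)) := by
    intro J
    induction J with
    | zero =>
      have := norm_apply_cutoff_le hL hM 0 (radialCutoff d 0) (abs_radialCutoff_le 0) (by
        intro ξ hξ
        refine ⟨by simp, ?_⟩
        by_contra! hcon
        refine hξ (radialCutoff_eq_zero ?_)
        simp only [Nat.cast_zero] at hcon ⊢
        linarith)
      simpa using this
    | succ J ih =>
      have h1 := norm_apply_cutoff_le hL hM J (radialCutoff d (J + 1) - radialCutoff d J)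
        (abs_radialCutoff_sub_le J) (by
          intro ξ hξ
          rw [ContinuousMap.sub_apply] at hξ
          constructor
          · by_contra! hcon
            refine hξ ?_
            rw [radialCutoff_eq_one hcon.le, radialCutoff_eq_one, sub_self]
            push_cast
            linarith
          · by_contra! hcon
            refine hξ ?_
            rw [radialCutoff_eq_zero, radialCutoff_eq_zero, sub_self]
            · linarith
            · push_cast; linarith)
      have h2 : cutoff (radialCutoff d (J + 1)) (abs_radialCutoff_le (J + 1)) g =
          cutoff (radialCutoff d J) (abs_radialCutoff_le J) g +
          cutoff (radialCutoff d (J + 1) - radialCutoff d J) (abs_radialCutoff_sub_le J) g := by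
        refine toCont_injective (ContinuousMap.ext fun ξ => ?_)
        rw [map_add, ContinuousMap.add_apply, toCont_cutoff, toCont_cutoff, toCont_cutoff,
          ContinuousMap.sub_apply]
        push_cast
        ring
      rw [h2, map_add]
      refine (norm_add_le _ _).trans ((add_le_add ih h1).trans ?_)
      have h3 : M / (4 * (1 + (J : ℝ)) ^ 2) ≤ M / 2 * (1 / (J + 1) - 1 / ((J + 1 : ℕ) + 1)) := by
        have h4 : (1 : ℝ) / (J + 1) - 1 / ((J + 1 : ℕ) + 1) = 1 / ((J + 1) * (J + 2)) := by
          push_cast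
          field_simp
          ring
        rw [h4, div_mul_div_comm, mul_one]
        refine div_le_div_of_nonneg_left hM0 (by positivity) ?_
        have : (0 : ℝ) ≤ J := J.cast_nonneg
        nlinarith
      linarith
  obtain ⟨n, A, hA⟩ := g.2
  -- The tail of `g`, which has growth of order `n`, is measured in the step `n + 1`; the spare
  -- power is at least `J + 1` there.
  have hrest : ∀ J : ℕ, ‖L g‖ ≤ M + C (n + 1) * |A| * (1 / ((J : ℝ) + 1)) := by
    intro J
    have h1 : g = cutoff (radialCutoff d J) (abs_radialCutoff_le J) g +
        cutoff (1 - radialCutoff d J) (abs_one_sub_radialCutoff_le J) g := by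
      refine toCont_injective (ContinuousMap.ext fun ξ => ?_)
      rw [map_add, ContinuousMap.add_apply, toCont_cutoff, toCont_cutoff, ContinuousMap.sub_apply,
        ContinuousMap.one_apply]
      push_cast
      ring
    have h2 : ‖L (cutoff (1 - radialCutoff d J) (abs_one_sub_radialCutoff_le J) g)‖ ≤
        C (n + 1) * (|A| * (1 / ((J : ℝ) + 1))) := by
      refine norm_apply_le_of_growth (C (n + 1)).2 (hL (n + 1)) (by positivity) fun ξ => ?_
      have h3 : ‖toCont g ξ‖ * ((polWeights d).weight n ξ : ℝ) ≤ A := hA ⟨ξ, rfl⟩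
      rw [coe_polWeights, ← div_eq_mul_inv, div_le_iff₀ (by positivity)] at h3
      rw [toCont_cutoff, norm_mul, Complex.norm_real, Real.norm_eq_abs]
      rcases le_total ‖ξ‖ J with h4 | h4
      · rw [ContinuousMap.sub_apply, ContinuousMap.one_apply, radialCutoff_eq_one h4, sub_self,
          abs_zero, zero_mul]
        positivity
      · calc _ ≤ 1 * (|A| * (1 + ‖ξ‖) ^ n) := by
              refine mul_le_mul (abs_one_sub_radialCutoff_le J ξ) (h3.trans ?_) (norm_nonneg _)
                zero_le_one
              gcongr
              exact le_abs_self A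
          _ = |A| * (1 / (J + 1)) * ((1 + ‖ξ‖) ^ n * (J + 1)) := by field_simp
          _ ≤ |A| * (1 / (J + 1)) * ((1 + ‖ξ‖) ^ n * (1 + ‖ξ‖)) := by
              have h5 : (J : ℝ) + 1 ≤ 1 + ‖ξ‖ := by linarith
              gcongr
          _ = |A| * (1 / (J + 1)) * (1 + ‖ξ‖) ^ (n + 1) := by rw [pow_succ]
    rw [h1, map_add, mul_assoc]
    refine (norm_add_le _ _).trans (add_le_add ((hmain J).trans ?_) h2)
    have : 0 ≤ M / 2 * (1 / ((J : ℝ) + 1)) := by positivity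
    linarith
  refine ge_of_tendsto' (x := atTop) (f := fun J : ℕ => M + C (n + 1) * |A| * (1 / ((J : ℝ) + 1)))
    ?_ hrest
  have := (tendsto_one_div_add_atTop_nhds_zero_nat (𝕜 := ℝ)).const_mul ((C (n + 1) : ℝ) * |A|)
  simpa using this.const_add M

end Rapid

/-! ### The weighted function space that models the completed tensor product -/

section Model

variable {d : ℕ} {Γ : Set (Rd d)}

theorem CCSExhaustion.subset (K : CCSExhaustion Γ) (N : ℕ) : K.set N ⊆ Γ :=
  (subset_iUnion K.set N).trans K.iUnion_eq.subset

theorem CCSExhaustion.exists_mem (K : CCSExhaustion Γ) {η : Rd d} (h : η ∈ Γ) :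
    ∃ N, η ∈ K.set N := by
  rwa [← K.iUnion_eq, mem_iUnion] at h

theorem CCSExhaustion.exists_finset_subset (K : CCSExhaustion Γ) {P : Finset (Rd d)}
    (h : (P : Set (Rd d)) ⊆ Γ) : ∃ M, (P : Set (Rd d)) ⊆ K.set M := by
  rw [← K.iUnion_eq] at h
  exact K.mono.directed_le.exists_mem_subset_of_finset_subset_biUnion h

theorem coe_weights (K : CCSExhaustion Γ) (N : ℕ) (x : Rd d) :
    (K.weights.weight N x : ℝ) = Real.exp (supportingFunction (-K.set N) x) := rfl

theorem neg_inner_le_supportingFunction {K : Set (Rd d)} (hK : IsCompact K) {η : Rd d}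
    (hη : η ∈ K) (x : Rd d) : -inner ℝ η x ≤ supportingFunction (-K) x := by
  refine le_csSup (hK.neg.image (by fun_prop)).bddAbove ⟨-η, by simpa using hη, ?_⟩
  simp [real_inner_comm]

theorem exists_supportingFunction_eq {K : Set (Rd d)} (hK : IsCompact K) (hne : K.Nonempty)
    (x : Rd d) : ∃ η ∈ K, supportingFunction (-K) x = -inner ℝ η x := by
  obtain ⟨η, hη, h⟩ := hK.neg.exists_sSup_image_eq hne.neg
    (f := fun η : Rd d => inner ℝ x η) (by fun_prop)
  refine ⟨-η, by simpa using hη, ?_⟩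
  rw [supportingFunction, h]
  simp [real_inner_comm]

/-- The supporting function of a compact subset of an open set, with a linear gain, is dominated
by that of a finite subset. -/
theorem exists_finset_dominating {K : Set (Rd d)} (hK : IsCompact K) (hne : K.Nonempty)
    (hopen : IsOpen Γ) (hKΓ : K ⊆ Γ) :
    ∃ (P : Finset (Rd d)) (r : ℝ), (P : Set (Rd d)) ⊆ Γ ∧ 0 < r ∧
      ∀ x, ∃ p ∈ P, supportingFunction (-K) x + r * ‖x‖ ≤ -inner ℝ p x := by
  -- Moving the maximiser `η ∈ K` by `δ` against `x` stays in Γ and gains `δ|x|`. Replacing the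
  -- moved point by the centre of a ball of radius `δ/2` loses at most half of that.
  obtain ⟨δ, hδ, hsub⟩ := hK.exists_cthickening_subset_open hopen hKΓ
  obtain ⟨t, htK, htf, hcov⟩ := (hK.cthickening (r := δ)).finite_cover_balls (half_pos hδ)
  refine ⟨htf.toFinset, δ / 2, by simpa using htK.trans hsub, half_pos hδ, fun x => ?_⟩
  obtain ⟨η, hη, hηx⟩ := exists_supportingFunction_eq hK hne x
  rw [hηx]
  -- For `x = 0` the inverse is `0` and the point is `η` itself.
  have hmem : η - (δ * ‖x‖⁻¹) • x ∈ Metric.cthickening δ K := by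
    refine Metric.mem_cthickening_of_dist_le _ η δ K hη ?_
    rw [dist_eq_norm, sub_sub_cancel_left, norm_neg, norm_smul, norm_mul, norm_inv, norm_norm,
      Real.norm_of_nonneg hδ.le, mul_assoc]
    exact mul_le_of_le_one_right hδ.le inv_mul_le_one
  obtain ⟨p, hp, hpd⟩ := mem_iUnion₂.1 (hcov hmem)
  refine ⟨p, by simpa using hp, ?_⟩
  rw [mem_ball_iff_norm, norm_sub_rev] at hpd
  have h1 := (real_inner_le_norm (p - (η - (δ * ‖x‖⁻¹) • x)) x).trans
    (mul_le_mul_of_nonneg_right hpd.le (norm_nonneg x))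
  rw [inner_sub_left, inner_sub_left, inner_smul_left, real_inner_self_eq_norm_sq] at h1
  have h2 : δ * ‖x‖⁻¹ * ‖x‖ ^ 2 = δ * ‖x‖ := by
    rcases eq_or_ne ‖x‖ 0 with h | h
    · rw [h]; ring
    · field_simp
  simp only [conj_trivial] at h1
  rw [h2] at h1
  linarith

/-- A finite subset of Γ lies in one `K_M` by monotonicity alone. This is why the compact set is
first dominated by finitely many points. -/
theorem CCSExhaustion.exists_weight_gain (K : CCSExhaustion Γ) (hopen : IsOpen Γ) (N : ℕ) :
    ∃ (M : ℕ) (r : ℝ), 0 < r ∧ ∀ x,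
      (K.weights.weight N x : ℝ) * Real.exp (r * ‖x‖) ≤ K.weights.weight M x := by
  obtain ⟨P, r, hP, hr, h⟩ := exists_finset_dominating (K.isCompact N) (K.nonempty N) hopen
    (K.subset N)
  obtain ⟨M, hM⟩ := K.exists_finset_subset hP
  refine ⟨M, r, hr, fun x => ?_⟩
  rw [coe_weights, coe_weights, ← Real.exp_add]
  obtain ⟨p, hp, hpx⟩ := h x
  exact Real.exp_le_exp.2 (hpx.trans (neg_inner_le_supportingFunction (K.isCompact M) (hM hp) x))

/-- The weights `e^{h_{-K_N}(x)} v(ξ)` with `v` rapidly decreasing. -/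
def epsWeight (K : CCSExhaustion Γ) (i : ℕ × {v : Rd d → ℝ≥0 // RapidlyDecreasing v})
    (p : Rd d × Rd d) : ℝ≥0 :=
  K.weights.weight i.1 p.1 * i.2.1 p.2

/-- The continuous functions on `ℝ^{2d}` bounded with respect to all weights
`e^{h_{-K_N}(x)} v(ξ)` with `v` rapidly decreasing. -/
abbrev EpsModel (K : CCSExhaustion Γ) : Type := MultiC (epsWeight K)

variable (K : CCSExhaustion Γ)

theorem coe_epsWeight (i : ℕ × {v : Rd d → ℝ≥0 // RapidlyDecreasing v}) (p : Rd d × Rd d) :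
    (epsWeight K i p : ℝ) = K.weights.weight i.1 p.1 * i.2.1 p.2 := rfl

/-- An index whose weight is positive and continuous. -/
def expIndex (d : ℕ) (N : ℕ) : ℕ × {v : Rd d → ℝ≥0 // RapidlyDecreasing v} :=
  (N, ⟨_, rapidlyDecreasing_exp_neg one_pos⟩)

theorem epsWeight_expIndex_pos (N : ℕ) (p : Rd d × Rd d) : 0 < epsWeight K (expIndex d N) p :=
  mul_pos (K.weights.pos N p.1) (Real.exp_pos _)

instance : CompleteSpace (EpsModel K) := by
  refine MultiC.completeSpace (expIndex d 0) (epsWeight_expIndex_pos K 0) ?_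
  refine ((K.weights.cont 0).comp continuous_fst).mul ?_
  exact Continuous.subtype_mk (by fun_prop) _

instance : T0Space (EpsModel K) :=
  MultiC.t0Space fun p => ⟨expIndex d 0, epsWeight_expIndex_pos K 0 p⟩

/-- The function `(x, ξ) ↦ f(x) g(ξ)`. -/
def tensorFun (f g : C(Rd d, ℂ)) : C(Rd d × Rd d, ℂ) :=
  ⟨fun p => f p.1 * g p.2, by fun_prop⟩

theorem exists_bound_tensorFun (f : CGamma K) (g : IndC (polWeights d))
    (i : ℕ × {v : Rd d → ℝ≥0 // RapidlyDecreasing v}) :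
    ∃ C, ∀ p, ‖tensorFun (ProjC.toCont f) (IndC.toCont g) p‖ * (epsWeight K i p : ℝ) ≤ C := by
  have h1 := fun x => WeightedC.norm_apply_mul_le (ProjC.proj i.1 f) x
  have h2 := fun ξ => WeightedC.norm_apply_mul_le
    (IndC.toWeighted i.2.1 i.2.2.le_polWeights g) ξ
  refine ⟨‖ProjC.proj i.1 f‖ * ‖IndC.toWeighted i.2.1 i.2.2.le_polWeights g‖, fun p => ?_⟩
  refine le_trans (le_of_eq ?_) (mul_le_mul (h1 p.1) (h2 p.2)
    (mul_nonneg (norm_nonneg _) (NNReal.coe_nonneg _)) (apply_nonneg _ _))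
  change ‖ProjC.toCont f p.1 * IndC.toCont g p.2‖ * _ =
    ‖ProjC.toCont f p.1‖ * _ * (‖IndC.toCont g p.2‖ * _)
  rw [norm_mul, coe_epsWeight]
  ring

section Partial

theorem EpsTensor.induction_on {E F : Type} [AddCommGroup E] [Module ℂ E] [AddCommGroup F]
    [Module ℂ F] {motive : EpsTensor E F → Prop} (t : EpsTensor E F)
    (zero : motive 0) (tmul : ∀ (f : E) (g : F), motive (f ⊗ₜ[ℂ] g : E ⊗[ℂ] F))
    (add : ∀ s t, motive s → motive t → motive (s + t)) : motive t :=
  TensorProduct.induction_on t zero tmul add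

end Partial

/-- The function on `ℝ^{2d}` represented by an element of the algebraic tensor product. -/
def tensorToModel : EpsTensor (CGamma K) (IndC (polWeights d)) →ₗ[ℂ] EpsModel K :=
  TensorProduct.lift (LinearMap.mk₂ ℂ
    (fun f g => MultiC.mk (tensorFun (ProjC.toCont f) (IndC.toCont g))
      (exists_bound_tensorFun K f g))
    (fun f₁ f₂ g => MultiC.toCont_injective <| ContinuousMap.ext fun p => by
      exact add_mul (ProjC.toCont f₁ p.1) _ _)
    (fun c f g => MultiC.toCont_injective <| ContinuousMap.ext fun p => by
      exact mul_assoc c (ProjC.toCont f p.1) _)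
    (fun f g₁ g₂ => MultiC.toCont_injective <| ContinuousMap.ext fun p => by
      exact mul_add (ProjC.toCont f p.1) _ _)
    (fun c f g => MultiC.toCont_injective <| ContinuousMap.ext fun p => by
      exact mul_left_comm (ProjC.toCont f p.1) c _))

theorem toCont_tensorToModel_tmul (f : CGamma K) (g : IndC (polWeights d)) (p : Rd d × Rd d) :
    MultiC.toCont (tensorToModel K (f ⊗ₜ[ℂ] g)) p =
      ProjC.toCont f p.1 * IndC.toCont g p.2 := rfl

theorem toCont_tensorToModel (t : EpsTensor (CGamma K) (IndC (polWeights d)))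
    (p : Rd d × Rd d) :
    MultiC.toCont (tensorToModel K t) p =
      EpsTensor.pairing (ProjC.eval p.1) (IndC.eval p.2) t := by
  induction t using EpsTensor.induction_on with
  | zero => rw [map_zero, map_zero, map_zero, ContinuousMap.zero_apply]
  | tmul f g => rfl
  | add s t hs ht =>
    rw [map_add, map_add, map_add, ContinuousMap.add_apply, hs, ht]

/-! ### Partial evaluations, and the ε-topology compared with that of the model. -/

section Partial

variable {E F : Type} [AddCommGroup E] [Module ℂ E] [TopologicalSpace E]
  [AddCommGroup F] [Module ℂ F] [TopologicalSpace F]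

/-- The partial evaluation `id ⊗ χ`. -/
def EpsTensor.evalRight (χ : F →L[ℂ] ℂ) : EpsTensor E F →ₗ[ℂ] E :=
  (TensorProduct.rid ℂ E).toLinearMap ∘ₗ TensorProduct.map LinearMap.id (χ : F →ₗ[ℂ] ℂ)

/-- The partial evaluation `φ ⊗ id`. -/
def EpsTensor.evalLeft (φ : E →L[ℂ] ℂ) : EpsTensor E F →ₗ[ℂ] F :=
  (TensorProduct.lid ℂ F).toLinearMap ∘ₗ TensorProduct.map (φ : E →ₗ[ℂ] ℂ) LinearMap.id

theorem EpsTensor.apply_evalRight (φ : E →L[ℂ] ℂ) (χ : F →L[ℂ] ℂ) (t : EpsTensor E F) :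
    φ (evalRight χ t) = pairing φ χ t := by
  induction t using EpsTensor.induction_on with
  | zero => rw [map_zero, map_zero, map_zero]
  | tmul f g =>
    change φ (χ g • f) = φ f * χ g
    rw [map_smul, smul_eq_mul, mul_comm]
  | add s t hs ht => rw [map_add, map_add, map_add, hs, ht]

theorem EpsTensor.apply_evalLeft (φ : E →L[ℂ] ℂ) (χ : F →L[ℂ] ℂ) (t : EpsTensor E F) :
    χ (evalLeft φ t) = pairing φ χ t := by
  induction t using EpsTensor.induction_on with
  | zero => rw [map_zero, map_zero, map_zero]
  | tmul f g =>
    change χ (φ f • g) = φ f * χ g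
    rw [map_smul, smul_eq_mul]
  | add s t hs ht => rw [map_add, map_add, map_add, hs, ht]

theorem EpsTensor.pairing_smul (a b : ℂ) (φ : E →L[ℂ] ℂ) (χ : F →L[ℂ] ℂ) (t : EpsTensor E F) :
    pairing (a • φ) (b • χ) t = a * b * pairing φ χ t := by
  induction t using EpsTensor.induction_on with
  | zero => rw [map_zero, map_zero, mul_zero]
  | tmul f g =>
    change (a • φ f) * (b • χ g) = a * b * (φ f * χ g)
    rw [smul_eq_mul, smul_eq_mul]
    ring
  | add s t hs ht => rw [map_add, map_add, hs, ht, mul_add]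

end Partial

/-- A group homomorphism under which the neighbourhoods of `0` correspond is uniformly inducing. -/
theorem isUniformInducing_of_nhds_zero {G H : Type*} [AddCommGroup G] [UniformSpace G]
    [IsUniformAddGroup G] [AddCommGroup H] [UniformSpace H] [IsUniformAddGroup H] (f : G →+ H)
    (h : comap f (𝓝 0) = 𝓝 0) : IsUniformInducing f := by
  refine ⟨?_⟩
  rw [uniformity_eq_comap_nhds_zero G, uniformity_eq_comap_nhds_zero H, comap_comap, ← h,
    comap_comap]
  congr 1
  ext ⟨x, y⟩
  simp

/-- Each seminorm of the model is a supremum over one equicontinuous rectangle, namely `{w_N(x) δ_x}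
× {v(ξ) δ_ξ}`. -/
theorem tendsto_tensorToModel :
    Tendsto (tensorToModel K) (𝓝 0) (𝓝 0) := by
  rw [MultiC.tendsto_iff_norm]
  intro i ε hε
  have hmem : (range fun x => ((K.weights.weight i.1 x : ℝ) : ℂ) • ProjC.eval (W := K.weights) x) ×ˢ
      (range fun ξ => ((i.2.1 ξ : ℝ) : ℂ) • IndC.eval (V := polWeights d) ξ) ∈
      equicontinuousRectangles (CGamma K) (IndC (polWeights d)) :=
    ⟨_, _, ProjC.equicontinuous_weighted_eval i.1,
      IndC.equicontinuous_weighted_eval i.2.2.le_polWeights, rfl⟩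
  have hT : Tendsto (EpsTensor.toFun (CGamma K) (IndC (polWeights d))) (𝓝 0)
      (𝓝 (EpsTensor.toFun (CGamma K) (IndC (polWeights d)) 0)) := by
    rw [nhds_induced (EpsTensor.toFun (CGamma K) (IndC (polWeights d)))]
    exact tendsto_comap
  rw [UniformOnFun.tendsto_iff_tendstoUniformlyOn] at hT
  have h1 := Metric.tendstoUniformlyOn_iff.1 (hT _ hmem) ε hε
  filter_upwards [h1] with t ht p
  have h2 := ht (_, _) ⟨⟨p.1, rfl⟩, ⟨p.2, rfl⟩⟩
  rw [zero_sub, map_neg, ContinuousMap.neg_apply, norm_neg, toCont_tensorToModel]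
  refine lt_of_le_of_lt (le_of_eq ?_) h2
  change _ = dist
    (EpsTensor.pairing (((K.weights.weight i.1 p.1 : ℝ) : ℂ) • ProjC.eval (W := K.weights) p.1)
      (((i.2.1 p.2 : ℝ) : ℂ) • IndC.eval (V := polWeights d) p.2) 0)
    (EpsTensor.pairing (((K.weights.weight i.1 p.1 : ℝ) : ℂ) • ProjC.eval (W := K.weights) p.1)
      (((i.2.1 p.2 : ℝ) : ℂ) • IndC.eval (V := polWeights d) p.2) t)
  rw [map_zero, dist_zero_left, EpsTensor.pairing_smul, norm_mul, mul_comm, coe_epsWeight]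
  simp

/-- Given a rectangle `A × B`, write `(φ ⊗ χ)(t) = φ((id ⊗ χ) t)`. The norm dominating `A` reduces
the estimate to `w_N(x) |χ((δ_x ⊗ id) t)|`, and the weight `rapidMinorant` attached to `B` reduces
that to the values of `t` as a function. -/
theorem comap_tensorToModel_le : comap (tensorToModel K) (𝓝 0) ≤ 𝓝 0 := by
  have hT : Tendsto (EpsTensor.toFun (CGamma K) (IndC (polWeights d)))
      (comap (tensorToModel K) (𝓝 0)) (𝓝 (EpsTensor.toFun (CGamma K) (IndC (polWeights d)) 0)) := by
    rw [UniformOnFun.tendsto_iff_tendstoUniformlyOn]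
    rintro _ ⟨A, B, hA, hB, rfl⟩
    obtain ⟨N, C, hC0, hC⟩ := ProjC.exists_norm_le_of_equicontinuous hA
    have hD := fun n => IndC.exists_norm_incl_le_of_equicontinuous hB n
    choose D hD0 hD using hD
    lift D to ℕ → ℝ≥0 using hD0
    have hm := MultiC.tendsto_iff_norm.1 (tendsto_comap (f := tensorToModel K) (x := 𝓝 0))
      (N, ⟨_, rapidlyDecreasing_rapidMinorant D⟩)
    rw [Metric.tendstoUniformlyOn_iff]
    intro ε hε
    -- `C + 1` instead of `C`, since `C` may be `0`.
    filter_upwards [hm (ε / (C + 1)) (by positivity)] with t ht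
    rintro ⟨φ, χ⟩ ⟨hφ, hχ⟩
    change dist (EpsTensor.pairing φ χ 0) (EpsTensor.pairing φ χ t) < ε
    rw [map_zero, dist_zero_left, ← EpsTensor.apply_evalRight]
    have h1 : ‖ProjC.proj N (EpsTensor.evalRight χ t)‖ ≤ ε / (C + 1) := by
      refine WeightedC.norm_le (by positivity) fun x => ?_
      change ‖ProjC.eval x (EpsTensor.evalRight χ t)‖ * _ ≤ _
      rw [EpsTensor.apply_evalRight, ← EpsTensor.apply_evalLeft]
      have hw : (0 : ℝ) < K.weights.weight N x := K.weights.pos N x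
      rw [← le_div_iff₀ hw]
      refine IndC.norm_apply_le_of_rapidMinorant
        (L := (χ : IndC (polWeights d) →ₗ[ℂ] ℂ)) (fun n g => hD n χ hχ g) fun ξ => ?_
      have h2 := (ht (x, ξ)).le
      rw [zero_sub, map_neg, ContinuousMap.neg_apply, norm_neg, toCont_tensorToModel,
        ← EpsTensor.apply_evalLeft, coe_epsWeight] at h2
      rw [le_div_iff₀ hw]
      refine le_trans (le_of_eq ?_) h2
      change _ = ‖IndC.toCont (EpsTensor.evalLeft (ProjC.eval x) t) ξ‖ *
        ((K.weights.weight N x : ℝ) * rapidMinorant D ξ)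
      ring
    calc ‖φ (EpsTensor.evalRight χ t)‖ ≤ C * (ε / (C + 1)) :=
          (hC φ hφ _).trans (mul_le_mul_of_nonneg_left h1 hC0)
      _ < (C + 1) * (ε / (C + 1)) := by
          have : 0 < ε / (C + 1) := by positivity
          nlinarith
      _ = ε := by field_simp
  have : 𝓝 (0 : EpsTensor (CGamma K) (IndC (polWeights d))) =
      comap (EpsTensor.toFun (CGamma K) (IndC (polWeights d))) (𝓝 (EpsTensor.toFun (CGamma K) (IndC (polWeights d)) 0)) := nhds_induced _ _
  rw [this]
  exact tendsto_iff_comap.1 hT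

theorem isUniformInducing_tensorToModel : IsUniformInducing (tensorToModel K) :=
  isUniformInducing_of_nhds_zero (tensorToModel K).toAddMonoidHom
    (le_antisymm (comap_tensorToModel_le K) (tendsto_tensorToModel K).le_comap)

end Model

/-! ### Density of the algebraic tensor product -/

section Density

variable {d : ℕ} {Γ : Set (Rd d)} (K : CCSExhaustion Γ)

/-- The function on `X × Y` represented by an element of `C(X) ⊗ C(Y)`. -/
def contTensorFun (X Y : Type) [TopologicalSpace X] [TopologicalSpace Y] :
    C(X, ℂ) ⊗[ℂ] C(Y, ℂ) →ₐ[ℂ] C(X × Y, ℂ) :=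
  Algebra.TensorProduct.productMap
    (ContinuousMap.compRightAlgHom ℂ ℂ ⟨Prod.fst, continuous_fst⟩)
    (ContinuousMap.compRightAlgHom ℂ ℂ ⟨Prod.snd, continuous_snd⟩)

theorem contTensorFun_tmul {X Y : Type} [TopologicalSpace X] [TopologicalSpace Y]
    (f : C(X, ℂ)) (g : C(Y, ℂ)) (p : X × Y) :
    contTensorFun X Y (f ⊗ₜ g) p = f p.1 * g p.2 := by
  rw [contTensorFun, Algebra.TensorProduct.productMap_apply_tmul]
  rfl

/-- Real Stone–Weierstrass, for the subalgebra of real functions whose complexification comes from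
`C(X) ⊗ C(Y)`. Distances to a point in either factor separate points; real and imaginary parts are
treated separately. -/
theorem exists_contTensorFun_near {X Y : Type} [MetricSpace X] [MetricSpace Y]
    {L : Set (X × Y)} (hL : IsCompact L) (F : C(X × Y, ℂ)) {ε : ℝ} (hε : 0 < ε) :
    ∃ s, ∀ p ∈ L, ‖F p - contTensorFun X Y s p‖ < ε := by
  let A : Subalgebra ℝ C(X × Y, ℝ) :=
    ((contTensorFun X Y).range.restrictScalars ℝ).comap
      (Complex.ofRealAm.compLeftContinuous ℝ Complex.continuous_ofReal)
  have hA : A.SeparatesPoints := by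
    intro p q hpq
    have hpq' : p.1 ≠ q.1 ∨ p.2 ≠ q.2 := by
      by_contra! h
      exact hpq (Prod.ext h.1 h.2)
    rcases hpq' with h | h
    · refine ⟨fun z => dist z.1 p.1, ⟨⟨fun z => dist z.1 p.1, by fun_prop⟩, ?_, rfl⟩, ?_⟩
      · refine ⟨(⟨fun x => (dist x p.1 : ℂ), by fun_prop⟩ : C(X, ℂ)) ⊗ₜ 1, ?_⟩
        ext z
        exact (contTensorFun_tmul _ _ z).trans (mul_one _)
      · simpa using (dist_pos.2 h.symm).ne
    · refine ⟨fun z => dist z.2 p.2, ⟨⟨fun z => dist z.2 p.2, by fun_prop⟩, ?_, rfl⟩, ?_⟩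
      · refine ⟨1 ⊗ₜ (⟨fun x => (dist x p.2 : ℂ), by fun_prop⟩ : C(Y, ℂ)), ?_⟩
        ext z
        exact (contTensorFun_tmul _ _ z).trans (one_mul _)
      · simpa using (dist_pos.2 h.symm).ne
  have key : ∀ G : C(X × Y, ℝ), ∃ s, ∀ p ∈ L, ‖(G p : ℂ) - contTensorFun X Y s p‖ < ε / 2 := by
    intro G
    obtain ⟨g, ⟨s, hs⟩, hg⟩ :=
      ContinuousMap.exists_mem_subalgebra_near_continuous_of_isCompact_of_separatesPoints hA G hL
        (half_pos hε)
    refine ⟨s, fun p hp => ?_⟩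
    have h1 : contTensorFun X Y s p = (g p : ℂ) := congrArg (fun h : C(X × Y, ℂ) => h p) hs
    rw [h1, ← Complex.ofReal_sub, Complex.norm_real, norm_sub_rev]
    exact hg p hp
  obtain ⟨s₁, h₁⟩ := key ⟨fun p => (F p).re, by fun_prop⟩
  obtain ⟨s₂, h₂⟩ := key ⟨fun p => (F p).im, by fun_prop⟩
  refine ⟨s₁ + Complex.I • s₂, fun p hp => ?_⟩
  have h3 : F p - contTensorFun X Y (s₁ + Complex.I • s₂) p =
      (((F p).re : ℂ) - contTensorFun X Y s₁ p) +
      Complex.I * (((F p).im : ℂ) - contTensorFun X Y s₂ p) := by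
    rw [map_add, map_smul, ContinuousMap.add_apply, ContinuousMap.smul_apply, smul_eq_mul]
    nth_rw 1 [← Complex.re_add_im (F p)]
    ring
  rw [h3]
  refine (norm_add_le _ _).trans_lt ?_
  rw [norm_mul, Complex.norm_I, one_mul]
  have := add_lt_add (h₁ p hp) (h₂ p hp)
  simpa using this

theorem norm_radialCutoff_mul_le (j : ℕ) (x : Rd d) (z : ℂ) :
    ‖(radialCutoff d j x : ℂ) * z‖ ≤ ‖z‖ := by
  rw [norm_mul, Complex.norm_real]
  exact mul_le_of_le_one_left (norm_nonneg _) (abs_radialCutoff_le j x)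

theorem exists_bound_radialCutoff_mul (j : ℕ) (f w : Rd d → ℂ) (hf : Continuous f)
    (hw : Continuous w) : ∃ C, ∀ x, ‖(radialCutoff d j x : ℂ) * f x‖ * ‖w x‖ ≤ C := by
  obtain ⟨C, hC⟩ := (isCompact_closedBall (0 : Rd d) (j + 1)).exists_bound_of_continuousOn
    (f := fun x => f x * w x) (by fun_prop)
  refine ⟨C, fun x => ?_⟩
  have hC0 : 0 ≤ C := (norm_nonneg _).trans (hC 0 (Metric.mem_closedBall_self (by positivity)))
  by_cases h : ‖x‖ ≤ j + 1
  · have h1 := hC x (by simpa using h)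
    rw [norm_mul] at h1
    exact (mul_le_mul_of_nonneg_right (norm_radialCutoff_mul_le j x (f x)) (norm_nonneg _)).trans h1
  · rw [radialCutoff_eq_zero (by linarith), Complex.ofReal_zero, zero_mul, norm_zero, zero_mul]
    exact hC0

/-- Multiplication with a cutoff function as a map `C(ℝ^d) → C_Γ(ℝ^d)`. -/
def cutoffProj (j : ℕ) : C(Rd d, ℂ) →ₗ[ℂ] CGamma K where
  toFun f := ⟨⟨fun x => (radialCutoff d j x : ℂ) * f x, by fun_prop⟩, by
    refine (Submodule.mem_iInf _).2 fun N => ?_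
    obtain ⟨C, hC⟩ := exists_bound_radialCutoff_mul j f
      (fun x => ((K.weights.weight N x : ℝ) : ℂ)) f.continuous
      (by have := K.weights.cont N; fun_prop)
    refine ⟨C, ?_⟩
    rintro _ ⟨x, rfl⟩
    have := hC x
    rwa [Complex.norm_real, Real.norm_of_nonneg (NNReal.coe_nonneg _)] at this⟩
  map_add' f g := Subtype.ext <| ContinuousMap.ext fun x => mul_add (radialCutoff d j x : ℂ) _ _
  map_smul' c f := Subtype.ext <| ContinuousMap.ext fun x =>
    mul_left_comm (radialCutoff d j x : ℂ) c _

/-- Multiplication with a cutoff function as a map `C(ℝ^d) → 𝒱_pol C(ℝ^d)`. -/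
def cutoffInd (d j : ℕ) : C(Rd d, ℂ) →ₗ[ℂ] IndC (polWeights d) where
  toFun f := ⟨⟨fun x => (radialCutoff d j x : ℂ) * f x, by fun_prop⟩, by
    obtain ⟨C, hC⟩ := exists_bound_radialCutoff_mul j f
      (fun x => (((polWeights d).weight 0 x : ℝ) : ℂ)) f.continuous
      (by have := (polWeights d).cont 0; fun_prop)
    refine ⟨0, C, ?_⟩
    rintro _ ⟨x, rfl⟩
    have := hC x
    rwa [Complex.norm_real, Real.norm_of_nonneg (NNReal.coe_nonneg _)] at this⟩
  map_add' f g := Subtype.ext <| ContinuousMap.ext fun x => mul_add (radialCutoff d j x : ℂ) _ _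
  map_smul' c f := Subtype.ext <| ContinuousMap.ext fun x =>
    mul_left_comm (radialCutoff d j x : ℂ) c _

theorem toCont_tensorToModel_cutoff (j : ℕ) (s : C(Rd d, ℂ) ⊗[ℂ] C(Rd d, ℂ)) (p : Rd d × Rd d) :
    MultiC.toCont (tensorToModel K (TensorProduct.map (cutoffProj K j) (cutoffInd d j) s)) p =
      (radialCutoff d j p.1 : ℂ) * ((radialCutoff d j p.2 : ℂ) * contTensorFun _ _ s p) := by
  induction s using TensorProduct.induction_on with
  | zero =>
    have h : tensorToModel K 0 = 0 := map_zero (tensorToModel K)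
    rw [map_zero, map_zero, ContinuousMap.zero_apply, mul_zero, mul_zero]
    refine (congrArg (fun F => MultiC.toCont F p) h).trans ?_
    rw [map_zero, ContinuousMap.zero_apply]
  | tmul f g =>
    rw [TensorProduct.map_tmul, toCont_tensorToModel_tmul, contTensorFun_tmul]
    change (radialCutoff d j p.1 : ℂ) * f p.1 * ((radialCutoff d j p.2 : ℂ) * g p.2) = _
    ring
  | add s t hs ht =>
    have h : ∀ a b, tensorToModel K (a + b) = tensorToModel K a + tensorToModel K b :=
      map_add (tensorToModel K)
    rw [map_add, map_add, ContinuousMap.add_apply]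
    refine (congrArg (fun F => MultiC.toCont F p) (h _ _)).trans ?_
    rw [map_add, ContinuousMap.add_apply, hs, ht]
    ring

/-- Truncation of a function on `ℝ^{2d}`. -/
def truncate (j : ℕ) (F : EpsModel K) : EpsModel K :=
  MultiC.mk ⟨fun p => (radialCutoff d j p.1 : ℂ) * ((radialCutoff d j p.2 : ℂ) * MultiC.toCont F p),
    by fun_prop⟩ fun i => by
      obtain ⟨C, hC⟩ := F.exists_bound i
      refine ⟨C, fun p => le_trans (mul_le_mul_of_nonneg_right ?_ (NNReal.coe_nonneg _)) (hC p)⟩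
      exact (norm_radialCutoff_mul_le j _ _).trans (norm_radialCutoff_mul_le j _ _)

theorem toCont_truncate (j : ℕ) (F : EpsModel K) (p : Rd d × Rd d) :
    MultiC.toCont (truncate K j F) p =
      (radialCutoff d j p.1 : ℂ) * ((radialCutoff d j p.2 : ℂ) * MultiC.toCont F p) := rfl

theorem exists_bound_epsWeight (j : ℕ) (i : ℕ × {v : Rd d → ℝ≥0 // RapidlyDecreasing v}) :
    ∃ C, 0 < C ∧ ∀ p : Rd d × Rd d, ‖p.1‖ ≤ j + 1 → (epsWeight K i p : ℝ) ≤ C := by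
  obtain ⟨C, hC⟩ := (isCompact_closedBall (0 : Rd d) (j + 1)).exists_bound_of_continuousOn
    (f := fun x => (K.weights.weight i.1 x : ℝ))
    (by have := K.weights.cont i.1; fun_prop)
  obtain ⟨D, hD⟩ := i.2.2 0
  refine ⟨|C| * |D| + 1, by positivity, fun p hp => ?_⟩
  have h1 := hC p.1 (by simpa using hp)
  have h2 := hD p.2
  rw [pow_zero, mul_one] at h2
  rw [Real.norm_of_nonneg (NNReal.coe_nonneg _)] at h1
  rw [coe_epsWeight]
  have h3 := mul_le_mul (h1.trans (le_abs_self C)) (h2.trans (le_abs_self D))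
    (NNReal.coe_nonneg _) (abs_nonneg C)
  linarith

/-- The approximants carry the same cutoffs as the truncation, so the error vanishes off a product
of balls. On that product every weight is bounded. -/
theorem truncate_mem_closure (j : ℕ) (F : EpsModel K) :
    truncate K j F ∈ closure (range (tensorToModel K)) := by
  have hB := isCompact_closedBall (0 : Rd d) (j + 1)
  have happrox := fun k : ℕ => exists_contTensorFun_near (hB.prod hB) (MultiC.toCont F)
    (ε := 1 / ((k : ℝ) + 1)) (by positivity)
  choose s hs using happrox
  refine mem_closure_of_tendsto (b := atTop) (f := fun k =>
    tensorToModel K (TensorProduct.map (cutoffProj K j) (cutoffInd d j) (s k))) ?_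
    (Eventually.of_forall fun k => mem_range_self _)
  rw [MultiC.tendsto_iff_norm]
  intro i ε hε
  obtain ⟨C, hC0, hC⟩ := exists_bound_epsWeight K j i
  have h1 := (tendsto_order.1 (tendsto_one_div_add_atTop_nhds_zero_nat (𝕜 := ℝ))).2 (ε / C)
    (by positivity)
  filter_upwards [h1] with k hk p
  rw [map_sub, ContinuousMap.sub_apply, toCont_truncate, toCont_tensorToModel_cutoff, ← mul_sub,
    ← mul_sub]
  by_cases hp : ‖p.1‖ ≤ j + 1 ∧ ‖p.2‖ ≤ j + 1
  · have h2 := hs k p ⟨by simpa using hp.1, by simpa using hp.2⟩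
    calc _ ≤ 1 / ((k : ℝ) + 1) * C := by
          refine mul_le_mul ?_ (hC p hp.1) (NNReal.coe_nonneg _) (by positivity)
          exact (norm_radialCutoff_mul_le j _ _).trans
            ((norm_radialCutoff_mul_le j _ _).trans h2.le)
      _ < ε / C * C := by gcongr
      _ = ε := by field_simp
  · have : (radialCutoff d j p.1 : ℂ) = 0 ∨ (radialCutoff d j p.2 : ℂ) = 0 := by
      rw [not_and_or, not_le, not_le] at hp
      refine hp.imp (fun h => ?_) fun h => ?_ <;> rw [radialCutoff_eq_zero h.le, Complex.ofReal_zero]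
    rcases this with h | h <;> simp [h, hε]

/-- Bounding `F` against the stronger weight `w_M(x) v(ξ)(1 + |ξ|)` makes `|F| w_N v` decay like
`e^{-r|x|} (1 + |ξ|)^{-1}`, hence small off the region where both cutoffs are `1`. -/
theorem tendsto_truncate (hopen : IsOpen Γ) (F : EpsModel K) :
    Tendsto (fun j => truncate K j F) atTop (𝓝 F) := by
  rw [MultiC.tendsto_iff_norm]
  rintro ⟨N, v, hv⟩ ε hε
  obtain ⟨M, r, hr, hM⟩ := K.exists_weight_gain hopen N
  have hv' : RapidlyDecreasing fun ξ => v ξ * (1 + ‖ξ‖₊) := by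
    intro n
    obtain ⟨C, hC⟩ := hv (n + 1)
    refine ⟨C, fun ξ => le_trans (le_of_eq ?_) (hC ξ)⟩
    push_cast
    ring
  obtain ⟨C, hC⟩ := F.exists_bound (M, ⟨_, hv'⟩)
  have hC0 : 0 ≤ C := (mul_nonneg (norm_nonneg _) (NNReal.coe_nonneg _)).trans (hC 0)
  have hlim : Tendsto (fun j : ℕ => C * (Real.exp (-(r * j)) + 1 / ((j : ℝ) + 1))) atTop (𝓝 0) := by
    have h1 : Tendsto (fun j : ℕ => Real.exp (-(r * j))) atTop (𝓝 0) :=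
      Real.tendsto_exp_neg_atTop_nhds_zero.comp
        (tendsto_natCast_atTop_atTop.const_mul_atTop hr)
    simpa using (h1.add (tendsto_one_div_add_atTop_nhds_zero_nat (𝕜 := ℝ))).const_mul C
  filter_upwards [(tendsto_order.1 hlim).2 ε hε] with j hj p
  refine lt_of_le_of_lt ?_ hj
  rw [map_sub, ContinuousMap.sub_apply, toCont_truncate]
  have hmain : ‖MultiC.toCont F p‖ * (epsWeight K (N, ⟨v, hv⟩) p : ℝ) ≤
      C * (Real.exp (-(r * ‖p.1‖)) * (1 / (‖p.2‖ + 1))) := by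
    have h1 := hC p
    rw [coe_epsWeight] at h1 ⊢
    push_cast at h1
    rw [mul_one_div, ← mul_div_assoc, le_div_iff₀ (by positivity), Real.exp_neg,
      ← div_eq_mul_inv, le_div_iff₀ (Real.exp_pos _)]
    calc _ = ‖MultiC.toCont F p‖ * ((K.weights.weight N p.1 * Real.exp (r * ‖p.1‖)) *
          (v p.2 * (1 + ‖p.2‖))) := by simp only; ring
      _ ≤ ‖MultiC.toCont F p‖ * (K.weights.weight M p.1 * (v p.2 * (1 + ‖p.2‖))) := by
          gcongr
          exact hM p.1
      _ ≤ C := h1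
  by_cases hp : ‖p.1‖ ≤ j ∧ ‖p.2‖ ≤ j
  · rw [radialCutoff_eq_one hp.1, radialCutoff_eq_one hp.2]
    simp only [Complex.ofReal_one, one_mul, sub_self, norm_zero, zero_mul]
    positivity
  · have hle : ‖MultiC.toCont F p - (radialCutoff d j p.1 : ℂ) *
        ((radialCutoff d j p.2 : ℂ) * MultiC.toCont F p)‖ ≤ ‖MultiC.toCont F p‖ := by
      have h1 : MultiC.toCont F p - (radialCutoff d j p.1 : ℂ) *
          ((radialCutoff d j p.2 : ℂ) * MultiC.toCont F p) =
          ((1 - radialCutoff d j p.1 * radialCutoff d j p.2 : ℝ) : ℂ) * MultiC.toCont F p := by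
        push_cast
        ring
      rw [h1, norm_mul, Complex.norm_real]
      refine mul_le_of_le_one_left (norm_nonneg _) ?_
      have h2 := mul_nonneg (radialCutoff_nonneg j p.1) (radialCutoff_nonneg j p.2)
      have h3 := mul_le_one₀ (radialCutoff_le_one j p.1) (radialCutoff_nonneg j p.2)
        (radialCutoff_le_one j p.2)
      rw [Real.norm_of_nonneg (by linarith)]
      linarith
    refine (mul_le_mul_of_nonneg_right hle (NNReal.coe_nonneg _)).trans (hmain.trans ?_)
    refine mul_le_mul_of_nonneg_left ?_ hC0
    rw [not_and_or, not_le, not_le] at hp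
    have h5 : 0 ≤ 1 / (‖p.2‖ + 1) := by positivity
    have h6 : 1 / (‖p.2‖ + 1) ≤ 1 := by
      rw [div_le_one (by positivity)]
      linarith [norm_nonneg p.2]
    have h7 : Real.exp (-(r * ‖p.1‖)) ≤ 1 := Real.exp_le_one_iff.2 (by simp; positivity)
    rcases hp with h | h
    · have h8 : Real.exp (-(r * ‖p.1‖)) ≤ Real.exp (-(r * j)) := by gcongr
      have : (0 : ℝ) ≤ 1 / ((j : ℝ) + 1) := by positivity
      have := mul_le_mul h8 h6 h5 (Real.exp_pos _).le
      linarith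
    · have h8 : 1 / (‖p.2‖ + 1) ≤ 1 / ((j : ℝ) + 1) := by gcongr
      have := mul_le_mul h7 h8 h5 zero_le_one
      have := Real.exp_pos (-(r * j))
      linarith

theorem denseRange_tensorToModel (hopen : IsOpen Γ) : DenseRange (tensorToModel K) := fun F =>
  isClosed_closure.mem_of_tendsto (tendsto_truncate K hopen F)
    (Eventually.of_forall fun j => truncate_mem_closure K j F)

/-- The model space as a completion of the algebraic tensor product. -/
def modelCompletion (hopen : IsOpen Γ) :
    AbstractCompletion (EpsTensor (CGamma K) (IndC (polWeights d))) where
  space := EpsModel K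
  coe := tensorToModel K
  uniformStruct := inferInstance
  complete := inferInstance
  separation := inferInstance
  isUniformInducing := isUniformInducing_tensorToModel K
  dense := denseRange_tensorToModel K hopen

/-- The completed `ε`-tensor product is isomorphic to the model space. -/
def completedEquivModel (hopen : IsOpen Γ) : CGammaTensorPol K ≃ᵤ EpsModel K :=
  UniformSpace.Completion.cPkg.compareEquiv (modelCompletion K hopen)

theorem continuous_toFunction (p : Rd d × Rd d) :
    Continuous fun u : CGammaTensorPol K => toFunction u p :=
  UniformSpace.Completion.continuous_extension

/-- Both sides are continuous in `u` and agree on the dense algebraic tensor product. -/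
theorem toFunction_eq (hopen : IsOpen Γ) (u : CGammaTensorPol K) (p : Rd d × Rd d) :
    toFunction u p = MultiC.toCont (completedEquivModel K hopen u) p := by
  induction u using UniformSpace.Completion.induction_on with
  | hp =>
    exact isClosed_eq (continuous_toFunction K p)
      ((MultiC.continuous_eval (epsWeight_expIndex_pos K 0 p)).comp
        (completedEquivModel K hopen).continuous)
  | ih t =>
    have h : completedEquivModel K hopen (t : CGammaTensorPol K) = tensorToModel K t :=
      AbstractCompletion.compare_coe _ (modelCompletion K hopen) t
    rw [h, toCont_tensorToModel]
    exact CompletedEpsTensor.pairing_coe _ _ t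

theorem toFunction_injective (hopen : IsOpen Γ) :
    Function.Injective (toFunction : CGammaTensorPol K → Rd d × Rd d → ℂ) := by
  intro u w h
  refine (completedEquivModel K hopen).injective (MultiC.toCont_injective ?_)
  ext p
  rw [← toFunction_eq, ← toFunction_eq, h]

theorem toFunction_symm (hopen : IsOpen Γ) (F : EpsModel K) (p : Rd d × Rd d) :
    toFunction ((completedEquivModel K hopen).symm F) p = MultiC.toCont F p := by
  rw [toFunction_eq K hopen]
  exact congrArg (fun G => MultiC.toCont G p) ((completedEquivModel K hopen).apply_symm_apply F)

theorem toFunction_add (u w : CGammaTensorPol K) (p : Rd d × Rd d) :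
    toFunction (u + w) p = toFunction u p + toFunction w p := by
  induction u, w using UniformSpace.Completion.induction_on₂ with
  | hp =>
    have h := continuous_toFunction K p
    exact isClosed_eq (h.comp continuous_add)
      ((h.comp continuous_fst).add (h.comp continuous_snd))
  | ih s t =>
    rw [← UniformSpace.Completion.coe_add]
    exact (CompletedEpsTensor.pairing_coe _ _ (s + t)).trans ((map_add _ s t).trans
      (congrArg₂ (· + ·) (CompletedEpsTensor.pairing_coe _ _ s).symm
        (CompletedEpsTensor.pairing_coe _ _ t).symm))

theorem toFunction_smul (c : ℂ) (u : CGammaTensorPol K) (p : Rd d × Rd d) :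
    toFunction (c • u) p = c * toFunction u p := by
  induction u using UniformSpace.Completion.induction_on with
  | hp =>
    have h := continuous_toFunction K p
    exact isClosed_eq (h.comp (continuous_const_smul c)) (continuous_const.mul h)
  | ih t =>
    rw [← UniformSpace.Completion.coe_smul]
    exact (CompletedEpsTensor.pairing_coe _ _ (c • t)).trans ((map_smul _ c t).trans
      (congrArg (c * ·) (CompletedEpsTensor.pairing_coe _ _ t).symm))

/-- Boundedness with respect to all rapidly decreasing weights amounts to polynomial growth. -/
theorem EpsModel.exists_pol_bound (F : EpsModel K) (N : ℕ) : ∃ (n : ℕ) (C : ℝ), ∀ x ξ : Rd d,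
    ‖MultiC.toCont F (x, ξ)‖ * K.weights.weight N x * ((1 + ‖ξ‖) ^ n)⁻¹ ≤ C := by
  by_contra! hcon
  choose x ξ hxξ using fun n : ℕ => hcon n n
  -- A weight living only on the bad points `ξ n`, which contradicts boundedness there. Weights need
  -- not be continuous, and the points may repeat, whence the supremum.
  let v : Rd d → ℝ≥0 := fun ζ => ⨆ n : ℕ, if ξ n = ζ then ((1 + ‖ζ‖₊) ^ n)⁻¹ else 0
  have hle : ∀ ζ (n : ℕ), (if ξ n = ζ then ((1 + ‖ζ‖₊) ^ n)⁻¹ else 0 : ℝ≥0) ≤ 1 := by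
    intro ζ n
    split_ifs
    · exact inv_le_one_of_one_le₀ (one_le_pow₀ (by simp))
    · exact zero_le_one
  have hbdd : ∀ ζ, BddAbove (range fun n : ℕ =>
      (if ξ n = ζ then ((1 + ‖ζ‖₊) ^ n)⁻¹ else 0 : ℝ≥0)) := fun ζ =>
    ⟨1, by rintro _ ⟨n, rfl⟩; exact hle ζ n⟩
  have hv : RapidlyDecreasing v := by
    intro k
    -- Terms with `n ≥ k` contribute at most `1`; the finitely many others are covered by the sum.
    refine ⟨(1 + ∑ n ∈ Finset.range k, (1 + ‖ξ n‖₊) ^ k : ℝ≥0), fun ζ => ?_⟩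
    have h : v ζ * (1 + ‖ζ‖₊) ^ k ≤ 1 + ∑ n ∈ Finset.range k, (1 + ‖ξ n‖₊) ^ k := by
      rw [← le_div_iff₀ (by positivity)]
      refine ciSup_le fun n => ?_
      rw [le_div_iff₀ (by positivity)]
      split_ifs with h1
      · rcases lt_or_ge n k with h2 | h2
        · have h3 : (1 + ‖ξ n‖₊) ^ k ≤ ∑ n ∈ Finset.range k, (1 + ‖ξ n‖₊) ^ k :=
            Finset.single_le_sum (f := fun n => (1 + ‖ξ n‖₊) ^ k) (fun _ _ => zero_le)
              (Finset.mem_range.2 h2)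
          have h4 : ((1 + ‖ζ‖₊) ^ n)⁻¹ ≤ 1 := inv_le_one_of_one_le₀ (one_le_pow₀ (by simp))
          rw [← h1] at h4 ⊢
          calc _ ≤ 1 * (1 + ‖ξ n‖₊) ^ k := by gcongr
            _ ≤ _ := by rw [one_mul]; exact h3.trans le_add_self
        · refine le_trans ?_ le_self_add
          rw [inv_mul_le_iff₀ (by positivity), mul_one]
          exact pow_le_pow_right₀ (by simp) h2
      · rw [zero_mul]
        exact zero_le
    exact_mod_cast h
  obtain ⟨C, hC⟩ := F.exists_bound (N, ⟨v, hv⟩)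
  obtain ⟨n, hn⟩ := exists_nat_ge C
  refine absurd (hxξ n) (not_lt.2 (le_trans ?_ ((hC (x n, ξ n)).trans hn)))
  rw [coe_epsWeight, mul_assoc]
  have h1 : ((1 + ‖ξ n‖₊) ^ n)⁻¹ ≤ v (ξ n) := by
    have := le_ciSup (hbdd (ξ n)) n
    rwa [if_pos rfl] at this
  have h2 : ((1 + ‖ξ n‖) ^ n)⁻¹ ≤ (v (ξ n) : ℝ) := by exact_mod_cast h1
  gcongr

/-- Growth of order `n` in `ξ` is compensated by any rapidly decreasing `v`, which gives membership
in the model; the converse is `EpsModel.exists_pol_bound`. -/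
theorem range_toFunction (hopen : IsOpen Γ) :
    range (toFunction : CGammaTensorPol K → Rd d × Rd d → ℂ) =
      {F | Continuous F ∧ ∀ N : ℕ, ∃ (n : ℕ) (C : ℝ), ∀ x ξ : Rd d,
        ‖F (x, ξ)‖ * Real.exp (supportingFunction (-K.set N) x) * ((1 + ‖ξ‖) ^ n)⁻¹ ≤ C} := by
  ext F
  constructor
  · rintro ⟨u, rfl⟩
    have h : toFunction u = MultiC.toCont (completedEquivModel K hopen u) :=
      funext fun p => toFunction_eq K hopen u p
    rw [h]
    exact ⟨ContinuousMap.continuous _, fun N => EpsModel.exists_pol_bound K _ N⟩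
  · rintro ⟨hF, hb⟩
    have hb' : ∀ i, ∃ C, ∀ p, ‖(⟨F, hF⟩ : C(Rd d × Rd d, ℂ)) p‖ * (epsWeight K i p : ℝ) ≤ C := by
      rintro ⟨N, v, hv⟩
      obtain ⟨n, C, hC⟩ := hb N
      obtain ⟨D, hD⟩ := hv n
      refine ⟨C * D, fun p => ?_⟩
      have h1 := mul_le_mul (hC p.1 p.2) (hD p.2) (by positivity)
        (le_trans (by positivity) (hC p.1 p.2))
      refine le_trans (le_of_eq ?_) h1
      rw [coe_epsWeight, coe_weights]
      change ‖F (p.1, p.2)‖ * _ = _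
      field_simp
    exact ⟨(completedEquivModel K hopen).symm (MultiC.mk ⟨F, hF⟩ hb'),
      funext fun p => toFunction_symm K hopen _ p⟩

end Density

/-! ### Bounded sets, translations and modulations in the Schwartz space -/

section Schwartz

open scoped FourierTransform

variable {d : ℕ}

namespace SchwartzMap

theorem isVonNBounded_of_bound {B : Set 𝓢(Rd d, ℂ)}
    (h : ∀ k n : ℕ, ∃ C, ∀ f ∈ B, ∀ t, ‖t‖ ^ k * ‖iteratedFDeriv ℝ n f t‖ ≤ C) :
    Bornology.IsVonNBounded ℂ B := by
  rw [(schwartz_withSeminorms ℂ (Rd d) ℂ).isVonNBounded_iff_seminorm_bounded]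
  rintro ⟨k, n⟩
  obtain ⟨C, hC⟩ := h k n
  refine ⟨|C| + 1, by positivity, fun f hf => ?_⟩
  refine lt_of_le_of_lt (seminorm_le_bound ℂ k n f (abs_nonneg C) fun t =>
    (hC f hf t).trans (le_abs_self C)) (lt_add_one _)

theorem exists_bound_of_isVonNBounded {B : Set 𝓢(Rd d, ℂ)} (h : Bornology.IsVonNBounded ℂ B)
    (k n : ℕ) : ∃ C, 0 ≤ C ∧ ∀ f ∈ B, ∀ t, (1 + ‖t‖) ^ k * ‖iteratedFDeriv ℝ n f t‖ ≤ C := by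
  rw [(schwartz_withSeminorms ℂ (Rd d) ℂ).isVonNBounded_iff_finset_seminorm_bounded] at h
  obtain ⟨r, hr, hB⟩ := h (Finset.Iic (k, n))
  refine ⟨2 ^ k * r, by positivity, fun f hf t => ?_⟩
  refine (one_add_le_sup_seminorm_apply (𝕜 := ℂ) (m := (k, n)) le_rfl le_rfl f t).trans ?_
  exact mul_le_mul_of_nonneg_left (hB f hf).le (by positivity)

theorem exists_bound (f : 𝓢(Rd d, ℂ)) (k n : ℕ) :
    ∃ C, 0 ≤ C ∧ ∀ t, (1 + ‖t‖) ^ k * ‖iteratedFDeriv ℝ n f t‖ ≤ C := by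
  obtain ⟨C, hC0, hC⟩ := exists_bound_of_isVonNBounded
    (Bornology.isVonNBounded_singleton (𝕜 := ℂ) f) k n
  exact ⟨C, hC0, hC f rfl⟩

theorem iteratedFDeriv_compSubConstCLM (f : 𝓢(Rd d, ℂ)) (x t : Rd d) (n : ℕ) :
    iteratedFDeriv ℝ n (compSubConstCLM ℂ x f) t = iteratedFDeriv ℝ n f (t - x) :=
  iteratedFDeriv_comp_sub (f := f) n x t

theorem norm_iteratedFDeriv_smul (c : ℂ) (f : 𝓢(Rd d, ℂ)) (t : Rd d) (n : ℕ) :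
    ‖iteratedFDeriv ℝ n (c • f) t‖ = ‖c‖ * ‖iteratedFDeriv ℝ n f t‖ := by
  have h : iteratedFDeriv ℝ n (c • f) t = c • iteratedFDeriv ℝ n f t :=
    iteratedFDeriv_const_smul_apply ((f.smooth n).contDiffAt)
  rw [h, norm_smul]

theorem one_add_norm_le (x t : Rd d) : 1 + ‖t‖ ≤ (1 + ‖x‖) * (1 + ‖t - x‖) := by
  have h1 : ‖t‖ ≤ ‖x‖ + ‖t - x‖ := by
    calc ‖t‖ = ‖x + (t - x)‖ := by rw [add_sub_cancel]
      _ ≤ _ := norm_add_le _ _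
  have h2 := mul_nonneg (norm_nonneg x) (norm_nonneg (t - x))
  linarith

/-- The translates of a bounded set, damped by a rapidly decreasing weight, form a bounded set. -/
theorem isVonNBounded_smul_translate {B : Set 𝓢(Rd d, ℂ)} (hB : Bornology.IsVonNBounded ℂ B)
    {v : Rd d → ℝ≥0} (hv : RapidlyDecreasing v) :
    Bornology.IsVonNBounded ℂ {g : 𝓢(Rd d, ℂ) | ∃ f ∈ B, ∃ x : Rd d,
      g = ((v x : ℝ) : ℂ) • compSubConstCLM ℂ x f} := by
  refine isVonNBounded_of_bound fun k n => ?_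
  obtain ⟨C, hC0, hC⟩ := exists_bound_of_isVonNBounded hB k n
  obtain ⟨D, hD⟩ := hv k
  refine ⟨D * C, ?_⟩
  rintro _ ⟨f, hf, x, rfl⟩ t
  rw [norm_iteratedFDeriv_smul, iteratedFDeriv_compSubConstCLM, Complex.norm_real,
    Real.norm_of_nonneg (NNReal.coe_nonneg _)]
  have h1 : ‖t‖ ^ k ≤ (1 + ‖x‖) ^ k * (1 + ‖t - x‖) ^ k := by
    rw [← mul_pow]
    gcongr
    linarith [one_add_norm_le x t]
  calc _ ≤ ((1 + ‖x‖) ^ k * (1 + ‖t - x‖) ^ k) * (v x * ‖iteratedFDeriv ℝ n f (t - x)‖) := by gcongr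
    _ = (v x * (1 + ‖x‖) ^ k) * ((1 + ‖t - x‖) ^ k * ‖iteratedFDeriv ℝ n f (t - x)‖) := by ring
    _ ≤ D * C := mul_le_mul (hD x) (hC f hf _) (by positivity)
        ((by positivity : (0 : ℝ) ≤ v x * (1 + ‖x‖) ^ k).trans (hD x))

theorem seminorm_translate_le (k n : ℕ) : ∃ s : Finset (ℕ × ℕ), ∃ C : ℝ, 0 ≤ C ∧
    ∀ (f : 𝓢(Rd d, ℂ)) (x : Rd d), SchwartzMap.seminorm ℂ k n (compSubConstCLM ℂ x f) ≤
      C * (1 + ‖x‖) ^ k * (s.sup (schwartzSeminormFamily ℂ (Rd d) ℂ)) f := by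
  refine ⟨Finset.Iic (k, n), 2 ^ k, by positivity, fun f x => ?_⟩
  refine seminorm_le_bound ℂ k n _ (mul_nonneg (by positivity) (apply_nonneg _ _)) fun t => ?_
  rw [iteratedFDeriv_compSubConstCLM]
  have h1 : ‖t‖ ^ k ≤ (1 + ‖x‖) ^ k * (1 + ‖t - x‖) ^ k := by
    rw [← mul_pow]
    gcongr
    linarith [one_add_norm_le x t]
  have h2 := one_add_le_sup_seminorm_apply (𝕜 := ℂ) (m := (k, n)) le_rfl le_rfl f (t - x)
  calc _ ≤ ((1 + ‖x‖) ^ k * (1 + ‖t - x‖) ^ k) * ‖iteratedFDeriv ℝ n f (t - x)‖ := by gcongr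
    _ = (1 + ‖x‖) ^ k * ((1 + ‖t - x‖) ^ k * ‖iteratedFDeriv ℝ n f (t - x)‖) := by ring
    _ ≤ (1 + ‖x‖) ^ k * (2 ^ k * ((Finset.Iic (k, n)).sup
          (schwartzSeminormFamily ℂ (Rd d) ℂ)) f) := mul_le_mul_of_nonneg_left h2 (by positivity)
    _ = _ := by ring

/-- Mean value inequality for the `n`-th derivative on the unit ball around `t - x₀`, where `|t| ≤
(2 + |x₀|)(1 + |y|)`, so the decay of the next derivative absorbs `|t|^k`. -/
theorem seminorm_translate_sub_le (f : 𝓢(Rd d, ℂ)) (x₀ : Rd d) (k n : ℕ) : ∃ C : ℝ, 0 ≤ C ∧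
    ∀ x ∈ Metric.ball x₀ 1, SchwartzMap.seminorm ℂ k n
      (compSubConstCLM ℂ x f - compSubConstCLM ℂ x₀ f) ≤ C * ‖x - x₀‖ := by
  obtain ⟨C, hC0, hC⟩ := f.exists_bound k (n + 1)
  refine ⟨(2 + ‖x₀‖) ^ k * C, by positivity, fun x hx => ?_⟩
  refine seminorm_le_bound ℂ k n _ (by positivity) fun t => ?_
  have h1 : iteratedFDeriv ℝ n (compSubConstCLM ℂ x f - compSubConstCLM ℂ x₀ f) t =
      iteratedFDeriv ℝ n f (t - x) - iteratedFDeriv ℝ n f (t - x₀) := by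
    rw [← iteratedFDeriv_compSubConstCLM, ← iteratedFDeriv_compSubConstCLM]
    exact iteratedFDeriv_sub_apply ((smooth _ n).contDiffAt) ((smooth _ n).contDiffAt)
  rw [h1]
  rcases eq_or_ne (‖t‖ ^ k) 0 with h0 | h0
  · rw [h0, zero_mul]; positivity
  have hpos : 0 < ‖t‖ ^ k := lt_of_le_of_ne (by positivity) h0.symm
  rw [← le_div_iff₀' hpos]
  have hd : Differentiable ℝ (iteratedFDeriv ℝ n f) :=
    (f.smooth (n + 1)).differentiable_iteratedFDeriv (by exact_mod_cast Nat.lt_succ_self n)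
  have h2 := Convex.norm_image_sub_le_of_norm_fderiv_le (𝕜 := ℝ) (f := iteratedFDeriv ℝ n f)
    (s := Metric.ball (t - x₀) 1) (x := t - x₀) (y := t - x)
    (C := (2 + ‖x₀‖) ^ k * C / ‖t‖ ^ k) (fun y _ => hd y) (fun y hy => ?_) (convex_ball _ _)
    (Metric.mem_ball_self one_pos) (by
      rw [mem_ball_iff_norm] at hx ⊢
      rw [sub_sub_sub_cancel_left, norm_sub_rev]
      exact hx)
  · rw [sub_sub_sub_cancel_left, norm_sub_rev x₀ x] at h2
    refine h2.trans (le_of_eq ?_)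
    ring
  · rw [norm_fderiv_iteratedFDeriv, le_div_iff₀' hpos]
    have h3 : ‖t‖ ≤ (2 + ‖x₀‖) * (1 + ‖y‖) := by
      have h4 : ‖t‖ ≤ ‖y‖ + ‖t - y‖ := by
        calc ‖t‖ = ‖y + (t - y)‖ := by rw [add_sub_cancel]
          _ ≤ _ := norm_add_le _ _
      have h5 : ‖t - y‖ ≤ 1 + ‖x₀‖ := by
        rw [mem_ball_iff_norm] at hy
        calc ‖t - y‖ = ‖x₀ - (y - (t - x₀))‖ := by congr 1; abel
          _ ≤ ‖x₀‖ + ‖y - (t - x₀)‖ := norm_sub_le _ _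
          _ ≤ 1 + ‖x₀‖ := by linarith
      have := norm_nonneg y
      have := norm_nonneg x₀
      nlinarith
    calc ‖t‖ ^ k * ‖iteratedFDeriv ℝ (n + 1) f y‖
        ≤ ((2 + ‖x₀‖) * (1 + ‖y‖)) ^ k * ‖iteratedFDeriv ℝ (n + 1) f y‖ := by gcongr
      _ = (2 + ‖x₀‖) ^ k * ((1 + ‖y‖) ^ k * ‖iteratedFDeriv ℝ (n + 1) f y‖) := by
          rw [mul_pow, mul_assoc]
      _ ≤ (2 + ‖x₀‖) ^ k * C := by gcongr; exact hC y

/-- The translation action on the Schwartz space is jointly continuous. -/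
theorem continuous_translate :
    Continuous fun q : Rd d × 𝓢(Rd d, ℂ) => compSubConstCLM ℂ q.1 q.2 := by
  refine continuous_iff_continuousAt.2 fun ⟨x₀, f₀⟩ => ?_
  refine ((schwartz_withSeminorms ℂ (Rd d) ℂ).tendsto_nhds _ _).2 ?_
  rintro ⟨k, n⟩ ε hε
  obtain ⟨s, C, hC0, hC⟩ := seminorm_translate_le (d := d) k n
  obtain ⟨D, hD0, hD⟩ := seminorm_translate_sub_le f₀ x₀ k n
  set p := s.sup (schwartzSeminormFamily ℂ (Rd d) ℂ) with hp
  have hpc : Continuous p := by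
    refine Seminorm.continuous_finsetSup fun i _ => ?_
    exact (schwartz_withSeminorms ℂ (Rd d) ℂ).continuous_seminorm i
  have hlim : Tendsto (fun q : Rd d × 𝓢(Rd d, ℂ) =>
      C * (1 + ‖q.1‖) ^ k * p (q.2 - f₀) + D * ‖q.1 - x₀‖) (𝓝 (x₀, f₀)) (𝓝 0) := by
    have hcont : Continuous fun q : Rd d × 𝓢(Rd d, ℂ) =>
        C * (1 + ‖q.1‖) ^ k * p (q.2 - f₀) + D * ‖q.1 - x₀‖ := by
      have := hpc.comp (continuous_snd.sub continuous_const :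
        Continuous fun q : Rd d × 𝓢(Rd d, ℂ) => q.2 - f₀)
      have h' : Continuous fun q : Rd d × 𝓢(Rd d, ℂ) => p (q.2 - f₀) := this
      fun_prop
    have := hcont.tendsto (x₀, f₀)
    simpa using this
  filter_upwards [(tendsto_order.1 hlim).2 ε hε,
    continuous_fst.continuousAt.preimage_mem_nhds (Metric.ball_mem_nhds x₀ one_pos)] with q hq hq1
  refine lt_of_le_of_lt ?_ hq
  have h1 : compSubConstCLM ℂ q.1 q.2 - compSubConstCLM ℂ x₀ f₀ =
      compSubConstCLM ℂ q.1 (q.2 - f₀) +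
        (compSubConstCLM ℂ q.1 f₀ - compSubConstCLM ℂ x₀ f₀) := by
    rw [map_sub]
    abel
  change SchwartzMap.seminorm ℂ k n (compSubConstCLM ℂ q.1 q.2 - compSubConstCLM ℂ x₀ f₀) ≤ _
  rw [h1]
  exact (map_add_le_add _ _ _).trans (add_le_add (hC _ _) (hD _ hq1))

/-- The modulation `f ↦ e^{2πi ζ · t} f(t)` of Schwartz functions. -/
def modulate (ζ : Rd d) (f : 𝓢(Rd d, ℂ)) : 𝓢(Rd d, ℂ) := 𝓕⁻ (compSubConstCLM ℂ ζ (𝓕 f))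

theorem modulate_apply (ζ : Rd d) (f : 𝓢(Rd d, ℂ)) (t : Rd d) :
    modulate ζ f t = Complex.exp (2 * Real.pi * Complex.I * ((inner ℝ ζ t : ℝ) : ℂ)) * f t := by
  have hinv : f t = 𝓕⁻ (𝓕 f) t := by rw [FourierTransform.fourierInv_fourier_eq]
  rw [modulate, fourierInv_coe, Real.fourierInv_eq', hinv, fourierInv_coe, Real.fourierInv_eq',
    ← integral_const_mul]
  refine Eq.trans ?_ (integral_sub_right_eq_self _ ζ)
  refine integral_congr_ae (Eventually.of_forall fun y => ?_)
  simp only [compSubConstCLM_apply, smul_eq_mul]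
  rw [← mul_assoc, ← Complex.exp_add, inner_sub_left]
  congr 2
  push_cast
  ring

/-- Modulation is defined as translation conjugated by the Fourier transform, so joint continuity of
translation is used on both sides. -/
theorem continuous_modulate_translate (f : 𝓢(Rd d, ℂ)) :
    Continuous fun p : Rd d × Rd d => modulate p.2 (compSubConstCLM ℂ p.1 f) := by
  refine (FourierTransform.fourierInvCLM ℂ 𝓢(Rd d, ℂ)).continuous.comp ?_
  refine continuous_translate.comp (continuous_snd.prodMk ?_)
  refine (FourierTransform.fourierCLM ℂ 𝓢(Rd d, ℂ)).continuous.comp ?_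
  exact continuous_translate.comp (continuous_fst.prodMk continuous_const)

/-- The boundedness of damped translates is applied once before and once after the Fourier
transform; continuous linear maps preserve bounded sets. -/
theorem isVonNBounded_modulate_translate (f : 𝓢(Rd d, ℂ)) {v w : Rd d → ℝ≥0}
    (hv : RapidlyDecreasing v) (hw : RapidlyDecreasing w) :
    Bornology.IsVonNBounded ℂ {g : 𝓢(Rd d, ℂ) | ∃ x ζ : Rd d,
      g = ((v x : ℝ) : ℂ) • ((w ζ : ℝ) : ℂ) • modulate ζ (compSubConstCLM ℂ x f)} := by
  have h1 := isVonNBounded_smul_translate (Bornology.isVonNBounded_singleton (𝕜 := ℂ) f) hv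
  have h2 := h1.image (FourierTransform.fourierCLM ℂ 𝓢(Rd d, ℂ))
  have h3 := (isVonNBounded_smul_translate h2 hw).image
    (FourierTransform.fourierInvCLM ℂ 𝓢(Rd d, ℂ))
  refine h3.subset ?_
  rintro _ ⟨x, ζ, rfl⟩
  refine ⟨_, ⟨_, ⟨_, ⟨f, rfl, x, rfl⟩, rfl⟩, ζ, rfl⟩, ?_⟩
  rw [map_smul, map_smul, map_smul, map_smul, smul_comm]
  rfl

end SchwartzMap

end Schwartz

/-! ### The short-time Fourier transform on `𝒮'(Γ)` -/

section STFT

variable {d : ℕ} {Γ : Set (Rd d)}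

open SchwartzMap (modulate modulate_apply compSubConstCLM compSubConstCLM_apply)

theorem TestFn.toSchwartz_apply (φ : TestFn d) (t : Rd d) : φ.toSchwartz t = φ t := rfl

theorem expTwist_apply (η : Rd d) (φ : TestFn d) (t : Rd d) :
    expTwist η φ t = Complex.exp (-((inner ℝ η t : ℝ) : ℂ)) * φ t := rfl

theorem conjTimeFreqShift_apply (ψ : TestFn d) (x ξ t : Rd d) : conjTimeFreqShift ψ x ξ t =
    conj (Complex.exp (2 * Real.pi * Complex.I * ((inner ℝ ξ t : ℝ) : ℂ)) * ψ (t - x)) := rfl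

theorem expTwist_expTwist_neg (η : Rd d) (φ : TestFn d) : expTwist η (expTwist (-η) φ) = φ := by
  ext t
  rw [expTwist_apply, expTwist_apply, ← mul_assoc, ← Complex.exp_add, inner_neg_left]
  simp

/-- The Schwartz function `t ↦ e^{η · t} conj ψ(t)`. -/
def twistedWindow (ψ : TestFn d) (η : Rd d) : 𝓢(Rd d, ℂ) :=
  (expTwist (-η) (conjTimeFreqShift ψ 0 0)).toSchwartz

/-- From `e^{η·t} = e^{η·x} e^{η·(t-x)}`: the second factor joins the translated window and the
conjugation reverses the sign of `ξ`. -/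
theorem toSchwartz_expTwist_conjTimeFreqShift (ψ : TestFn d) (η x ξ : Rd d) :
    (expTwist (-η) (conjTimeFreqShift ψ x ξ)).toSchwartz =
      Complex.exp ((inner ℝ η x : ℝ) : ℂ) •
        modulate (-ξ) (compSubConstCLM ℂ x (twistedWindow ψ η)) := by
  ext t
  have h : twistedWindow ψ η (t - x) =
      Complex.exp (-((inner ℝ (-η) (t - x) : ℝ) : ℂ)) * conj (ψ (t - x)) := by
    rw [twistedWindow, TestFn.toSchwartz_apply, expTwist_apply, conjTimeFreqShift_apply]
    simp
  rw [smul_apply, modulate_apply, compSubConstCLM_apply, h, TestFn.toSchwartz_apply,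
    expTwist_apply, conjTimeFreqShift_apply, map_mul, ← Complex.exp_conj, smul_eq_mul, ← mul_assoc,
    ← mul_assoc, ← mul_assoc, ← Complex.exp_add, ← Complex.exp_add, ← Complex.exp_add]
  congr 2
  simp only [inner_neg_left, inner_sub_right, map_mul, Complex.conj_ofReal, Complex.conj_I,
    map_ofNat]
  push_cast
  ring

theorem stftDistr_eq {ψ : TestFn d} {f : Distr d} {η : Rd d} {u : Temp d} (h : IsExpTwist f η u)
    (x ξ : Rd d) : stftDistr ψ f x ξ = Complex.exp ((inner ℝ η x : ℝ) : ℂ) *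
      u (modulate (-ξ) (compSubConstCLM ℂ x (twistedWindow ψ η))) := by
  rw [stftDistr, ← expTwist_expTwist_neg η (conjTimeFreqShift ψ x ξ), ← h,
    toSchwartz_expTwist_conjTimeFreqShift, map_smul, smul_eq_mul]

theorem continuous_stftDistr {ψ : TestFn d} {f : Distr d} {η : Rd d} {u : Temp d}
    (h : IsExpTwist f η u) : Continuous fun p : Rd d × Rd d => stftDistr ψ f p.1 p.2 := by
  simp only [stftDistr_eq h]
  have h0 : Continuous fun p : Rd d × Rd d => ((p.1, -p.2) : Rd d × Rd d) := by fun_prop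
  have h1 := (SchwartzMap.continuous_modulate_translate (twistedWindow ψ η)).comp h0
  have h2 := u.continuous.comp h1
  have h3 : Continuous fun p : Rd d × Rd d => Complex.exp ((inner ℝ η p.1 : ℝ) : ℂ) := by fun_prop
  refine (h3.mul h2).congr fun p => ?_
  simp only [Pi.mul_apply, Function.comp_apply]

theorem RapidlyDecreasing.comp_neg {v : Rd d → ℝ≥0} (hv : RapidlyDecreasing v) :
    RapidlyDecreasing fun ξ => v (-ξ) := by
  intro n
  obtain ⟨C, hC⟩ := hv n
  exact ⟨C, fun ξ => by simpa using hC (-ξ)⟩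

/-- The weighted short-time Fourier transform is dominated by finitely many tempered twists on
bounded sets. -/
theorem exists_bounded_dominating_stft (K : CCSExhaustion Γ) (hopen : IsOpen Γ) (ψ : TestFn d)
    (i : ℕ × {v : Rd d → ℝ≥0 // RapidlyDecreasing v}) :
    ∃ (P : Finset (Rd d)) (B : Rd d → Set 𝓢(Rd d, ℂ)), (P : Set (Rd d)) ⊆ Γ ∧
      (∀ η, Bornology.IsVonNBounded ℂ (B η)) ∧ ∀ p : Rd d × Rd d, ∃ η ∈ P, ∃ g ∈ B η,
        ∀ (f : Distr d) (u : Temp d), IsExpTwist f η u →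
          ‖stftDistr ψ f p.1 p.2‖ * (epsWeight K i p : ℝ) ≤ ‖u g‖ := by
  obtain ⟨N, v, hv⟩ := i
  obtain ⟨P, r, hP, hr, h⟩ := exists_finset_dominating (K.isCompact N) (K.nonempty N) hopen
    (K.subset N)
  obtain ⟨w, hw, hwe⟩ : ∃ w : Rd d → ℝ≥0, RapidlyDecreasing w ∧
      ∀ x, (w x : ℝ) = Real.exp (-(r * ‖x‖)) := ⟨_, rapidlyDecreasing_exp_neg hr, fun _ => rfl⟩
  refine ⟨P, _, hP, fun η => SchwartzMap.isVonNBounded_modulate_translate (twistedWindow ψ η)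
    hw hv.comp_neg, fun p => ?_⟩
  -- The point `η` depends on `x` but ranges over a finite set. The gain `r|x|` becomes the rapidly
  -- decreasing factor `w`, without which the translates would not be bounded.
  obtain ⟨η, hη, hηx⟩ := h p.1
  refine ⟨η, hη, _, ⟨p.1, -p.2, rfl⟩, fun f u hu => ?_⟩
  rw [stftDistr_eq hu, map_smul, map_smul, norm_mul, norm_smul, norm_smul, Complex.norm_exp,
    Complex.ofReal_re, neg_neg, Complex.norm_real, Complex.norm_real,
    Real.norm_of_nonneg (NNReal.coe_nonneg _), Real.norm_of_nonneg (NNReal.coe_nonneg _),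
    coe_epsWeight, coe_weights, hwe]
  have h1 : Real.exp (inner ℝ η p.1) * Real.exp (supportingFunction (-K.set N) p.1) ≤
      Real.exp (-(r * ‖p.1‖)) := by
    rw [← Real.exp_add]
    exact Real.exp_le_exp.2 (by linarith)
  calc _ = (Real.exp (inner ℝ η p.1) * Real.exp (supportingFunction (-K.set N) p.1)) *
        ((v p.2 : ℝ) * ‖u (modulate (-p.2) (compSubConstCLM ℂ p.1 (twistedWindow ψ η)))‖) := by
        ring
    _ ≤ _ := by gcongr

theorem Bornology.IsVonNBounded.exists_norm_apply_le {B : Set 𝓢(Rd d, ℂ)}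
    (hB : Bornology.IsVonNBounded ℂ B) (u : Temp d) : ∃ C, ∀ g ∈ B, ‖u g‖ ≤ C := by
  obtain ⟨C, hC⟩ := (NormedSpace.isVonNBounded_iff' ℂ).1 (hB.image u)
  exact ⟨C, fun g hg => hC _ (mem_image_of_mem u hg)⟩

/-- The short-time Fourier transform as a map from `𝒮'(Γ)` to the model space. -/
def stftModel (K : CCSExhaustion Γ) (hne : Γ.Nonempty) (hopen : IsOpen Γ) (ψ : TestFn d) :
    LaplaceDistr Γ →ₗ[ℂ] EpsModel K where
  toFun f := MultiC.mk ⟨fun p => stftDistr ψ f.toDistr p.1 p.2,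
      continuous_stftDistr (LaplaceDistr.twist_spec ⟨_, hne.some_mem⟩ f)⟩ (by
    intro i
    obtain ⟨P, B, hP, hB, h⟩ := exists_bounded_dominating_stft K hopen ψ i
    have hu : ∀ η : P, ∃ C, ∀ g ∈ B η, ‖LaplaceDistr.twist ⟨η, hP η.2⟩ f g‖ ≤ C := fun η =>
      (hB η).exists_norm_apply_le _
    choose C hC using hu
    refine ⟨∑ η, |C η|, fun p => ?_⟩
    obtain ⟨η, hη, g, hg, hle⟩ := h p
    refine (hle _ _ (LaplaceDistr.twist_spec ⟨η, hP hη⟩ f)).trans ?_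
    refine ((hC ⟨η, hη⟩ g hg).trans (le_abs_self _)).trans ?_
    exact Finset.single_le_sum (f := fun η => |C η|) (fun _ _ => abs_nonneg _)
      (Finset.mem_univ _))
  map_add' f g := MultiC.toCont_injective <| ContinuousMap.ext fun _ => rfl
  map_smul' c f := MultiC.toCont_injective <| ContinuousMap.ext fun _ => rfl

theorem toCont_stftModel (K : CCSExhaustion Γ) (hne : Γ.Nonempty) (hopen : IsOpen Γ)
    (ψ : TestFn d) (f : LaplaceDistr Γ) (p : Rd d × Rd d) :
    MultiC.toCont (stftModel K hne hopen ψ f) p = stftDistr ψ f.toDistr p.1 p.2 := rfl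

theorem LaplaceDistr.continuous_twist (η : Γ) : Continuous (twist (Γ := Γ) η) :=
  continuous_iInf_dom continuous_induced_dom

theorem IsExpTwist.sub {f g : Distr d} {η : Rd d} {u w : Temp d} (hf : IsExpTwist f η u)
    (hg : IsExpTwist g η w) : IsExpTwist (f - g) η (u - w) :=
  fun φ => congrArg₂ (· - ·) (hf φ) (hg φ)

/-- Strong convergence of the finitely many twists `η ∈ P` is uniform on the bounded sets `B η`. The
difference of two chosen twists is a twist of the difference, so linearity of the choice is not
needed. -/
theorem continuous_stftModel (K : CCSExhaustion Γ) (hne : Γ.Nonempty) (hopen : IsOpen Γ)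
    (ψ : TestFn d) : Continuous (stftModel K hne hopen ψ) := by
  refine continuous_iff_continuousAt.2 fun f => ?_
  refine MultiC.tendsto_iff_norm.2 fun i ε hε => ?_
  obtain ⟨P, B, hP, hB, h⟩ := exists_bounded_dominating_stft K hopen ψ i
  have hev : ∀ η : P, ∀ᶠ g in 𝓝 f, ∀ b ∈ B η,
      ‖(LaplaceDistr.twist ⟨η, hP η.2⟩ f - LaplaceDistr.twist ⟨η, hP η.2⟩ g) b‖ < ε := by
    intro η
    have h1 : Tendsto (fun g : LaplaceDistr Γ =>
        LaplaceDistr.twist ⟨η, hP η.2⟩ f - LaplaceDistr.twist ⟨η, hP η.2⟩ g) (𝓝 f) (𝓝 0) := by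
      have h2 := (tendsto_const_nhds (x := LaplaceDistr.twist ⟨(η : Rd d), hP η.2⟩ f)).sub
        ((LaplaceDistr.continuous_twist (⟨η, hP η.2⟩ : Γ)).tendsto f)
      rwa [sub_self] at h2
    filter_upwards [h1.eventually (ContinuousLinearMap.eventually_nhds_zero_mapsTo (hB η)
      (Metric.ball_mem_nhds (0 : ℂ) hε))] with g hg b hb
    simpa using hg hb
  filter_upwards [eventually_all.2 hev] with g hg p
  obtain ⟨η, hη, b, hb, hle⟩ := h p
  refine lt_of_le_of_lt ?_ (hg ⟨η, hη⟩ b hb)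
  rw [← map_sub, toCont_stftModel, map_sub]
  exact hle _ _ ((LaplaceDistr.twist_spec ⟨η, hP hη⟩ f).sub
    (LaplaceDistr.twist_spec ⟨η, hP hη⟩ g))

theorem exists_stft (K : CCSExhaustion Γ) (hne : Γ.Nonempty) (hopen : IsOpen Γ) (ψ : TestFn d) :
    ∃ T : LaplaceDistr Γ →L[ℂ] CGammaTensorPol K, ∀ (f : LaplaceDistr Γ) (x ξ : Rd d),
      toFunction (T f) (x, ξ) = stftDistr ψ f.toDistr x ξ := by
  refine ⟨
    { toFun := fun f => (completedEquivModel K hopen).symm (stftModel K hne hopen ψ f)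
      map_add' := fun f g => toFunction_injective K hopen <| funext fun p => by
        rw [toFunction_symm, toFunction_add, toFunction_symm, toFunction_symm, map_add, map_add,
          ContinuousMap.add_apply]
      map_smul' := fun c f => toFunction_injective K hopen <| funext fun p => by
        rw [toFunction_symm, RingHom.id_apply, toFunction_smul, toFunction_symm, map_smul,
          map_smul, ContinuousMap.smul_apply, smul_eq_mul]
      cont := (completedEquivModel K hopen).symm.continuous.comp
        (continuous_stftModel K hne hopen ψ) }, fun f x ξ => ?_⟩
  exact toFunction_symm K hopen _ _

end STFT

/-! ### Test functions and Schwartz functions -/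

section TestFunctions

variable {d : ℕ}

namespace ContDiffMapSupportedIn

/-- The inclusion of the smooth functions supported in a compact set in the Schwartz space. -/
def toSchwartzLM (L : TopologicalSpace.Compacts (Rd d)) : 𝓓_{L}(Rd d, ℂ) →ₗ[ℂ] 𝓢(Rd d, ℂ) where
  toFun φ := φ.hasCompactSupport.toSchwartzMap φ.contDiff
  map_add' _ _ := rfl
  map_smul' _ _ := rfl

/-- On a compact set polynomial factors are bounded, so each Schwartz seminorm is a multiple of a
single derivative norm. -/
theorem continuous_toSchwartzLM (L : TopologicalSpace.Compacts (Rd d)) :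
    Continuous (toSchwartzLM L) := by
  refine WithSeminorms.continuous_of_isBounded
    (ContDiffMapSupportedIn.withSeminorms ℂ (Rd d) ℂ ⊤ L)
    (schwartz_withSeminorms ℂ (Rd d) ℂ) _ ?_
  rintro ⟨k, n⟩
  obtain ⟨R, hR0, hR⟩ := L.isCompact.isBounded.exists_pos_norm_le
  refine ⟨{n}, ⟨R ^ k, by positivity⟩, fun φ => ?_⟩
  rw [Finset.sup_singleton]
  refine SchwartzMap.seminorm_le_bound ℂ k n _
    (mul_nonneg (pow_nonneg hR0.le k) (apply_nonneg _ _)) fun t => ?_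
  have h1 : ‖iteratedFDeriv ℝ n φ t‖ ≤ ContDiffMapSupportedIn.seminorm ℂ (Rd d) ℂ ⊤ L n φ :=
    ContDiffMapSupportedIn.norm_iteratedFDeriv_apply_le_seminorm_top ℂ
  by_cases ht : t ∈ L
  · have := hR t ht
    change ‖t‖ ^ k * ‖iteratedFDeriv ℝ n φ t‖ ≤ R ^ k * _
    gcongr
  · have h2 : iteratedFDeriv ℝ n φ t = 0 := by
      have := (tsupport_iteratedFDeriv_subset (𝕜 := ℝ) (f := φ) n).trans φ.tsupport_subset
      exact image_eq_zero_of_notMem_tsupport fun h => ht (this h)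
    change ‖t‖ ^ k * ‖iteratedFDeriv ℝ n φ t‖ ≤ R ^ k * _
    rw [h2, norm_zero, mul_zero]
    exact mul_nonneg (by positivity) (apply_nonneg _ _)

end ContDiffMapSupportedIn

/-- The map `φ ↦ e^{-η · x} φ(x)` from test functions to Schwartz functions. -/
def expTwistSchwartz (η : Rd d) : TestFn d →ₗ[ℂ] 𝓢(Rd d, ℂ) where
  toFun φ := (expTwist η φ).toSchwartz
  map_add' φ χ := by ext t; exact mul_add (Complex.exp (-((inner ℝ η t : ℝ) : ℂ))) _ _
  map_smul' c φ := by ext t; exact mul_left_comm (Complex.exp (-((inner ℝ η t : ℝ) : ℂ))) c _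

theorem continuous_expTwistSchwartz (η : Rd d) (L : TopologicalSpace.Compacts (Rd d))
    (hL : (L : Set (Rd d)) ⊆ (⊤ : TopologicalSpace.Opens (Rd d))) :
    Continuous fun φ : 𝓓_{L}(Rd d, ℂ) => expTwistSchwartz η (TestFunction.ofSupportedIn hL φ) := by
  have hg : ContDiff ℝ ∞ fun t : Rd d => Complex.exp (-((inner ℝ η t : ℝ) : ℂ)) := by
    refine ContDiff.cexp (ContDiff.neg ?_)
    exact Complex.ofRealCLM.contDiff.comp (contDiff_const.inner ℝ contDiff_id)
  refine ((ContDiffMapSupportedIn.continuous_toSchwartzLM L).comp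
    (ContDiffMapSupportedIn.bilinLeftCLM (n := ⊤) (K := L) (ContinuousLinearMap.mul ℂ ℂ)
      hg).continuous).congr fun φ => ?_
  ext t
  exact mul_comm _ _

/-- The composition of a tempered distribution with the twist of test functions. -/
def Temp.twistDistr (u : Temp d) (η : Rd d) : Distr d where
  toLinearMap := (u : 𝓢(Rd d, ℂ) →ₗ[ℂ] ℂ) ∘ₗ expTwistSchwartz η
  cont := (TestFunction.continuous_iff_continuous_comp _).2 fun L hL =>
    u.continuous.comp (continuous_expTwistSchwartz η L hL)

theorem Temp.twistDistr_apply (u : Temp d) (η : Rd d) (φ : TestFn d) :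
    u.twistDistr η φ = u (expTwist η φ).toSchwartz := rfl

/-- A smooth cutoff function equal to `1` on the unit ball. -/
def smoothCutoff (d : ℕ) : ContDiffBump (0 : Rd d) := ⟨1, 2, one_pos, one_lt_two⟩

/-- A Schwartz function cut off at radius `j + 1`. -/
def schwartzCutoff (j : ℕ) (f : 𝓢(Rd d, ℂ)) : TestFn d where
  toFun t := ((smoothCutoff d (((j : ℝ) + 1)⁻¹ • t) : ℝ) : ℂ) * f t
  contDiff' := by
    refine ContDiff.mul ?_ (f.smooth ⊤)
    exact Complex.ofRealCLM.contDiff.comp ((smoothCutoff d).contDiff.comp (contDiff_const_smul _))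
  hasCompactSupport' := by
    have h : HasCompactSupport fun t : Rd d => smoothCutoff d (((j : ℝ) + 1)⁻¹ • t) :=
      (smoothCutoff d).hasCompactSupport.comp_smul (by positivity)
    exact (h.comp_left (g := fun r : ℝ => (r : ℂ)) Complex.ofReal_zero).mul_right
  tsupport_subset' _ _ := trivial

/-- Dilation multiplies the `n`-th derivative by `(j + 1)^{-n} ≤ 1`, and the undilated function is
constant off a compact set. -/
theorem exists_bound_iteratedFDeriv_cutoff_sub_one (d n : ℕ) : ∃ C, ∀ (j : ℕ) (t : Rd d),
    ‖iteratedFDeriv ℝ n (fun t : Rd d =>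
      ((smoothCutoff d (((j : ℝ) + 1)⁻¹ • t) : ℝ) : ℂ) - 1) t‖ ≤ C := by
  let θ : Rd d → ℂ := fun t => ((smoothCutoff d t : ℝ) : ℂ) - 1
  have hθ : ContDiff ℝ ∞ θ :=
    (Complex.ofRealCLM.contDiff.comp (smoothCutoff d).contDiff).sub contDiff_const
  have hb : ∃ C, ∀ t, ‖iteratedFDeriv ℝ n θ t‖ ≤ C := by
    have hs : HasCompactSupport fun t : Rd d => ((smoothCutoff d t : ℝ) : ℂ) :=
      (smoothCutoff d).hasCompactSupport.comp_left (g := fun r : ℝ => (r : ℂ)) Complex.ofReal_zero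
    obtain ⟨C, hC⟩ := (hs.isCompact.union (isCompact_closedBall (0 : Rd d) 1)
      ).exists_bound_of_continuousOn (f := iteratedFDeriv ℝ n θ)
      (hθ.continuous_iteratedFDeriv (by exact_mod_cast le_top)).continuousOn
    refine ⟨max C ‖iteratedFDeriv ℝ n (fun _ : Rd d => (-1 : ℂ)) 0‖, fun t => ?_⟩
    by_cases ht : t ∈ tsupport fun t : Rd d => ((smoothCutoff d t : ℝ) : ℂ)
    · exact (hC t (Or.inl ht)).trans (le_max_left _ _)
    · refine le_trans (le_of_eq ?_) (le_max_right _ _)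
      have h1 : θ =ᶠ[𝓝 t] fun _ => (-1 : ℂ) := by
        filter_upwards [notMem_tsupport_iff_eventuallyEq.1 ht] with s hs
        simp only [θ]
        rw [hs]
        simp
      rw [(h1.iteratedFDeriv ℝ n).eq_of_nhds]
      rcases n.eq_zero_or_pos with hn | hn
      · subst hn
        rw [norm_iteratedFDeriv_zero, norm_iteratedFDeriv_zero]
      · rw [iteratedFDeriv_const_of_ne hn.ne']
        rfl
  obtain ⟨C, hC⟩ := hb
  refine ⟨C, fun j t => ?_⟩
  have h1 := congrFun (iteratedFDeriv_comp_const_smul (i := n) (f := θ) (((j : ℝ) + 1)⁻¹)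
    (hθ.of_le (by exact_mod_cast le_top))) t
  change ‖iteratedFDeriv ℝ n (fun t => θ (((j : ℝ) + 1)⁻¹ • t)) t‖ ≤ C
  rw [h1, norm_smul]
  refine (mul_le_of_le_one_left (norm_nonneg _) ?_).trans (hC _)
  rw [norm_pow, norm_inv, Real.norm_of_nonneg (by positivity)]
  refine pow_le_one₀ (by positivity) (inv_le_one_of_one_le₀ ?_)
  have : (0 : ℝ) ≤ j := j.cast_nonneg
  linarith

/-- The error vanishes for `|t| < j + 1`; beyond, one extra power of `|t|` taken from the decay of
`f` yields a factor `1/(j + 1)` in the Leibniz sum. -/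
theorem tendsto_schwartzCutoff (f : 𝓢(Rd d, ℂ)) :
    Tendsto (fun j => (schwartzCutoff j f).toSchwartz) atTop (𝓝 f) := by
  refine ((schwartz_withSeminorms ℂ (Rd d) ℂ).tendsto_nhds _ _).2 ?_
  rintro ⟨k, n⟩ ε hε
  choose M hM using fun i => exists_bound_iteratedFDeriv_cutoff_sub_one d i
  choose D hD0 hD using fun i => f.exists_bound (k + 1) i
  set S : ℝ := ∑ i ∈ Finset.range (n + 1), (n.choose i : ℝ) * |M i| * D (n - i) with hS
  have hS0 : 0 ≤ S := Finset.sum_nonneg fun i _ => by have := hD0 (n - i); positivity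
  have hlim : Tendsto (fun j : ℕ => S * (1 / ((j : ℝ) + 1))) atTop (𝓝 0) := by
    simpa using (tendsto_one_div_add_atTop_nhds_zero_nat (𝕜 := ℝ)).const_mul S
  filter_upwards [(tendsto_order.1 hlim).2 ε hε] with j hj
  refine lt_of_le_of_lt ?_ hj
  refine SchwartzMap.seminorm_le_bound ℂ k n _ (by positivity) fun t => ?_
  let θ : Rd d → ℂ := fun t => ((smoothCutoff d (((j : ℝ) + 1)⁻¹ • t) : ℝ) : ℂ) - 1
  have hθ : ContDiff ℝ ∞ θ :=
    (Complex.ofRealCLM.contDiff.comp ((smoothCutoff d).contDiff.comp (contDiff_const_smul _))).sub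
      contDiff_const
  have hfun : ((schwartzCutoff j f).toSchwartz - f : 𝓢(Rd d, ℂ)) = fun t => θ t * f t := by
    funext s
    change ((smoothCutoff d (((j : ℝ) + 1)⁻¹ • s) : ℝ) : ℂ) * f s - f s = θ s * f s
    simp only [θ]
    ring
  rw [hfun]
  rcases lt_or_ge ‖t‖ ((j : ℝ) + 1) with ht | ht
  · have h0 : (fun t => θ t * f t) =ᶠ[𝓝 t] fun _ => (0 : ℂ) := by
      have hopen : IsOpen {s : Rd d | ‖s‖ < (j : ℝ) + 1} := isOpen_lt continuous_norm continuous_const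
      filter_upwards [hopen.mem_nhds ht] with s hs
      have h1 : smoothCutoff d (((j : ℝ) + 1)⁻¹ • s) = 1 := by
        refine (smoothCutoff d).one_of_mem_closedBall ?_
        rw [mem_closedBall_zero_iff, norm_smul, norm_inv, Real.norm_of_nonneg (by positivity),
          inv_mul_le_iff₀ (by positivity)]
        change ‖s‖ ≤ ((j : ℝ) + 1) * 1
        rw [mul_one]
        exact le_of_lt hs
      simp [θ, h1]
    rw [(h0.iteratedFDeriv ℝ n).eq_of_nhds]
    have h2 : iteratedFDeriv ℝ n (fun _ : Rd d => (0 : ℂ)) t = 0 := by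
      rw [iteratedFDeriv_fun_zero]; rfl
    rw [h2, norm_zero, mul_zero]
    positivity
  · have h1 := norm_iteratedFDeriv_mul_le (N := ∞) hθ (f.smooth ⊤) t (n := n)
      (by exact_mod_cast le_top)
    have hj1 : (0 : ℝ) < (j : ℝ) + 1 := by positivity
    calc ‖t‖ ^ k * ‖iteratedFDeriv ℝ n (fun t => θ t * f t) t‖
        ≤ ‖t‖ ^ k * ∑ i ∈ Finset.range (n + 1), (n.choose i : ℝ) * ‖iteratedFDeriv ℝ i θ t‖ *
            ‖iteratedFDeriv ℝ (n - i) f t‖ := by gcongr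
      _ ≤ S * (1 / ((j : ℝ) + 1)) := by
          rw [hS, Finset.sum_mul, Finset.mul_sum]
          refine Finset.sum_le_sum fun i _ => ?_
          have h3 : ‖iteratedFDeriv ℝ i θ t‖ ≤ |M i| := (hM i j t).trans (le_abs_self _)
          have h4 : ‖t‖ ^ k * ‖iteratedFDeriv ℝ (n - i) f t‖ ≤ D (n - i) * (1 / ((j : ℝ) + 1)) := by
            rw [mul_one_div, le_div_iff₀ hj1]
            calc _ ≤ ‖t‖ ^ k * ‖iteratedFDeriv ℝ (n - i) f t‖ * ‖t‖ := by gcongr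
              _ = ‖t‖ ^ (k + 1) * ‖iteratedFDeriv ℝ (n - i) f t‖ := by ring
              _ ≤ (1 + ‖t‖) ^ (k + 1) * ‖iteratedFDeriv ℝ (n - i) f t‖ := by
                  gcongr
                  linarith
              _ ≤ _ := hD _ t
          calc _ = (n.choose i : ℝ) * ‖iteratedFDeriv ℝ i θ t‖ *
                (‖t‖ ^ k * ‖iteratedFDeriv ℝ (n - i) f t‖) := by ring
            _ ≤ (n.choose i : ℝ) * |M i| * (D (n - i) * (1 / ((j : ℝ) + 1))) := by gcongr
            _ = _ := by ring

/-- A tempered distribution is determined by its values on test functions. -/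
theorem Temp.ext_testFn {u w : Temp d} (h : ∀ φ : TestFn d, u φ.toSchwartz = w φ.toSchwartz) :
    u = w := by
  ext f
  refine tendsto_nhds_unique (((u.continuous.tendsto f).comp (tendsto_schwartzCutoff f)).congr
    fun j => h _) ((w.continuous.tendsto f).comp (tendsto_schwartzCutoff f))

end TestFunctions

/-! ### The adjoint short-time Fourier transform -/

section CrossTransform

open scoped FourierTransform

variable {d : ℕ}

namespace SchwartzMap

/-- The Schwartz function `t ↦ φ(t) χ(t - x)`. -/
def windowed (χ φ : 𝓢(Rd d, ℂ)) (x : Rd d) : 𝓢(Rd d, ℂ) :=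
  pairing (ContinuousLinearMap.mul ℂ ℂ) φ (compSubConstCLM ℂ x χ)

theorem windowed_apply (χ φ : 𝓢(Rd d, ℂ)) (x t : Rd d) :
    windowed χ φ x t = φ t * χ (t - x) := rfl

theorem continuous_windowed (χ φ : 𝓢(Rd d, ℂ)) : Continuous (windowed χ φ) := by
  refine (pairing (ContinuousLinearMap.mul ℂ ℂ) φ).continuous.comp ?_
  exact continuous_translate.comp (continuous_id.prodMk continuous_const)

/-- The factor `(1 + |x|)^m` is shared between `φ` and `χ` through `1 + |x| ≤ (1 + |t|)(1 + |t -
x|)`. -/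
theorem isVonNBounded_smul_windowed (χ : 𝓢(Rd d, ℂ)) {B : Set 𝓢(Rd d, ℂ)}
    (hB : Bornology.IsVonNBounded ℂ B) (m : ℕ) :
    Bornology.IsVonNBounded ℂ {g : 𝓢(Rd d, ℂ) | ∃ φ ∈ B, ∃ x : Rd d,
      g = (((1 + ‖x‖) ^ m : ℝ) : ℂ) • windowed χ φ x} := by
  refine isVonNBounded_of_bound fun k n => ?_
  choose C hC0 hC using fun i => exists_bound_of_isVonNBounded hB (k + m) i
  choose D hD0 hD using fun i => χ.exists_bound m i
  refine ⟨∑ i ∈ Finset.range (n + 1), (n.choose i : ℝ) * (C i * D (n - i)), ?_⟩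
  rintro _ ⟨φ, hφ, x, rfl⟩ t
  rw [norm_iteratedFDeriv_smul, Complex.norm_real, Real.norm_of_nonneg (by positivity)]
  have h1 : ‖iteratedFDeriv ℝ n (windowed χ φ x) t‖ ≤ ∑ i ∈ Finset.range (n + 1),
      (n.choose i : ℝ) * ‖iteratedFDeriv ℝ i φ t‖ * ‖iteratedFDeriv ℝ (n - i) χ (t - x)‖ := by
    have h := norm_iteratedFDeriv_mul_le (N := ∞) (φ.smooth ⊤) ((compSubConstCLM ℂ x χ).smooth ⊤) t
      (n := n) (by exact_mod_cast le_top)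
    simp only [iteratedFDeriv_compSubConstCLM] at h
    exact h
  calc _ ≤ ‖t‖ ^ k * ((1 + ‖x‖) ^ m * ∑ i ∈ Finset.range (n + 1),
      (n.choose i : ℝ) * ‖iteratedFDeriv ℝ i φ t‖ * ‖iteratedFDeriv ℝ (n - i) χ (t - x)‖) := by
        gcongr
    _ ≤ _ := by
        rw [Finset.mul_sum, Finset.mul_sum]
        refine Finset.sum_le_sum fun i _ => ?_
        have h2 : ‖t‖ ^ k ≤ (1 + ‖t‖) ^ k := by gcongr; linarith
        have h3 : (1 + ‖x‖) ^ m ≤ (1 + ‖t‖) ^ m * (1 + ‖t - x‖) ^ m := by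
          rw [← mul_pow, norm_sub_rev]
          gcongr
          exact one_add_norm_le t x
        calc _ ≤ (1 + ‖t‖) ^ k * ((1 + ‖t‖) ^ m * (1 + ‖t - x‖) ^ m *
              ((n.choose i : ℝ) * ‖iteratedFDeriv ℝ i φ t‖ *
                ‖iteratedFDeriv ℝ (n - i) χ (t - x)‖)) := by gcongr
          _ = (n.choose i : ℝ) * (((1 + ‖t‖) ^ (k + m) * ‖iteratedFDeriv ℝ i φ t‖) *
              ((1 + ‖t - x‖) ^ m * ‖iteratedFDeriv ℝ (n - i) χ (t - x)‖)) := by ring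
          _ ≤ _ := by
              refine mul_le_mul_of_nonneg_left ?_ (by positivity)
              exact mul_le_mul (hC i φ hφ t) (hD _ _) (by positivity) (hC0 i)

/-- The transform `(x, ξ) ↦ ∫ φ(t) χ(t - x) e^{2πi ξ · t} dt`. -/
def crossTransform (χ φ : 𝓢(Rd d, ℂ)) (p : Rd d × Rd d) : ℂ := 𝓕⁻ (windowed χ φ p.1) p.2

theorem crossTransform_add (χ φ φ' : 𝓢(Rd d, ℂ)) (p : Rd d × Rd d) :
    crossTransform χ (φ + φ') p = crossTransform χ φ p + crossTransform χ φ' p := by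
  have h : windowed χ (φ + φ') p.1 = windowed χ φ p.1 + windowed χ φ' p.1 := by
    ext t; exact add_mul _ _ _
  rw [crossTransform, h, FourierTransform.fourierInv_add]
  rfl

theorem crossTransform_smul (χ : 𝓢(Rd d, ℂ)) (c : ℂ) (φ : 𝓢(Rd d, ℂ)) (p : Rd d × Rd d) :
    crossTransform χ (c • φ) p = c * crossTransform χ φ p := by
  have h : windowed χ (c • φ) p.1 = c • windowed χ φ p.1 := by
    ext t; exact mul_assoc _ _ _
  rw [crossTransform, h, FourierTransform.fourierInv_smul]
  rfl

theorem continuous_crossTransform (χ φ : 𝓢(Rd d, ℂ)) : Continuous (crossTransform χ φ) := by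
  have h1 : Continuous fun p : Rd d × Rd d =>
      toBoundedContinuousFunctionCLM ℂ (Rd d) ℂ
        (FourierTransform.fourierInvCLM ℂ 𝓢(Rd d, ℂ) (windowed χ φ p.1)) :=
    (toBoundedContinuousFunctionCLM ℂ (Rd d) ℂ).continuous.comp
      ((FourierTransform.fourierInvCLM ℂ 𝓢(Rd d, ℂ)).continuous.comp
        ((continuous_windowed χ φ).comp continuous_fst))
  exact continuous_eval.comp (h1.prodMk continuous_snd)

/-- Inverse Fourier transforms of the damped windowed functions form a bounded set. Its pointwise
supremum, times `(1 + |ξ|)^m`, is the weight `v`; no continuity of it is required. -/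
theorem exists_rapidlyDecreasing_bound_crossTransform (χ : 𝓢(Rd d, ℂ)) {B : Set 𝓢(Rd d, ℂ)}
    (hB : Bornology.IsVonNBounded ℂ B) (m : ℕ) : ∃ v : Rd d → ℝ≥0, RapidlyDecreasing v ∧
      ∀ φ ∈ B, ∀ p : Rd d × Rd d,
        ‖crossTransform χ φ p‖ * ((1 + ‖p.1‖) ^ m * (1 + ‖p.2‖) ^ m) ≤ v p.2 := by
  have hB' := (isVonNBounded_smul_windowed χ hB m).image
    (FourierTransform.fourierInvCLM ℂ 𝓢(Rd d, ℂ))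
  set B' := FourierTransform.fourierInvCLM ℂ 𝓢(Rd d, ℂ) '' {g : 𝓢(Rd d, ℂ) | ∃ φ ∈ B, ∃ x : Rd d,
      g = (((1 + ‖x‖) ^ m : ℝ) : ℂ) • windowed χ φ x}
  have hbd : ∀ k : ℕ, ∃ C, 0 ≤ C ∧ ∀ g ∈ B', ∀ ξ, ‖g ξ‖ * (1 + ‖ξ‖) ^ k ≤ C := fun k => by
    obtain ⟨C, hC0, hC⟩ := exists_bound_of_isVonNBounded hB' k 0
    refine ⟨C, hC0, fun g hg ξ => ?_⟩
    have := hC g hg ξ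
    rwa [norm_iteratedFDeriv_zero, mul_comm] at this
  refine ⟨fun ξ => (⨆ g : B', ‖(g : 𝓢(Rd d, ℂ)) ξ‖₊) * (1 + ‖ξ‖₊) ^ m, fun n => ?_,
    fun φ hφ p => ?_⟩
  · obtain ⟨C, hC0, hC⟩ := hbd (m + n)
    refine ⟨C, fun ξ => ?_⟩
    have h1 : (⨆ g : B', ‖(g : 𝓢(Rd d, ℂ)) ξ‖₊) ≤
        (⟨C / (1 + ‖ξ‖) ^ (m + n), by positivity⟩ : ℝ≥0) := by
      refine ciSup_le' fun g => ?_
      change ‖(g : 𝓢(Rd d, ℂ)) ξ‖ ≤ C / (1 + ‖ξ‖) ^ (m + n)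
      rw [le_div_iff₀ (by positivity)]
      exact hC g g.2 ξ
    have h2 : ((⨆ g : B', ‖(g : 𝓢(Rd d, ℂ)) ξ‖₊ : ℝ≥0) : ℝ) ≤ C / (1 + ‖ξ‖) ^ (m + n) := h1
    rw [le_div_iff₀ (by positivity), pow_add, ← mul_assoc] at h2
    exact h2
  · obtain ⟨C, hC0, hC⟩ := hbd 0
    have hmem : FourierTransform.fourierInvCLM ℂ 𝓢(Rd d, ℂ)
        ((((1 + ‖p.1‖) ^ m : ℝ) : ℂ) • windowed χ φ p.1) ∈ B' :=
      mem_image_of_mem _ ⟨φ, hφ, p.1, rfl⟩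
    have h1 := le_ciSup (f := fun g : B' => ‖(g : 𝓢(Rd d, ℂ)) p.2‖₊)
      ⟨⟨C, hC0⟩, by
        rintro _ ⟨g, rfl⟩
        have := hC g g.2 p.2
        rw [pow_zero, mul_one] at this
        exact this⟩ ⟨_, hmem⟩
    have h2 : ‖crossTransform χ φ p‖ * (1 + ‖p.1‖) ^ m ≤
        ((⨆ g : B', ‖(g : 𝓢(Rd d, ℂ)) p.2‖₊ : ℝ≥0) : ℝ) := by
      refine le_trans (le_of_eq ?_) (NNReal.coe_le_coe.2 h1)
      have h3 : FourierTransform.fourierInvCLM ℂ 𝓢(Rd d, ℂ)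
          ((((1 + ‖p.1‖) ^ m : ℝ) : ℂ) • windowed χ φ p.1) p.2 =
          (((1 + ‖p.1‖) ^ m : ℝ) : ℂ) * crossTransform χ φ p := by rw [map_smul]; rfl
      rw [coe_nnnorm, h3, norm_mul, Complex.norm_real, Real.norm_of_nonneg (by positivity), mul_comm]
    rw [← mul_assoc]
    change _ ≤ ((⨆ g : B', ‖(g : 𝓢(Rd d, ℂ)) p.2‖₊ : ℝ≥0) : ℝ) * (1 + ‖p.2‖) ^ m
    gcongr

end SchwartzMap

open SchwartzMap

theorem stftFun_conj_neg (ψ φ : TestFn d) (p : Rd d × Rd d) :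
    stftFun (fun t => conj (ψ t)) φ p.1 (-p.2) = crossTransform ψ.toSchwartz φ.toSchwartz p := by
  rw [crossTransform, fourierInv_coe, Real.fourierInv_eq', stftFun]
  refine integral_congr_ae (Eventually.of_forall fun t => ?_)
  simp only [windowed_apply, TestFn.toSchwartz_apply, Complex.conj_conj, smul_eq_mul]
  rw [mul_comm]
  congr 2
  rw [inner_neg_left, real_inner_comm]
  push_cast
  ring

/-- From `e^{-η·t} = e^{-η·x} e^{-η·(t-x)}`: the twist moves from `φ` to the window, so that `φ` may
afterwards be any Schwartz function. -/
theorem exp_mul_crossTransform_expTwist (ψ φ : TestFn d) (η : Rd d) (p : Rd d × Rd d) :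
    Complex.exp (-((inner ℝ η p.1 : ℝ) : ℂ)) *
      crossTransform (expTwist η ψ).toSchwartz φ.toSchwartz p =
      crossTransform ψ.toSchwartz (expTwist η φ).toSchwartz p := by
  have h : windowed ψ.toSchwartz (expTwist η φ).toSchwartz p.1 =
      Complex.exp (-((inner ℝ η p.1 : ℝ) : ℂ)) •
        windowed (expTwist η ψ).toSchwartz φ.toSchwartz p.1 := by
    ext t
    rw [smul_apply, smul_eq_mul, windowed_apply, windowed_apply]
    simp only [TestFn.toSchwartz_apply, expTwist_apply]
    have h1 : Complex.exp (-((inner ℝ η t : ℝ) : ℂ)) = Complex.exp (-((inner ℝ η p.1 : ℝ) : ℂ)) *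
        Complex.exp (-((inner ℝ η (t - p.1) : ℝ) : ℂ)) := by
      rw [← Complex.exp_add, inner_sub_right]
      push_cast
      ring_nf
    rw [h1]
    ring
  rw [crossTransform, crossTransform, h, FourierTransform.fourierInv_smul]
  rfl

end CrossTransform

/-! ### The adjoint as an absolutely convergent pairing with functions of the model. -/

section AdjointSTFT

variable {d : ℕ} {Γ : Set (Rd d)}

open SchwartzMap (crossTransform continuous_crossTransform crossTransform_add crossTransform_smul)

/-- An integrable function of polynomial decay on `ℝ^{2d}`. -/
def decayWeight (p : Rd d × Rd d) : ℝ :=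
  (1 + ‖p.1‖) ^ (-((d + 1 : ℕ) : ℝ)) * (1 + ‖p.2‖) ^ (-((d + 1 : ℕ) : ℝ))

theorem integrable_decayWeight : Integrable (decayWeight (d := d)) := by
  have h : Integrable fun x : Rd d => (1 + ‖x‖) ^ (-((d + 1 : ℕ) : ℝ)) := by
    refine integrable_one_add_norm ?_
    rw [finrank_euclideanSpace_fin]
    exact_mod_cast Nat.lt_succ_self d
  exact h.mul_prod h

theorem decayWeight_nonneg (p : Rd d × Rd d) : 0 ≤ decayWeight p := by
  unfold decayWeight
  positivity

theorem le_mul_decayWeight {a b : ℝ} {p : Rd d × Rd d}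
    (h : a * ((1 + ‖p.1‖) ^ (d + 1) * (1 + ‖p.2‖) ^ (d + 1)) ≤ b) : a ≤ b * decayWeight p := by
  rw [decayWeight, Real.rpow_neg (by positivity), Real.rpow_neg (by positivity),
    Real.rpow_natCast, Real.rpow_natCast, ← mul_inv, ← div_eq_mul_inv, le_div_iff₀ (by positivity)]
  exact h

/-- The integrand pairing `F` with the transform of a Schwartz function. -/
def pairingIntegrand (χ : 𝓢(Rd d, ℂ)) (η : Rd d) (F : Rd d × Rd d → ℂ) (φ : 𝓢(Rd d, ℂ))
    (p : Rd d × Rd d) : ℂ :=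
  F p * (Complex.exp (-((inner ℝ η p.1 : ℝ) : ℂ)) * crossTransform χ φ p)

theorem continuous_pairingIntegrand (χ : 𝓢(Rd d, ℂ)) (η : Rd d) {F : Rd d × Rd d → ℂ}
    (hF : Continuous F) (φ : 𝓢(Rd d, ℂ)) : Continuous (pairingIntegrand χ η F φ) := by
  have := continuous_crossTransform χ φ
  unfold pairingIntegrand
  fun_prop

/-- The index serves all `φ ∈ B` and all `F` at once: `N` comes from `η ∈ K_N` and `v` from the
uniform decay of the transforms. Convergence of the integral and both continuity statements, in `φ`
and in `F`, follow from it. -/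
theorem exists_epsWeight_pairingIntegrand_bound (K : CCSExhaustion Γ) (χ : 𝓢(Rd d, ℂ)) {η : Rd d}
    (hη : η ∈ Γ) {B : Set 𝓢(Rd d, ℂ)} (hB : Bornology.IsVonNBounded ℂ B) :
    ∃ i, ∀ φ ∈ B, ∀ (F : Rd d × Rd d → ℂ) (S : ℝ), (∀ p, ‖F p‖ * (epsWeight K i p : ℝ) ≤ S) →
      ∀ p, ‖pairingIntegrand χ η F φ p‖ ≤ S * decayWeight p := by
  obtain ⟨N, hN⟩ := K.exists_mem hη
  obtain ⟨v, hv, hvB⟩ := SchwartzMap.exists_rapidlyDecreasing_bound_crossTransform χ hB (d + 1)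
  refine ⟨(N, ⟨v, hv⟩), fun φ hφ F S hS p => ?_⟩
  have h1 : Real.exp (-inner ℝ η p.1) ≤ K.weights.weight N p.1 :=
    Real.exp_le_exp.2 (neg_inner_le_supportingFunction (K.isCompact N) hN p.1)
  have h2 : ‖crossTransform χ φ p‖ ≤ v p.2 * decayWeight p := le_mul_decayWeight (hvB φ hφ p)
  have h3 := decayWeight_nonneg p
  rw [pairingIntegrand, norm_mul, norm_mul, Complex.norm_exp, ← Complex.ofReal_neg,
    Complex.ofReal_re]
  calc _ ≤ ‖F p‖ * (K.weights.weight N p.1 * (v p.2 * decayWeight p)) := by gcongr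
    _ = (‖F p‖ * (epsWeight K (N, ⟨v, hv⟩) p : ℝ)) * decayWeight p := by
        rw [coe_epsWeight]
        ring
    _ ≤ _ := mul_le_mul_of_nonneg_right (hS p) h3

theorem integrable_pairingIntegrand (K : CCSExhaustion Γ) (χ : 𝓢(Rd d, ℂ)) {η : Rd d} (hη : η ∈ Γ)
    (F : EpsModel K) (φ : 𝓢(Rd d, ℂ)) :
    Integrable (pairingIntegrand χ η (MultiC.toCont F) φ) := by
  obtain ⟨i, hi⟩ := exists_epsWeight_pairingIntegrand_bound K χ hη
    (Bornology.isVonNBounded_singleton (𝕜 := ℂ) φ)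
  obtain ⟨S, hS⟩ := F.exists_bound i
  exact (integrable_decayWeight.const_mul S).mono'
    (continuous_pairingIntegrand χ η (map_continuous _) φ).aestronglyMeasurable
    (Eventually.of_forall (hi φ rfl _ S hS))

theorem norm_integral_pairingIntegrand_le {χ : 𝓢(Rd d, ℂ)} {η : Rd d} {F : Rd d × Rd d → ℂ}
    {φ : 𝓢(Rd d, ℂ)} {S : ℝ} (h : ∀ p, ‖pairingIntegrand χ η F φ p‖ ≤ S * decayWeight p) :
    ‖∫ p, pairingIntegrand χ η F φ p‖ ≤ S * ∫ p, decayWeight (d := d) p := by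
  rw [← integral_const_mul]
  exact norm_integral_le_of_norm_le (integrable_decayWeight.const_mul S) (Eventually.of_forall h)

/-- The linear form `φ ↦ ⟨e^{-η · x} V^* F, φ⟩`. -/
def adjointForm (K : CCSExhaustion Γ) (χ : 𝓢(Rd d, ℂ)) {η : Rd d} (hη : η ∈ Γ)
    (F : EpsModel K) : 𝓢(Rd d, ℂ) →ₗ[ℂ] ℂ where
  toFun φ := ∫ p, pairingIntegrand χ η (MultiC.toCont F) φ p
  map_add' φ φ' := by
    rw [← integral_add (integrable_pairingIntegrand K χ hη F φ)
      (integrable_pairingIntegrand K χ hη F φ')]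
    refine integral_congr_ae (Eventually.of_forall fun p => ?_)
    simp only [pairingIntegrand, crossTransform_add]
    ring
  map_smul' c φ := by
    rw [RingHom.id_apply, smul_eq_mul, ← integral_const_mul]
    refine integral_congr_ae (Eventually.of_forall fun p => ?_)
    simp only [pairingIntegrand, crossTransform_smul]
    ring

/-- On the Schwartz space a linear form that is bounded on bounded sets is continuous, and the
weight bound is uniform on bounded sets. -/
theorem continuous_adjointForm (K : CCSExhaustion Γ) (χ : 𝓢(Rd d, ℂ)) {η : Rd d} (hη : η ∈ Γ)
    (F : EpsModel K) : Continuous (adjointForm K χ hη F) := by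
  refine LinearMap.continuous_of_locally_bounded (𝕜 := ℂ) (𝕜' := ℂ) _ fun B hB => ?_
  obtain ⟨i, hi⟩ := exists_epsWeight_pairingIntegrand_bound K χ hη hB
  obtain ⟨S, hS⟩ := F.exists_bound i
  refine (NormedSpace.isVonNBounded_iff' ℂ).2 ⟨S * ∫ p, decayWeight (d := d) p, ?_⟩
  rintro _ ⟨φ, hφ, rfl⟩
  exact norm_integral_pairingIntegrand_le (hi φ hφ _ S hS)

/-- The map `F ↦ e^{-η · x} V^* F` from the model space to the tempered distributions. -/
def adjointTemp (K : CCSExhaustion Γ) (χ : 𝓢(Rd d, ℂ)) {η : Rd d} (hη : η ∈ Γ) :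
    EpsModel K →ₗ[ℂ] Temp d where
  toFun F := ⟨adjointForm K χ hη F, continuous_adjointForm K χ hη F⟩
  map_add' F G := by
    ext φ
    refine Eq.trans ?_ (integral_add (integrable_pairingIntegrand K χ hη F φ)
      (integrable_pairingIntegrand K χ hη G φ))
    exact integral_congr_ae (Eventually.of_forall fun p => add_mul _ _ _)
  map_smul' c F := by
    ext φ
    refine Eq.trans ?_ (integral_const_mul c _)
    exact integral_congr_ae (Eventually.of_forall fun p => mul_assoc _ _ _)

theorem adjointTemp_apply (K : CCSExhaustion Γ) (χ : 𝓢(Rd d, ℂ)) {η : Rd d} (hη : η ∈ Γ)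
    (F : EpsModel K) (φ : 𝓢(Rd d, ℂ)) :
    adjointTemp K χ hη F φ = ∫ p, pairingIntegrand χ η (MultiC.toCont F) φ p := rfl

theorem continuous_adjointTemp (K : CCSExhaustion Γ) (χ : 𝓢(Rd d, ℂ)) {η : Rd d} (hη : η ∈ Γ) :
    Continuous (adjointTemp K χ hη) := by
  refine continuous_of_continuousAt_zero (adjointTemp K χ hη) ?_
  rw [ContinuousAt, map_zero]
  refine ContinuousLinearMap.hasBasis_nhds_zero.tendsto_right_iff.2 ?_
  rintro ⟨B, U⟩ ⟨hB, hU⟩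
  obtain ⟨ε, hε, hεU⟩ := Metric.mem_nhds_iff.1 hU
  obtain ⟨i, hi⟩ := exists_epsWeight_pairingIntegrand_bound K χ hη hB
  have hI : 0 ≤ ∫ p, decayWeight (d := d) p := integral_nonneg decayWeight_nonneg
  set I := ∫ p, decayWeight (d := d) p with hIdef
  have hδ : 0 < ε / (I + 1) := by positivity
  filter_upwards [MultiC.tendsto_iff_norm.1 (tendsto_id (x := 𝓝 (0 : EpsModel K))) i _ hδ]
    with F hF φ hφ
  refine hεU ?_
  rw [mem_ball_zero_iff, adjointTemp_apply]
  refine (norm_integral_pairingIntegrand_le (hi φ hφ _ (ε / (I + 1)) fun p => ?_)).trans_lt ?_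
  · have := (hF p).le
    rwa [zero_sub, map_neg, ContinuousMap.neg_apply, norm_neg] at this
  · rw [← hIdef, div_mul_eq_mul_div, div_lt_iff₀ (by positivity)]
    exact mul_lt_mul_of_pos_left (lt_add_one I) hε

theorem pairingIntegrand_expTwist (ψ φ : TestFn d) (η : Rd d) (F : Rd d × Rd d → ℂ) :
    pairingIntegrand (expTwist η ψ).toSchwartz η F φ.toSchwartz =
      adjointIntegrand ψ F (expTwist η φ) := by
  funext p
  rw [pairingIntegrand, adjointIntegrand, stftFun_conj_neg, exp_mul_crossTransform_expTwist]

theorem integrable_adjointIntegrand (K : CCSExhaustion Γ) (hne : Γ.Nonempty) (ψ φ : TestFn d)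
    (F : EpsModel K) : Integrable (adjointIntegrand ψ (MultiC.toCont F) φ) := by
  have h := integrable_pairingIntegrand K (expTwist hne.some ψ).toSchwartz hne.some_mem F
    (expTwist (-hne.some) φ).toSchwartz
  rwa [pairingIntegrand_expTwist, expTwist_expTwist_neg] at h

/-- The distribution `V_ψ^* F`. -/
def adjointDistr (K : CCSExhaustion Γ) (hne : Γ.Nonempty) (ψ : TestFn d) (F : EpsModel K) :
    Distr d :=
  (adjointTemp K (expTwist hne.some ψ).toSchwartz hne.some_mem F).twistDistr (-hne.some)

theorem adjointDistr_apply (K : CCSExhaustion Γ) (hne : Γ.Nonempty) (ψ : TestFn d)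
    (F : EpsModel K) (φ : TestFn d) :
    adjointDistr K hne ψ F φ = ∫ p, adjointIntegrand ψ (MultiC.toCont F) φ p := by
  rw [adjointDistr, Temp.twistDistr_apply, adjointTemp_apply, pairingIntegrand_expTwist,
    expTwist_expTwist_neg]

/-- The distribution is built from one chosen point of Γ, yet its values are integrals not involving
that point; hence every `η ∈ Γ` gives a tempered twist. -/
theorem isExpTwist_adjointTemp (K : CCSExhaustion Γ) (hne : Γ.Nonempty) (ψ : TestFn d)
    (F : EpsModel K) {η : Rd d} (hη : η ∈ Γ) :
    IsExpTwist (adjointDistr K hne ψ F) η (adjointTemp K (expTwist η ψ).toSchwartz hη F) := by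
  intro φ
  rw [adjointDistr_apply, adjointTemp_apply, pairingIntegrand_expTwist]

/-- The adjoint short-time Fourier transform on the model space. -/
def adjointModel (K : CCSExhaustion Γ) (hne : Γ.Nonempty) (ψ : TestFn d) :
    EpsModel K →ₗ[ℂ] LaplaceDistr Γ where
  toFun F := ⟨adjointDistr K hne ψ F, fun _ hη => ⟨_, isExpTwist_adjointTemp K hne ψ F hη⟩⟩
  map_add' F G := Subtype.ext <| by
    ext φ
    exact congrArg (fun u : Temp d => u (expTwist (-hne.some) φ).toSchwartz)
      (map_add (adjointTemp K (expTwist hne.some ψ).toSchwartz hne.some_mem) F G)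
  map_smul' c F := Subtype.ext <| by
    ext φ
    exact congrArg (fun u : Temp d => u (expTwist (-hne.some) φ).toSchwartz)
      (map_smul (adjointTemp K (expTwist hne.some ψ).toSchwartz hne.some_mem) c F)

theorem IsExpTwist.unique {f : Distr d} {η : Rd d} {u w : Temp d} (hu : IsExpTwist f η u)
    (hw : IsExpTwist f η w) : u = w :=
  Temp.ext_testFn fun φ => (hu φ).trans (hw φ).symm

theorem continuous_adjointModel (K : CCSExhaustion Γ) (hne : Γ.Nonempty) (ψ : TestFn d) :
    Continuous (adjointModel K hne ψ) := by
  refine continuous_iInf_rng.2 fun η => continuous_induced_rng.2 ?_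
  refine (continuous_adjointTemp K (expTwist (η : Rd d) ψ).toSchwartz η.2).congr fun F => ?_
  -- The topology refers to a chosen twist; density of the test functions identifies it with the
  -- explicit one.
  exact (isExpTwist_adjointTemp K hne ψ F η.2).unique
    (LaplaceDistr.twist_spec η (adjointModel K hne ψ F))

/-- The identification of the completed tensor product with the model space, as a linear map. -/
def completedToModel (K : CCSExhaustion Γ) (hopen : IsOpen Γ) :
    CGammaTensorPol K →L[ℂ] EpsModel K where
  toFun := completedEquivModel K hopen
  map_add' u w := MultiC.toCont_injective <| ContinuousMap.ext fun p => by
    rw [map_add MultiC.toCont, ContinuousMap.add_apply, ← toFunction_eq, ← toFunction_eq, ← toFunction_eq,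
      toFunction_add]
  map_smul' c u := MultiC.toCont_injective <| ContinuousMap.ext fun p => by
    rw [RingHom.id_apply, map_smul MultiC.toCont, ContinuousMap.smul_apply, ← toFunction_eq, ← toFunction_eq,
      toFunction_smul, smul_eq_mul]
  cont := (completedEquivModel K hopen).continuous

theorem toCont_completedToModel (K : CCSExhaustion Γ) (hopen : IsOpen Γ) (u : CGammaTensorPol K) :
    ⇑(MultiC.toCont (completedToModel K hopen u)) = toFunction u :=
  funext fun p => (toFunction_eq K hopen u p).symm

theorem exists_adjointSTFT (K : CCSExhaustion Γ) (hne : Γ.Nonempty) (hopen : IsOpen Γ)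
    (ψ : TestFn d) : ∃ S : CGammaTensorPol K →L[ℂ] LaplaceDistr Γ, ∀ u : CGammaTensorPol K,
      IsAdjointSTFT ψ (toFunction u) (S u).toDistr := by
  refine ⟨(⟨adjointModel K hne ψ, continuous_adjointModel K hne ψ⟩ :
    EpsModel K →L[ℂ] LaplaceDistr Γ).comp (completedToModel K hopen), fun u φ => ?_⟩
  rw [← toCont_completedToModel K hopen u]
  exact ⟨integrable_adjointIntegrand K hne ψ φ _, adjointDistr_apply K hne ψ _ φ⟩

end AdjointSTFT

end

theorem mainTheorem2 (d : ℕ) (Γ : Set (Rd d)) (hne : Γ.Nonempty) (hopen : IsOpen Γ)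
    (hconv : Convex ℝ Γ) (K : CCSExhaustion Γ) (ψ : TestFn d) :
    -- `C_Γ ⊗̂_ε 𝒱_pol C` is a space of functions on `ℝ^{2d}`, namely the following one
    (Function.Injective (toFunction : CGammaTensorPol K → Rd d × Rd d → ℂ) ∧
      range (toFunction : CGammaTensorPol K → Rd d × Rd d → ℂ) =
        {F | Continuous F ∧ ∀ N : ℕ, ∃ (n : ℕ) (C : ℝ), ∀ x ξ : Rd d,
          ‖F (x, ξ)‖ * Real.exp (supportingFunction (-K.set N) x) * ((1 + ‖ξ‖) ^ n)⁻¹ ≤ C}) ∧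
    -- `V_ψ : 𝒮'(Γ) → C_Γ ⊗̂_ε 𝒱_pol C` is well-defined and continuous
    (∃ T : LaplaceDistr Γ →L[ℂ] CGammaTensorPol K, ∀ (f : LaplaceDistr Γ) (x ξ : Rd d),
      toFunction (T f) (x, ξ) = stftDistr ψ f.toDistr x ξ) ∧
    -- `V_ψ^* : C_Γ ⊗̂_ε 𝒱_pol C → 𝒮'(Γ)` is well-defined and continuous
    (∃ S : CGammaTensorPol K →L[ℂ] LaplaceDistr Γ, ∀ u : CGammaTensorPol K,
      IsAdjointSTFT ψ (toFunction u) (S u).toDistr) :=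
  ⟨⟨toFunction_injective K hopen, range_toFunction K hopen⟩, exists_stft K hne hopen ψ,
    exists_adjointSTFT K hne hopen ψ⟩
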